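/- **Notation.** Let $d\in\mathbb N$, $n\in\mathbb N_{\ge 1}$. For $\alpha\in(0,1]$ let $C^{n,\alpha}_0(\mathbb R^d,\mathbb R^d)$ be the space of all $C^n$-maps $f:\mathbb R^d\to\mathbb R^d$ such that $$\|f\|_{n,\alpha}:=\max\Big\{\sup_{x\in\mathbb R^d,\,0\le l\le n}\|f^{(l)}(x)\|,\ \sup_{x\ne y}\frac{\|f^{(n)}(x)-f^{(n)}(y)\|}{\|x-y\|^{\alpha}}\Big\}<\infty$$ and $f^{(l)}(x)\to 0$ as $\|x\|\to\infty$ for all $0\le l\le n$, with the norm $\|\cdot\|_{n,\alpha}$. Put $$C^{n,\beta-}_0:=\bigcap_{0<\alpha<\beta}C^{n,\alpha}_0\ \ (\beta\in(0,1]),\qquad C^{n,\beta+}_0:=\bigcup_{\beta<\alpha<1}C^{n,\alpha}_0\ \ (\beta\in[0,1)),$$ equipped with the projective limit topology and with the inductive limit topology in the category of locally convex spaces, respectively. Let $$\mathcal D^{n,\beta\pm}(\mathbb R^d):=\{\Phi\in \mathrm{Id}+C^{n,\beta\pm}_0(\mathbb R^d,\mathbb R^d):\ \det d\Phi(x)>0\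 \text{ for all } x\in\mathbb R^d\},$$ with the topology for which the map $\Phi\mapsto\Phi-\mathrm{Id}$ into $C^{n,\beta\pm}_0(\mathbb R^d,\mathbb R^d)$ is a homeomorphism onto its image. A *slowly vanishing modulus of continuity* is an increasing (i.e. non-decreasing), subadditive function $\omega:[0,\infty)\to[0,\infty)$ with $\lim_{t\to0}\omega(t)=\omega(0)=0$ and $\liminf_{t\downarrow 0}\omega(t)/t^{\gamma}>0$ for all $\gamma>0$. A *convenient vector space* is a Mackey complete Hausdorff locally convex space. A curve $c:\mathbb R\to F$ in such a space is $C^\infty$ if all its derivatives exist and are continuous, and is $C^{0,\omega}$ if for each bounded interval $I$ the set $\{(c(t)-c(s))/\omega(|t-s|): s,t\in I,\ s\neq t\}$ is bounded in $F$. A map between open subsets of convenient vector spaces is $C^{0,\omega}$ if it maps $C^\infty$-curves to $C^{0,\omega}$-curves. A group $G$ with a topology and a homeomorphism $\kappa$ from $G$ onto an open subset of a convenient vector space (a global chart) is a *$C^{0,\omega}$ Lie group* if multiplication $G\times G\to G$ and inversion $G\to G$, read in the charts $\kappa\times\kappa$ and $\kappa$, are $C^{0,\omega}$. **Theorem.**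 Let $d\in\mathbb N$, $n\in\mathbb N_{\ge1}$ and let $\omega$ be a slowly vanishing modulus of continuity. 1. For every $\beta\in(0,1]$, $C^{n,\beta-}_0(\mathbb R^d,\mathbb R^d)$ is a Fréchet space, $\mathcal D^{n,\beta-}(\mathbb R^d)$ is a group with respect to composition, and with the global chart $\Phi\mapsto\Phi-\mathrm{Id}$ into $C^{n,\beta-}_0(\mathbb R^d,\mathbb R^d)$ it is a $C^{0,\omega}$ Lie group. Moreover, $\mathcal D^{n,\beta-}(\mathbb R^d)$ is a topological group. 2. For every $\beta\in[0,1)$, $C^{n,\beta+}_0(\mathbb R^d,\mathbb R^d)$ is an (LB)-space (the locally convex inductive limit of an increasing sequence of Banach spaces), $\mathcal D^{n,\beta+}(\mathbb R^d)$ is a group with respect to composition, and with the global chart $\Phi\mapsto\Phi-\mathrm{Id}$ into $C^{n,\beta+}_0(\mathbb R^d,\mathbb R^d)$ it is a $C^{0,\omega}$ Lie group. -/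

import Mathlib

open Set Filter Topology
open scoped NNReal ENNReal

noncomputable section

/-! ### Hölder spaces of functions vanishing at infinity -/

section Holder

variable {E F : Type} [NormedAddCommGroup E] [NormedSpace ℝ E]
  [NormedAddCommGroup F] [NormedSpace ℝ F]

/-- The Hölder norm `max (sup_{x, l ≤ n} ‖f⁽ˡ⁾(x)‖) (sup_{x ≠ y} ‖f⁽ⁿ⁾(x) - f⁽ⁿ⁾(y)‖ / ‖x - y‖ ^ α)`,
as an extended nonnegative real number. -/
def eHolderCNorm (n : ℕ) (α : ℝ) (f : E → F) : ℝ≥0∞ :=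
  max (⨆ (l : ℕ) (_ : l ≤ n) (x : E), ‖iteratedFDeriv ℝ l f x‖ₑ)
    (⨆ (x : E) (y : E) (_ : x ≠ y),
      ‖iteratedFDeriv ℝ n f x - iteratedFDeriv ℝ n f y‖ₑ / ‖x - y‖ₑ ^ α)

theorem eHolderCNorm_zero (n : ℕ) (α : ℝ) : eHolderCNorm n α (0 : E → F) = 0 := by
  have h : ∀ (l : ℕ) (x : E), iteratedFDeriv ℝ l (0 : E → F) x = 0 := by
    intro l x
    exact congrFun (iteratedFDeriv_fun_zero (𝕜 := ℝ) (E := E) (F := F) (n := l)) x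
  have h0 : ∀ l : ℕ, ‖(0 : E [×l]→L[ℝ] F)‖ₑ = 0 := fun l => by
    rw [← ofReal_norm, norm_zero, ENNReal.ofReal_zero]
  simp only [eHolderCNorm, h, sub_self, h0, ENNReal.zero_div]
  simp

theorem eHolderCNorm_add_le {n : ℕ} {α : ℝ} {f g : E → F} (hf : ContDiff ℝ n f)
    (hg : ContDiff ℝ n g) :
    eHolderCNorm n α (f + g) ≤ eHolderCNorm n α f + eHolderCNorm n α g := by
  have key : ∀ l : ℕ, l ≤ n → ∀ x : E,
      iteratedFDeriv ℝ l (f + g) x = iteratedFDeriv ℝ l f x + iteratedFDeriv ℝ l g x := by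
    intro l hl x
    have hl' : ((l : ℕ) : WithTop ℕ∞) ≤ n := by exact_mod_cast hl
    exact iteratedFDeriv_add_apply (hf.of_le hl').contDiffAt (hg.of_le hl').contDiffAt
  have tri : ∀ (l : ℕ) (a b : E [×l]→L[ℝ] F), ‖a + b‖ₑ ≤ ‖a‖ₑ + ‖b‖ₑ := by
    intro l a b
    rw [← ofReal_norm, ← ofReal_norm, ← ofReal_norm,
      ← ENNReal.ofReal_add (norm_nonneg _) (norm_nonneg _)]
    exact ENNReal.ofReal_le_ofReal (norm_add_le a b)
  refine max_le ?_ ?_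
  · refine iSup_le fun l => iSup_le fun hl => iSup_le fun x => ?_
    rw [key l hl x]
    refine (tri l _ _).trans (add_le_add ?_ ?_)
    · exact le_max_of_le_left (le_iSup_of_le l (le_iSup_of_le hl (le_iSup_of_le x le_rfl)))
    · exact le_max_of_le_left (le_iSup_of_le l (le_iSup_of_le hl (le_iSup_of_le x le_rfl)))
  · refine iSup_le fun x => iSup_le fun y => iSup_le fun hxy => ?_
    rw [key n le_rfl x, key n le_rfl y, add_sub_add_comm]
    refine (ENNReal.div_le_div_right (tri n _ _) _).trans ?_
    rw [ENNReal.add_div]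
    refine add_le_add ?_ ?_
    · exact le_max_of_le_right (le_iSup_of_le x (le_iSup_of_le y (le_iSup_of_le hxy le_rfl)))
    · exact le_max_of_le_right (le_iSup_of_le x (le_iSup_of_le y (le_iSup_of_le hxy le_rfl)))

theorem eHolderCNorm_smul {n : ℕ} {α : ℝ} (c : ℝ) {f : E → F} (hf : ContDiff ℝ n f) :
    eHolderCNorm n α (c • f) = ‖c‖ₑ * eHolderCNorm n α f := by
  have key : ∀ l : ℕ, l ≤ n → ∀ x : E,
      iteratedFDeriv ℝ l (c • f) x = c • iteratedFDeriv ℝ l f x := by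
    intro l hl x
    have hl' : ((l : ℕ) : WithTop ℕ∞) ≤ n := by exact_mod_cast hl
    exact iteratedFDeriv_const_smul_apply (hf.of_le hl').contDiffAt
  unfold eHolderCNorm
  rw [mul_max, ENNReal.mul_iSup, ENNReal.mul_iSup]
  congr 1
  · refine iSup_congr fun l => ?_
    rw [ENNReal.mul_iSup]
    refine iSup_congr fun hl => ?_
    rw [ENNReal.mul_iSup]
    refine iSup_congr fun x => ?_
    rw [key l hl x, enorm_smul]
  · refine iSup_congr fun x => ?_
    rw [ENNReal.mul_iSup]
    refine iSup_congr fun y => ?_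
    rw [ENNReal.mul_iSup]
    refine iSup_congr fun hxy => ?_
    rw [key n le_rfl x, key n le_rfl y, ← smul_sub, enorm_smul, mul_div_assoc]

variable (E F) in
/-- The space `C₀^{n,α}(E, F)` as a linear subspace of the space of all functions: functions of
class `Cⁿ` with finite Hölder norm, tending to zero at infinity together with all derivatives up
to order `n`. -/
def holderZeroSubmodule (n : ℕ) (α : ℝ) : Submodule ℝ (E → F) where
  carrier := {f | ContDiff ℝ n f ∧ eHolderCNorm n α f < ⊤ ∧
    ∀ l : ℕ, l ≤ n → Tendsto (iteratedFDeriv ℝ l f) (Bornology.cobounded E) (𝓝 0)}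
  zero_mem' := by
    refine ⟨contDiff_const, by rw [eHolderCNorm_zero]; simp, fun l _ => ?_⟩
    have : iteratedFDeriv ℝ l (0 : E → F) = fun _ => 0 := by
      funext x
      exact congrFun (iteratedFDeriv_fun_zero (𝕜 := ℝ) (E := E) (F := F) (n := l)) x
    rw [this]
    exact tendsto_const_nhds
  add_mem' := by
    rintro f g ⟨hf, hf1, hf2⟩ ⟨hg, hg1, hg2⟩
    refine ⟨hf.add hg, (eHolderCNorm_add_le hf hg).trans_lt (ENNReal.add_lt_top.2 ⟨hf1, hg1⟩),
      fun l hl => ?_⟩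
    have hl' : ((l : ℕ) : WithTop ℕ∞) ≤ n := by exact_mod_cast hl
    rw [iteratedFDeriv_add (hf.of_le hl') (hg.of_le hl')]
    have h := (hf2 l hl).add (hg2 l hl)
    rw [add_zero] at h
    exact h
  smul_mem' := by
    rintro c f ⟨hf, hf1, hf2⟩
    refine ⟨contDiff_const.smul hf, ?_, fun l hl => ?_⟩
    · rw [eHolderCNorm_smul c hf]
      exact ENNReal.mul_lt_top (by simp) hf1
    · have hl' : ((l : ℕ) : WithTop ℕ∞) ≤ n := by exact_mod_cast hl
      have : iteratedFDeriv ℝ l (c • f) = fun x => c • iteratedFDeriv ℝ l f x := by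
        funext x
        exact iteratedFDeriv_const_smul_apply (hf.of_le hl').contDiffAt
      rw [this]
      simpa using (hf2 l hl).const_smul c

variable (E F) in
/-- The normed space `C₀^{n,α}(E, F)`, with the Hölder norm (`0 < α ≤ 1`). -/
def HolderZero (n : ℕ) (α : ℝ) : Type := holderZeroSubmodule E F n α

namespace HolderZero

variable {n : ℕ} {α : ℝ}

/-- Auxiliary algebraic structure, from which the normed group structure is built below. -/
@[reducible] def addCommGroupAux (n : ℕ) (α : ℝ) : AddCommGroup (HolderZero E F n α) :=
  inferInstanceAs (AddCommGroup (holderZeroSubmodule E F n α))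

/-- Auxiliary algebraic structure, from which the normed space structure is built below. -/
@[reducible] def moduleAux (n : ℕ) (α : ℝ) :
    @Module ℝ (HolderZero E F n α) _ (addCommGroupAux n α).toAddCommMonoid :=
  inferInstanceAs (Module ℝ (holderZeroSubmodule E F n α))

instance : Norm (HolderZero E F n α) := ⟨fun f => (eHolderCNorm n α f.1).toReal⟩

theorem core (n : ℕ) (α : ℝ) :
    @NormedSpace.Core ℝ (HolderZero E F n α) _ (addCommGroupAux n α) (moduleAux n α) _ := by
  let _ := addCommGroupAux (E := E) (F := F) n α
  let _ := moduleAux (E := E) (F := F) n α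
  refine { norm_nonneg := fun f => ENNReal.toReal_nonneg, norm_smul := ?_, norm_triangle := ?_,
           norm_eq_zero_iff := ?_ }
  · intro c f
    change (eHolderCNorm n α (c • f.1)).toReal = _ * (eHolderCNorm n α f.1).toReal
    rw [eHolderCNorm_smul c f.2.1, ENNReal.toReal_mul, toReal_enorm]
  · intro f g
    change (eHolderCNorm n α (f.1 + g.1)).toReal ≤
      (eHolderCNorm n α f.1).toReal + (eHolderCNorm n α g.1).toReal
    rw [← ENNReal.toReal_add f.2.2.1.ne g.2.2.1.ne]
    exact ENNReal.toReal_mono (ENNReal.add_lt_top.2 ⟨f.2.2.1, g.2.2.1⟩).ne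
      (eHolderCNorm_add_le f.2.1 g.2.1)
  · intro f
    change (eHolderCNorm n α f.1).toReal = 0 ↔ _
    rw [ENNReal.toReal_eq_zero_iff, or_iff_left f.2.2.1.ne]
    constructor
    · intro h
      refine Subtype.ext (funext fun x => ?_)
      have h1 : ‖iteratedFDeriv ℝ 0 f.1 x‖ₑ ≤ eHolderCNorm n α f.1 :=
        le_max_of_le_left (le_iSup_of_le 0 (le_iSup_of_le (Nat.zero_le n)
          (le_iSup_of_le x le_rfl)))
      rw [h] at h1
      have h2 : ‖iteratedFDeriv ℝ 0 f.1 x‖ = 0 := by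
        rw [← toReal_enorm, le_zero_iff.1 h1, ENNReal.toReal_zero]
      rw [norm_iteratedFDeriv_zero] at h2
      exact norm_eq_zero.1 h2
    · rintro rfl
      exact eHolderCNorm_zero n α

instance : NormedAddCommGroup (HolderZero E F n α) :=
  @NormedAddCommGroup.ofCore ℝ _ _ (addCommGroupAux n α) (moduleAux n α) _ (core n α)

instance : NormedSpace ℝ (HolderZero E F n α) :=
  @NormedSpace.ofCore ℝ _ _ _ (moduleAux n α) (core n α)

end HolderZero

end Holder

/-! ### Locally convex spaces and convenient calculus -/

section Convenient

universe u v

/-- The inductive locally convex topology: the finest locally convex vector space topology on `V`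
for which all linear maps `j i : X i → V` are continuous. (In the order of topologies used here,
finer topologies are smaller, and the infimum below is again such a topology.) -/
@[reducible] def lcFinalTopology {ι : Type*} {V : Type*} [AddCommGroup V] [Module ℝ V] {X : ι → Type*}
    [∀ i, NormedAddCommGroup (X i)] [∀ i, NormedSpace ℝ (X i)] (j : ∀ i, X i →ₗ[ℝ] V) :
    TopologicalSpace V :=
  sInf {t : TopologicalSpace V | @IsTopologicalAddGroup V t _ ∧ @ContinuousSMul ℝ V _ _ t ∧
    @LocallyConvexSpace ℝ V _ _ _ _ t ∧ ∀ i, @Continuous (X i) V _ t (j i)}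

variable (V : Type u) [AddCommGroup V] [Module ℝ V] [TopologicalSpace V]

/-- Mackey completeness: every Mackey-Cauchy sequence converges. -/
def IsMackeyComplete : Prop :=
  ∀ x : ℕ → V,
    (∃ B : Set V, Bornology.IsVonNBounded ℝ B ∧ ∃ μ : ℕ × ℕ → ℝ, Tendsto μ atTop (𝓝 0) ∧
      ∀ p q : ℕ, ∃ b ∈ B, x p - x q = μ (p, q) • b) →
    ∃ l : V, Tendsto x atTop (𝓝 l)

/-- Convenient vector spaces: Hausdorff locally convex spaces that are Mackey complete. -/
structure IsConvenient : Prop where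
  isTopologicalAddGroup : IsTopologicalAddGroup V
  continuousSMul : ContinuousSMul ℝ V
  locallyConvex : LocallyConvexSpace ℝ V
  t2 : T2Space V
  mackeyComplete : IsMackeyComplete V

/-- Fréchet spaces: metrizable locally convex spaces in which every Cauchy sequence converges. -/
structure IsFrechetSpace : Prop where
  isTopologicalAddGroup : IsTopologicalAddGroup V
  continuousSMul : ContinuousSMul ℝ V
  locallyConvex : LocallyConvexSpace ℝ V
  metrizable : TopologicalSpace.MetrizableSpace V
  complete : ∀ x : ℕ → V,
    (∀ U ∈ 𝓝 (0 : V), ∃ N : ℕ, ∀ p ≥ N, ∀ q ≥ N, x p - x q ∈ U) →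
    ∃ l : V, Tendsto x atTop (𝓝 l)

/-- (LB)-spaces: `V` is the union of an increasing sequence of continuously included Banach
spaces and carries the corresponding inductive locally convex topology. -/
def IsLBSpace : Prop :=
  ∃ (X : ℕ → Type u) (_ : ∀ k, NormedAddCommGroup (X k)) (_ : ∀ k, NormedSpace ℝ (X k))
    (j : ∀ k, X k →ₗ[ℝ] V) (i : ∀ k, X k →L[ℝ] X (k + 1)),
    (∀ k, CompleteSpace (X k)) ∧ (∀ k, Function.Injective (j k)) ∧
    (∀ k x, j (k + 1) (i k x) = j k x) ∧ (∀ v : V, ∃ k x, j k x = v) ∧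
    (inferInstance : TopologicalSpace V) = lcFinalTopology j

variable {V}
variable {W : Type v} [AddCommGroup W] [Module ℝ W] [TopologicalSpace W]

/-- `C^∞`-curves in a locally convex space: all iterated derivatives (limits of difference
quotients) exist; they are then automatically continuous. -/
def IsSmoothCurve (c : ℝ → V) : Prop :=
  ∃ D : ℕ → ℝ → V, D 0 = c ∧
    ∀ (k : ℕ) (t : ℝ), Tendsto (fun s => (s - t)⁻¹ • (D k s - D k t)) (𝓝[≠] t) (𝓝 (D (k + 1) t))

/-- `C^{0,ω}`-curves: on each bounded interval the quotients `(c(t) - c(s)) / ω(|t - s|)`, `t ≠ s`,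
form a bounded set. -/
def IsC0OmegaCurve (ω : ℝ≥0 → ℝ≥0) (c : ℝ → V) : Prop :=
  ∀ a b : ℝ, Bornology.IsVonNBounded ℝ
    {v : V | ∃ t ∈ Icc a b, ∃ s ∈ Icc a b, t ≠ s ∧ v = (ω (nndist t s) : ℝ)⁻¹ • (c t - c s)}

/-- `C^{0,ω}`-mappings between sets `X` and `Y` with global charts `κ : X → V` and `κ' : Y → W`:
those which map `C^∞`-curves to `C^{0,ω}`-curves, both read in the charts. -/
def IsC0OmegaMap (ω : ℝ≥0 → ℝ≥0) {X Y : Type*} (κ : X → V) (κ' : Y → W) (f : X → Y) : Prop :=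
  ∀ c : ℝ → X, IsSmoothCurve (fun t => κ (c t)) → IsC0OmegaCurve ω (fun t => κ' (f (c t)))

/-- The group `G`, with its topology, is a `C^{0,ω}` Lie group with global chart `κ`: the chart is
a homeomorphism onto an open (hence `c^∞`-open) subset of a convenient vector space, and
multiplication and inversion are `C^{0,ω}`. The chart of the product manifold `G × G` is
`κ × κ`. -/
structure IsC0OmegaLieGroup (ω : ℝ≥0 → ℝ≥0) {G : Type*} [Group G] [TopologicalSpace G]
    (κ : G → V) : Prop where
  convenient : IsConvenient V
  chart : IsOpenEmbedding κ
  mul : IsC0OmegaMap ω (Prod.map κ κ) κ (fun p : G × G => p.1 * p.2)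
  inv : IsC0OmegaMap ω κ κ (fun g : G => g⁻¹)

/-- Slowly vanishing moduli of continuity. -/
structure IsSlowlyVanishing (ω : ℝ≥0 → ℝ≥0) : Prop where
  map_zero : ω 0 = 0
  tendsto_zero : Tendsto ω (𝓝 0) (𝓝 0)
  increasing : Monotone ω
  subadditive : ∀ s t, ω (s + t) ≤ ω s + ω t
  liminf_pos : ∀ γ : ℝ, 0 < γ →
    0 < liminf (fun t : ℝ≥0 => ((ω t / t ^ γ : ℝ≥0) : ℝ≥0∞)) (𝓝[>] 0)

end Convenient

/-! ### Intermediate Hölder spaces on Euclidean space -/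

/-- Euclidean space `ℝᵈ`. -/
abbrev Euc (d : ℕ) : Type := EuclideanSpace ℝ (Fin d)

/-- `C₀^{n,β-}(ℝᵈ, ℝᵈ)`, the intersection of all `C₀^{n,α}(ℝᵈ, ℝᵈ)` with `0 < α < β`. -/
def holderMinusSubmodule (d n : ℕ) (β : ℝ) : Submodule ℝ (Euc d → Euc d) :=
  ⨅ α : Ioo 0 β, holderZeroSubmodule (Euc d) (Euc d) n α

/-- `C₀^{n,β+}(ℝᵈ, ℝᵈ)`, the union of all `C₀^{n,α}(ℝᵈ, ℝᵈ)` with `β < α < 1`, written as a supremum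
of subspaces; it is the set-theoretic union by `mem_holderPlusSubmodule`. -/
def holderPlusSubmodule (d n : ℕ) (β : ℝ) : Submodule ℝ (Euc d → Euc d) :=
  ⨆ α : Ioo β 1, holderZeroSubmodule (Euc d) (Euc d) n α

theorem holderZeroSubmodule_anti {d n : ℕ} {α α' : ℝ} (h0 : 0 ≤ α) (h : α ≤ α') :
    holderZeroSubmodule (Euc d) (Euc d) n α' ≤ holderZeroSubmodule (Euc d) (Euc d) n α := by
  rintro f ⟨hf, hf1, hf2⟩
  refine ⟨hf, ?_, hf2⟩
  have hb : ∀ x, ‖iteratedFDeriv ℝ n f x‖ₑ ≤ eHolderCNorm n α' f := fun x =>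
    le_max_of_le_left (le_iSup_of_le n (le_iSup_of_le le_rfl (le_iSup_of_le x le_rfl)))
  have hle : eHolderCNorm n α f ≤ eHolderCNorm n α' f + eHolderCNorm n α' f := by
    refine max_le ((le_max_left _ _).trans le_self_add) ?_
    refine iSup_le fun x => iSup_le fun y => iSup_le fun hxy => ?_
    rcases le_total ‖x - y‖ₑ 1 with h1 | h1
    · refine le_trans ?_ (le_self_add (b := eHolderCNorm n α' f))
      refine (ENNReal.div_le_div_left (ENNReal.rpow_le_rpow_of_exponent_ge h1 h) _).trans ?_
      exact le_max_of_le_right (le_iSup_of_le x (le_iSup_of_le y (le_iSup_of_le hxy le_rfl)))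
    · have h2 : (1 : ℝ≥0∞) ≤ ‖x - y‖ₑ ^ α := by
        simpa using ENNReal.rpow_le_rpow h1 h0
      refine (ENNReal.div_le_div_left h2 _).trans ?_
      rw [div_one]
      exact (enorm_sub_le).trans (add_le_add (hb x) (hb y))
  exact hle.trans_lt (ENNReal.add_lt_top.2 ⟨hf1, hf1⟩)

theorem mem_holderMinusSubmodule {d n : ℕ} {β : ℝ} {f : Euc d → Euc d} :
    f ∈ holderMinusSubmodule d n β ↔
      ∀ α ∈ Ioo 0 β, f ∈ holderZeroSubmodule (Euc d) (Euc d) n α := by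
  simp only [holderMinusSubmodule, Submodule.mem_iInf, Subtype.forall]

theorem mem_holderPlusSubmodule {d n : ℕ} {β : ℝ} (hβ : β ∈ Ico (0 : ℝ) 1) {f : Euc d → Euc d} :
    f ∈ holderPlusSubmodule d n β ↔
      ∃ α ∈ Ioo β 1, f ∈ holderZeroSubmodule (Euc d) (Euc d) n α := by
  have : Nonempty (Ioo β 1) := (nonempty_Ioo.2 hβ.2).to_subtype
  rw [holderPlusSubmodule, Submodule.mem_iSup_of_directed]
  · simp only [Subtype.exists, exists_prop]
  · intro a b
    refine ⟨⟨min a b, lt_min a.2.1 b.2.1, (min_le_left _ _).trans_lt a.2.2⟩, ?_, ?_⟩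
    · exact holderZeroSubmodule_anti (hβ.1.trans (lt_min a.2.1 b.2.1).le) (min_le_left _ _)
    · exact holderZeroSubmodule_anti (hβ.1.trans (lt_min a.2.1 b.2.1).le) (min_le_right _ _)

/-- The space `C₀^{n,β-}(ℝᵈ, ℝᵈ)` with its projective topology (see below). -/
def HolderMinus (d n : ℕ) (β : ℝ) : Type := holderMinusSubmodule d n β

/-- The space `C₀^{n,β+}(ℝᵈ, ℝᵈ)` with its inductive locally convex topology (see below). -/
def HolderPlus (d n : ℕ) (β : ℝ) : Type := holderPlusSubmodule d n β

section Spaces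

variable (d n : ℕ) (β : ℝ)

instance : AddCommGroup (HolderMinus d n β) :=
  inferInstanceAs (AddCommGroup (holderMinusSubmodule d n β))

instance : Module ℝ (HolderMinus d n β) :=
  inferInstanceAs (Module ℝ (holderMinusSubmodule d n β))

instance : AddCommGroup (HolderPlus d n β) :=
  inferInstanceAs (AddCommGroup (holderPlusSubmodule d n β))

instance : Module ℝ (HolderPlus d n β) :=
  inferInstanceAs (Module ℝ (holderPlusSubmodule d n β))

/-- The inclusion of `C₀^{n,β-}` into `C₀^{n,α}`, for `0 < α < β`. -/
def HolderMinus.toStep (α : Ioo 0 β) :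
    HolderMinus d n β →ₗ[ℝ] HolderZero (Euc d) (Euc d) n (α : ℝ) where
  toFun f := ⟨f.1, iInf_le (fun a : Ioo 0 β => holderZeroSubmodule (Euc d) (Euc d) n a) α f.2⟩
  map_add' _ _ := rfl
  map_smul' _ _ := rfl

/-- The inclusion of `C₀^{n,α}` into `C₀^{n,β+}`, for `β < α < 1`. -/
def HolderPlus.ofStep (α : Ioo β 1) :
    HolderZero (Euc d) (Euc d) n (α : ℝ) →ₗ[ℝ] HolderPlus d n β where
  toFun f := ⟨f.1, le_iSup (fun a : Ioo β 1 => holderZeroSubmodule (Euc d) (Euc d) n a) α f.2⟩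
  map_add' _ _ := rfl
  map_smul' _ _ := rfl

/-- The projective limit topology. -/
instance : TopologicalSpace (HolderMinus d n β) :=
  ⨅ α : Ioo 0 β, TopologicalSpace.induced (HolderMinus.toStep d n β α) inferInstance

/-- The inductive limit topology, in the category of locally convex spaces. -/
instance : TopologicalSpace (HolderPlus d n β) :=
  lcFinalTopology (HolderPlus.ofStep d n β)

/-- The set `𝒟^{n,β-}(ℝᵈ)` of all `Φ ∈ Id + C₀^{n,β-}(ℝᵈ, ℝᵈ)` with `det dΦ(x) > 0` for all `x`. -/
def DiffMinus : Type :=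
  {Φ : Euc d → Euc d // Φ - id ∈ holderMinusSubmodule d n β ∧ ∀ x, 0 < (fderiv ℝ Φ x).det}

/-- The set `𝒟^{n,β+}(ℝᵈ)` of all `Φ ∈ Id + C₀^{n,β+}(ℝᵈ, ℝᵈ)` with `det dΦ(x) > 0` for all `x`. -/
def DiffPlus : Type :=
  {Φ : Euc d → Euc d // Φ - id ∈ holderPlusSubmodule d n β ∧ ∀ x, 0 < (fderiv ℝ Φ x).det}

/-- The global chart `Φ ↦ Φ - Id` of `𝒟^{n,β-}(ℝᵈ)`. -/
def DiffMinus.chart (Φ : DiffMinus d n β) : HolderMinus d n β := ⟨Φ.1 - id, Φ.2.1⟩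

/-- The global chart `Φ ↦ Φ - Id` of `𝒟^{n,β+}(ℝᵈ)`. -/
def DiffPlus.chart (Φ : DiffPlus d n β) : HolderPlus d n β := ⟨Φ.1 - id, Φ.2.1⟩

instance : TopologicalSpace (DiffMinus d n β) :=
  TopologicalSpace.induced (DiffMinus.chart d n β) inferInstance

instance : TopologicalSpace (DiffPlus d n β) :=
  TopologicalSpace.induced (DiffPlus.chart d n β) inferInstance

end Spaces

end

/-!
Write a diffeomorphism as `id + f`. Everything is read off from estimates in the predicate
`HolderBound n α C f`, which says that `f` is bounded by `C` in `C₀^{n,α}`; it is recursive in `n`,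
so that the estimates are proved by induction over `n` with the chain rule as the step.

*Multiplication.* For `g` in bounded sets of `C^{n,α}`, the composition `f ∘ (id + g)` is bounded in
`C^{n,α}`, linearly in `f` (`HolderBound.exists_comp`). In `g` it is not continuous into `C^{n,α}`,
but it is `α`-Hölder into `Cⁿ` (`HolderBound.exists_comp_sub`), and interpolating between `Cⁿ` and
`C^{n,α}` (`HolderBound.interpolate`) shows that it is `(α - α')`-Hölder into `C^{n,α'}` for every
`α' < α` (`HolderBound.exists_comp_sub_rpow`). Thus an arbitrarily small loss in the exponent buys
some Hölder continuity, and such a loss is harmless in the spaces `C₀^{n,β±}`.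

*Inversion.* If `det (1 + df) > 0`, then `id + f` is a proper local diffeomorphism, hence bijective.
With the inverse written as `id + h`, one has `dh = (1 + df ∘ (id + h))⁻¹ - 1`, by which a bound on
`h` in `C^{k,α}` improves to one in `C^{k+1,α}` (`HolderBound.exists_inverse_map`). The bound
depends only on `f` in `C^{n,α}` and on the supremum of `(1 + df)⁻¹`, which is locally uniform as
`df` vanishes at infinity. The Hölder continuity of inversion follows from that of composition
(`HolderBound.exists_inv_sub`).

*Curves.* A smooth curve in `C₀^{n,β-}` is locally Lipschitz in each step `C₀^{n,α}`. A smooth curve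
in `C₀^{n,β+}` is locally Lipschitz in one of the steps, since this inductive limit is regular:
bounded sets are contained and bounded in a step (`HolderPlus.exists_bound`). Regularity also gives
Mackey completeness of `C₀^{n,β+}`. Products and inverses of such curves are therefore Hölder curves
in slightly larger steps, and Hölder curves are `C^{0,ω}`, because `ω` vanishes more slowly
than any power (`IsSlowlyVanishing.exists_inv_mul_rpow_le`).
-/

noncomputable section

/-! ### Hölder bounds -/

section HolderBound

variable {E : Type} [NormedAddCommGroup E] [NormedSpace ℝ E]

/-- `HolderBound n α C f`: the function `f` is of class `Cⁿ`, it tends to zero at infinity together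
with its derivatives up to order `n`, these derivatives are bounded by `C`, and the `n`-th one is
`α`-Hölder with constant `C`. The recursion over `n` passes from `f` to `fderiv ℝ f`; see
`holderBound_iff` for the description by iterated derivatives. The exponent `α = 0` is allowed, and
gives bounds in `Cⁿ`. -/
def HolderBound : ∀ (_ : ℕ) {F : Type} [NormedAddCommGroup F] [NormedSpace ℝ F] (_ _ : ℝ)
    (_ : E → F), Prop
  | 0, _, _, _, α, C, f => Continuous f ∧ (∀ x, ‖f x‖ ≤ C) ∧
      Tendsto f (Bornology.cobounded E) (𝓝 0) ∧ ∀ x y, ‖f x - f y‖ ≤ C * ‖x - y‖ ^ α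
  | n + 1, _, _, _, α, C, f => Differentiable ℝ f ∧ (∀ x, ‖f x‖ ≤ C) ∧
      Tendsto f (Bornology.cobounded E) (𝓝 0) ∧ HolderBound n α C (fderiv ℝ f)

namespace HolderBound

variable {F : Type} [NormedAddCommGroup F] [NormedSpace ℝ F]
  {G : Type} [NormedAddCommGroup G] [NormedSpace ℝ G]
  {H : Type} [NormedAddCommGroup H] [NormedSpace ℝ H]
  {n : ℕ} {α C : ℝ} {f : E → F}

theorem continuous (h : HolderBound n α C f) : Continuous f := by
  cases n with
  | zero => exact h.1
  | succ n => exact h.1.continuous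

theorem norm_le (h : HolderBound n α C f) (x : E) : ‖f x‖ ≤ C := by
  cases n with
  | zero => exact h.2.1 x
  | succ n => exact h.2.1 x

theorem tendsto (h : HolderBound n α C f) : Tendsto f (Bornology.cobounded E) (𝓝 0) := by
  cases n with
  | zero => exact h.2.2.1
  | succ n => exact h.2.2.1

theorem nonneg (h : HolderBound n α C f) : 0 ≤ C := (norm_nonneg _).trans (h.norm_le 0)

theorem mono {C' : ℝ} (hC : C ≤ C') (h : HolderBound n α C f) : HolderBound n α C' f := by
  induction n generalizing F with
  | zero =>
    exact ⟨h.1, fun x => (h.2.1 x).trans hC, h.2.2.1, fun x y => (h.2.2.2 x y).trans (by gcongr)⟩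
  | succ n ih => exact ⟨h.1, fun x => (h.2.1 x).trans hC, h.2.2.1, ih h.2.2.2⟩

theorem add {C' : ℝ} {g : E → F} (hf : HolderBound n α C f) (hg : HolderBound n α C' g) :
    HolderBound n α (C + C') (fun x => f x + g x) := by
  have hb : ∀ x, ‖f x + g x‖ ≤ C + C' := fun x =>
    (norm_add_le _ _).trans (add_le_add (hf.norm_le x) (hg.norm_le x))
  have ht : Tendsto (fun x => f x + g x) (Bornology.cobounded E) (𝓝 0) := by
    simpa using hf.tendsto.add hg.tendsto
  induction n generalizing F with
  | zero =>
    refine ⟨hf.1.add hg.1, hb, ht, fun x y => ?_⟩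
    rw [add_sub_add_comm, add_mul]
    exact (norm_add_le _ _).trans (add_le_add (hf.2.2.2 x y) (hg.2.2.2 x y))
  | succ n ih =>
    refine ⟨hf.1.add hg.1, hb, ht, ?_⟩
    have e : fderiv ℝ (fun x => f x + g x) = fun x => fderiv ℝ f x + fderiv ℝ g x := by
      funext x
      exact fderiv_fun_add (hf.1 x) (hg.1 x)
    rw [e]
    have h1 := hf.2.2.2
    have h2 := hg.2.2.2
    exact ih h1 h2 (fun x => (norm_add_le _ _).trans (add_le_add (h1.norm_le x) (h2.norm_le x)))
      (by simpa using h1.tendsto.add h2.tendsto)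

theorem neg (h : HolderBound n α C f) : HolderBound n α C (fun x => -f x) := by
  induction n generalizing F with
  | zero =>
    refine ⟨h.1.neg, fun x => by simpa using h.2.1 x, by simpa using h.2.2.1.neg, fun x y => ?_⟩
    rw [neg_sub_neg, norm_sub_rev]
    exact h.2.2.2 x y
  | succ n ih =>
    refine ⟨h.1.neg, fun x => by simpa using h.2.1 x, by simpa using h.2.2.1.neg, ?_⟩
    have e : fderiv ℝ (fun x => -f x) = fun x => -fderiv ℝ f x := by
      funext x
      exact fderiv_fun_neg
    rw [e]
    exact ih h.2.2.2

theorem sub {C' : ℝ} {g : E → F} (hf : HolderBound n α C f) (hg : HolderBound n α C' g) :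
    HolderBound n α (C + C') (fun x => f x - g x) := by
  simpa only [sub_eq_add_neg] using hf.add hg.neg

theorem lipschitz (h : HolderBound (n + 1) α C f) (x y : E) : ‖f x - f y‖ ≤ C * ‖x - y‖ :=
  Convex.norm_image_sub_le_of_norm_fderiv_le (fun z _ => h.1 z) (fun z _ => h.2.2.2.norm_le z)
    convex_univ (mem_univ y) (mem_univ x)

theorem norm_sub_le_two_mul (h : HolderBound n α C f) (x y : E) : ‖f x - f y‖ ≤ 2 * C := by
  have := norm_sub_le_of_le (h.norm_le x) (h.norm_le y)
  linarith

/-- A bounded function with a bound on its `α'`-Hölder quotient is `α`-Hölder for `α ≤ α'`. -/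
theorem _root_.le_two_mul_mul_rpow {a C r α α' : ℝ} (h0 : 0 ≤ α) (h : α ≤ α') (hC : 0 ≤ C)
    (hr : 0 ≤ r) (h1 : a ≤ 2 * C) (h2 : a ≤ C * r ^ α') : a ≤ 2 * C * r ^ α := by
  rcases le_total r 1 with hr1 | hr1
  · rcases hr.eq_or_lt with rfl | hr'
    · rcases h0.eq_or_lt with rfl | h0'
      · simpa using h1
      · rw [Real.zero_rpow (h0'.trans_le h).ne'] at h2
        rw [Real.zero_rpow h0'.ne']
        linarith
    · have := Real.rpow_le_rpow_of_exponent_ge hr' hr1 h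
      have h3 : 0 ≤ r ^ α := Real.rpow_nonneg hr _
      nlinarith [mul_le_mul_of_nonneg_left this hC, mul_nonneg hC h3]
  · have := Real.one_le_rpow hr1 h0
    nlinarith

theorem holder (h0 : 0 ≤ α) (h1 : α ≤ 1) (h : HolderBound n α C f) (x y : E) :
    ‖f x - f y‖ ≤ 2 * C * ‖x - y‖ ^ α := by
  cases n with
  | zero =>
    exact le_two_mul_mul_rpow h0 le_rfl h.nonneg (norm_nonneg _) (h.norm_sub_le_two_mul x y)
      (h.2.2.2 x y)
  | succ n =>
    refine le_two_mul_mul_rpow h0 h1 h.nonneg (norm_nonneg _) (h.norm_sub_le_two_mul x y) ?_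
    rw [Real.rpow_one]
    exact h.lipschitz x y

theorem of_le (h0 : 0 ≤ α) (h1 : α ≤ 1) {k : ℕ} (hk : k ≤ n) (h : HolderBound n α C f) :
    HolderBound k α (2 * C) f := by
  have hC := h.nonneg
  have hb : ∀ x, ‖f x‖ ≤ 2 * C := fun x => by linarith [h.norm_le x]
  induction k generalizing n F with
  | zero => exact ⟨h.continuous, hb, h.tendsto, h.holder h0 h1⟩
  | succ k ih =>
    obtain ⟨m, rfl⟩ := Nat.exists_eq_succ_of_ne_zero (n := n) (by lia)
    exact ⟨h.1, hb, h.tendsto, ih (n := m) (by lia) h.2.2.2 fun x => by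
      linarith [h.2.2.2.norm_le x]⟩

theorem of_succ (h0 : 0 ≤ α) (h1 : α ≤ 1) (h : HolderBound (n + 1) α C f) :
    HolderBound n α (2 * C) f := h.of_le h0 h1 n.le_succ

theorem contDiff_one (h : HolderBound (n + 1) α C f) : ContDiff ℝ 1 f :=
  contDiff_one_iff_fderiv.2 ⟨h.1, h.2.2.2.continuous⟩

theorem exponent_mono {α' : ℝ} (h0 : 0 ≤ α') (h1 : α' ≤ α) (h : HolderBound n α C f) :
    HolderBound n α' (2 * C) f := by
  have hC := h.nonneg
  have hb : ∀ x, ‖f x‖ ≤ 2 * C := fun x => by linarith [h.norm_le x]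
  induction n generalizing F with
  | zero =>
    exact ⟨h.continuous, hb, h.tendsto, fun x y => le_two_mul_mul_rpow h0 h1 hC (norm_nonneg _)
      (h.norm_sub_le_two_mul x y) (h.2.2.2 x y)⟩
  | succ n ih =>
    exact ⟨h.1, hb, h.tendsto, ih h.2.2.2 fun x => by linarith [h.2.2.2.norm_le x]⟩

/-- Interpolation: a function bounded in `C^{n,α}` and small in `Cⁿ` is small in `C^{n,α'}` for
`α' < α`. -/
theorem interpolate {α' ε : ℝ} (h0 : 0 ≤ α') (h1 : α' ≤ α) (hα : 0 < α) (hε : 0 ≤ ε) (hε1 : ε ≤ 1)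
    (h : HolderBound n α C f) (h' : HolderBound n 0 (C * ε) f) :
    HolderBound n α' (C * ε ^ (1 - α' / α)) f := by
  have hC := h.nonneg
  have hθ1 : α' / α ≤ 1 := (div_le_one hα).2 h1
  have hθ0 : 0 ≤ α' / α := div_nonneg h0 hα.le
  have key : ε ≤ ε ^ (1 - α' / α) := by
    rcases hε.eq_or_lt with rfl | hε
    · exact Real.rpow_nonneg le_rfl _
    · simpa using Real.rpow_le_rpow_of_exponent_ge hε hε1 (show 1 - α' / α ≤ 1 by linarith)
  have hb : ∀ x, ‖f x‖ ≤ C * ε ^ (1 - α' / α) := fun x =>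
    (h'.norm_le x).trans (mul_le_mul_of_nonneg_left key hC)
  induction n generalizing F with
  | zero =>
    refine ⟨h.1, hb, h.2.2.1, fun x y => ?_⟩
    have a1 := h.2.2.2 x y
    have a2 := h'.2.2.2 x y
    rw [Real.rpow_zero, mul_one] at a2
    have e : ‖f x - f y‖ = ‖f x - f y‖ ^ (α' / α) * ‖f x - f y‖ ^ (1 - α' / α) := by
      rw [← Real.rpow_add_of_nonneg (norm_nonneg _) hθ0 (by linarith)]
      simp
    have hr := norm_nonneg (x - y)
    calc ‖f x - f y‖ = _ := e
      _ ≤ (C * ‖x - y‖ ^ α) ^ (α' / α) * (C * ε) ^ (1 - α' / α) := by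
        have : 0 ≤ 1 - α' / α := by linarith
        gcongr
      _ = C ^ (α' / α) * C ^ (1 - α' / α) * ε ^ (1 - α' / α) * (‖x - y‖ ^ α) ^ (α' / α) := by
        rw [Real.mul_rpow hC (Real.rpow_nonneg hr _), Real.mul_rpow hC hε]
        ring
      _ = C * ε ^ (1 - α' / α) * ‖x - y‖ ^ α' := by
        rw [← Real.rpow_add_of_nonneg hC hθ0 (by linarith), ← Real.rpow_mul hr,
          mul_div_cancel₀ _ hα.ne']
        simp
  | succ n ih =>
    exact ⟨h.1, hb, h.2.2.1, ih h.2.2.2 h'.2.2.2 fun x =>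
      (h'.2.2.2.norm_le x).trans (mul_le_mul_of_nonneg_left key hC)⟩

theorem norm_bilinear_le (B : F →L[ℝ] G →L[ℝ] H) {g : E → G} {C' : ℝ}
    (hf : HolderBound n α C f) (hg : HolderBound n α C' g) (x : E) :
    ‖B (f x) (g x)‖ ≤ 2 * 4 ^ n * ‖B‖ * C * C' := by
  have hC := hf.nonneg
  have hC' := hg.nonneg
  have h1 := hf.norm_le x
  have h2 := hg.norm_le x
  have h4 : (1 : ℝ) ≤ 4 ^ n := one_le_pow₀ (by norm_num)
  calc ‖B (f x) (g x)‖ ≤ ‖B‖ * ‖f x‖ * ‖g x‖ := B.le_opNorm₂ _ _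
    _ ≤ ‖B‖ * C * C' := by gcongr
    _ = 1 * (‖B‖ * C * C') := by ring
    _ ≤ 2 * 4 ^ n * (‖B‖ * C * C') := by
      gcongr
      linarith
    _ = _ := by ring

theorem tendsto_bilinear (B : F →L[ℝ] G →L[ℝ] H) {g : E → G} {C' : ℝ}
    (hf : HolderBound n α C f) (hg : HolderBound n α C' g) :
    Tendsto (fun x => B (f x) (g x)) (Bornology.cobounded E) (𝓝 0) := by
  have : Tendsto (fun x => ‖B‖ * ‖f x‖ * C') (Bornology.cobounded E) (𝓝 0) := by
    simpa using (hf.tendsto.norm.const_mul ‖B‖).mul_const C'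
  refine squeeze_zero_norm (fun x => (B.le_opNorm₂ _ _).trans ?_) this
  have := hg.norm_le x
  gcongr

/-- `C^{n,α}` is stable under products, that is, under continuous bilinear maps. Each step of the
induction costs a factor four: two summands in the product rule, and one lowering of the order. -/
theorem bilinear (B : F →L[ℝ] G →L[ℝ] H) {g : E → G} {C' : ℝ} (h0 : 0 ≤ α) (h1 : α ≤ 1)
    (hf : HolderBound n α C f) (hg : HolderBound n α C' g) :
    HolderBound n α (2 * 4 ^ n * ‖B‖ * C * C') (fun x => B (f x) (g x)) := by
  have hb := norm_bilinear_le B hf hg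
  have ht := tendsto_bilinear B hf hg
  induction n generalizing F G H C C' with
  | zero =>
    have hC := hf.nonneg
    have hC' := hg.nonneg
    refine ⟨B.continuous₂.comp (hf.1.prodMk hg.1), hb, ht, fun x y => ?_⟩
    have e : B (f x) (g x) - B (f y) (g y) = B (f x - f y) (g x) + B (f y) (g x - g y) := by
      simp
    rw [e]
    have a1 : ‖B (f x - f y) (g x)‖ ≤ ‖B‖ * (C * ‖x - y‖ ^ α) * C' :=
      (B.le_opNorm₂ _ _).trans (by
        have := hf.2.2.2 x y
        have := hg.norm_le x
        gcongr)
    have a2 : ‖B (f y) (g x - g y)‖ ≤ ‖B‖ * C * (C' * ‖x - y‖ ^ α) :=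
      (B.le_opNorm₂ _ _).trans (by
        have := hg.2.2.2 x y
        have := hf.norm_le y
        gcongr)
    refine ((norm_add_le _ _).trans (add_le_add a1 a2)).trans (le_of_eq ?_)
    ring
  | succ n ih =>
    have hd : ∀ x, HasFDerivAt (fun x => B (f x) (g x))
        (B.precompR E (f x) (fderiv ℝ g x) + B.precompL E (fderiv ℝ f x) (g x)) x := fun x =>
      B.hasFDerivAt_of_bilinear (hf.1 x).hasFDerivAt (hg.1 x).hasFDerivAt
    refine ⟨fun x => (hd x).differentiableAt, hb, ht, ?_⟩
    have e : fderiv ℝ (fun x => B (f x) (g x)) =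
        fun x => B.precompR E (f x) (fderiv ℝ g x) + B.precompL E (fderiv ℝ f x) (g x) := by
      funext x
      exact (hd x).fderiv
    rw [e]
    have hC := hf.nonneg
    have hC' := hg.nonneg
    have f1 := hf.of_succ h0 h1
    have g1 := hg.of_succ h0 h1
    have a1 := ih (B.precompR E) f1 hg.2.2.2 (norm_bilinear_le _ f1 hg.2.2.2)
      (tendsto_bilinear _ f1 hg.2.2.2)
    have a2 := ih (B.precompL E) hf.2.2.2 g1 (norm_bilinear_le _ hf.2.2.2 g1)
      (tendsto_bilinear _ hf.2.2.2 g1)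
    refine (a1.add a2).mono ?_
    calc _ ≤ 2 * 4 ^ n * ‖B‖ * (2 * C) * C' + 2 * 4 ^ n * ‖B‖ * C * (2 * C') := by
          have := B.norm_precompR_le E
          have := B.norm_precompL_le E
          gcongr
      _ = _ := by ring

/-- The product estimate for the composition of linear maps, which occurs in the chain rule. -/
theorem compL {F' : Type} [NormedAddCommGroup F'] [NormedSpace ℝ F'] {u : E → F →L[ℝ] G}
    {v : E → F' →L[ℝ] F} {C' : ℝ} (h0 : 0 ≤ α) (h1 : α ≤ 1)
    (hu : HolderBound n α C u) (hv : HolderBound n α C' v) :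
    HolderBound n α (2 * 4 ^ n * C * C') (fun x => (u x).comp (v x)) := by
  have hC := hu.nonneg
  have hC' := hv.nonneg
  refine (hu.bilinear (ContinuousLinearMap.compL ℝ F' F G) h0 h1 hv).mono ?_
  calc _ ≤ 2 * 4 ^ n * 1 * C * C' := by
        have := ContinuousLinearMap.norm_compL_le ℝ F' F G
        gcongr
    _ = _ := by ring

end HolderBound

end HolderBound

/-! ### Composition and inversion estimates -/

section Composition

theorem tendsto_id_add_cobounded {E : Type} [NormedAddCommGroup E] {g : E → E} {C : ℝ}
    (hg : ∀ x, ‖g x‖ ≤ C) :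
    Tendsto (fun x => x + g x) (Bornology.cobounded E) (Bornology.cobounded E) := by
  rw [← tendsto_norm_atTop_iff_cobounded]
  refine tendsto_atTop_mono (fun x => ?_)
    (tendsto_atTop_add_const_right _ (-C) tendsto_norm_cobounded_atTop)
  have h1 : ‖x‖ ≤ ‖x + g x‖ + ‖g x‖ := by simpa using norm_sub_le (x + g x) (g x)
  linarith [hg x]

variable {E : Type} [NormedAddCommGroup E] [NormedSpace ℝ E]

theorem hasFDerivAt_comp_id_add {F : Type} [NormedAddCommGroup F] [NormedSpace ℝ F] {f : E → F}
    {g : E → E} (hf : Differentiable ℝ f) (hg : Differentiable ℝ g) (x : E) :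
    HasFDerivAt (fun x => f (x + g x))
      (fderiv ℝ f (x + g x) + (fderiv ℝ f (x + g x)).comp (fderiv ℝ g x)) x := by
  have h : HasFDerivAt (fun x => x + g x) (ContinuousLinearMap.id ℝ E + fderiv ℝ g x) x :=
    (hasFDerivAt_id x).add (hg x).hasFDerivAt
  have := (hf (x + g x)).hasFDerivAt.comp x h
  rwa [ContinuousLinearMap.comp_add, ContinuousLinearMap.comp_id] at this

namespace HolderBound

variable {F : Type} [NormedAddCommGroup F] [NormedSpace ℝ F] {n : ℕ} {α C : ℝ}

theorem tendsto_comp {f : E → F} {g : E → E} {C' : ℝ} (hf : HolderBound n α C f)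
    (hg : HolderBound n α C' g) :
    Tendsto (fun x => f (x + g x)) (Bornology.cobounded E) (𝓝 0) :=
  hf.tendsto.comp (tendsto_id_add_cobounded hg.norm_le)

/-- `f ∘ (id + g)` is bounded in `C^{n,α}`, linearly in `f` and uniformly for `g` in bounded sets.
The Lipschitz bound on `g` follows from the other one only if `1 ≤ n`. -/
theorem exists_comp (n : ℕ) {α : ℝ} (h0 : 0 ≤ α) (h1 : α ≤ 1) {R : ℝ} (hR : 0 ≤ R) :
    ∃ C : ℝ, 1 ≤ C ∧ ∀ (F : Type) [NormedAddCommGroup F] [NormedSpace ℝ F] (f : E → F) (g : E → E)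
      (A : ℝ), HolderBound n α A f → HolderBound n α R g → (∀ x y, ‖g x - g y‖ ≤ R * ‖x - y‖) →
      HolderBound n α (C * A) (fun x => f (x + g x)) := by
  induction n generalizing R with
  | zero =>
    refine ⟨1 + R, by linarith, fun F _ _ f g A hf hg hL => ?_⟩
    have hA := hf.nonneg
    have hb : ∀ x, ‖f (x + g x)‖ ≤ (1 + R) * A := fun x => by nlinarith [hf.norm_le (x + g x)]
    refine ⟨hf.1.comp (continuous_id.add hg.1), hb, hf.tendsto_comp hg, fun x y => ?_⟩
    have e : ‖x + g x - (y + g y)‖ ≤ (1 + R) * ‖x - y‖ := by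
      rw [add_sub_add_comm, add_mul, one_mul]
      exact (norm_add_le _ _).trans (add_le_add le_rfl (hL x y))
    have e2 : (1 + R) ^ α ≤ 1 + R := by
      simpa using Real.rpow_le_rpow_of_exponent_le (show 1 ≤ 1 + R by linarith) h1
    calc ‖f (x + g x) - f (y + g y)‖ ≤ A * ‖x + g x - (y + g y)‖ ^ α := hf.2.2.2 _ _
      _ ≤ A * ((1 + R) * ‖x - y‖) ^ α := by gcongr
      _ = A * ((1 + R) ^ α * ‖x - y‖ ^ α) := by
        rw [Real.mul_rpow (by linarith) (norm_nonneg _)]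
      _ ≤ A * ((1 + R) * ‖x - y‖ ^ α) := by gcongr
      _ = _ := by ring
  | succ n ih =>
    obtain ⟨C, hC1, hC⟩ := ih (R := 2 * R) (by linarith)
    have hC0 : 0 ≤ C := by linarith
    have h4 : 0 ≤ 2 * 4 ^ n * C * R := by positivity
    refine ⟨C + 2 * 4 ^ n * C * R, by linarith, fun F _ _ f g A hf hg hL => ?_⟩
    have hA := hf.nonneg
    have hd := hasFDerivAt_comp_id_add hf.1 hg.1
    refine ⟨fun x => (hd x).differentiableAt, fun x => ?_, hf.tendsto_comp hg, ?_⟩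
    · nlinarith [hf.norm_le (x + g x), mul_nonneg h4 hA]
    · have e : fderiv ℝ (fun x => f (x + g x)) = fun x =>
          fderiv ℝ f (x + g x) + (fderiv ℝ f (x + g x)).comp (fderiv ℝ g x) := by
        funext x
        exact (hd x).fderiv
      rw [e]
      have a1 := hC _ _ g A hf.2.2.2 (hg.of_succ h0 h1) fun x y => (hL x y).trans (by
        have := norm_nonneg (x - y)
        nlinarith)
      refine (a1.add (a1.compL h0 h1 hg.2.2.2)).mono (le_of_eq ?_)
      ring

theorem _root_.le_mul_rpow_self {α δ S : ℝ} (h0 : 0 ≤ α) (h1 : α ≤ 1) (hδ : 0 ≤ δ) (hδS : δ ≤ S)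
    (hS : 1 ≤ S) : δ ≤ S * δ ^ α := by
  calc δ = δ ^ (1 - α) * δ ^ α := by
        rw [← Real.rpow_add_of_nonneg hδ (by linarith) h0]
        simp
    _ ≤ S * δ ^ α := by
      gcongr
      calc δ ^ (1 - α) ≤ S ^ (1 - α) := Real.rpow_le_rpow hδ hδS (by linarith)
        _ ≤ S ^ (1 : ℝ) := Real.rpow_le_rpow_of_exponent_le hS (by linarith)
        _ = S := Real.rpow_one S

/-- `f ∘ (id + g)` is `α`-Hölder continuous in `g` with respect to `Cⁿ` norms, if `f` is in
`C^{n,α}`. The distance `δ` of `g₁` and `g₂` is taken bounded by some `S`, so that the terms linear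
in `δ` are dominated by `δ ^ α`; the bound `S` doubles in each step of the induction. -/
theorem exists_comp_sub (n : ℕ) {α : ℝ} (h0 : 0 ≤ α) (h1 : α ≤ 1) {R : ℝ} (hR : 0 ≤ R)
    {S : ℝ} (hS : 1 ≤ S) : ∃ C : ℝ, 4 ≤ C ∧
      ∀ (F : Type) [NormedAddCommGroup F] [NormedSpace ℝ F] (f : E → F) (g₁ g₂ : E → E)
      (A δ : ℝ), δ ≤ S → HolderBound n α A f →
      HolderBound n α R g₁ → (∀ x y, ‖g₁ x - g₁ y‖ ≤ R * ‖x - y‖) →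
      HolderBound n α R g₂ → (∀ x y, ‖g₂ x - g₂ y‖ ≤ R * ‖x - y‖) →
      HolderBound n 0 δ (fun x => g₁ x - g₂ x) →
      HolderBound n 0 (C * A * δ ^ α) (fun x => f (x + g₁ x) - f (x + g₂ x)) := by
  induction n generalizing R S with
  | zero =>
    refine ⟨4, le_rfl, fun F _ _ f g₁ g₂ A δ hδS hf hg₁ _ hg₂ _ hg => ?_⟩
    have hA := hf.nonneg
    have hδ := hg.nonneg
    have hs : ∀ x, ‖f (x + g₁ x) - f (x + g₂ x)‖ ≤ A * δ ^ α := fun x => by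
      refine (hf.2.2.2 _ _).trans ?_
      have : ‖x + g₁ x - (x + g₂ x)‖ ≤ δ := by simpa using hg.norm_le x
      gcongr
    have hp : 0 ≤ A * δ ^ α := by positivity
    refine ⟨(hf.1.comp (continuous_id.add hg₁.1)).sub (hf.1.comp (continuous_id.add hg₂.1)),
      fun x => (hs x).trans (by linarith), ?_, fun x y => ?_⟩
    · simpa using (hf.tendsto_comp hg₁).sub (hf.tendsto_comp hg₂)
    · rw [Real.rpow_zero, mul_one]
      exact (norm_sub_le_of_le (hs x) (hs y)).trans (by linarith)
  | succ n ih =>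
    obtain ⟨C, hC4, hC⟩ := ih (R := 2 * R) (by linarith) (S := 2 * S) (by linarith)
    obtain ⟨K, hK1, hK⟩ := exists_comp (E := E) n h0 h1 (R := 2 * R) (by linarith)
    have hC0 : 0 ≤ C := by linarith
    have hK0 : 0 ≤ K := by linarith
    have h4 : 0 ≤ 2 * 4 ^ n * (2 * C) * (2 * R) := by positivity
    have h5 : 0 ≤ 2 * 4 ^ n * (2 * K) * S := by positivity
    refine ⟨2 * C + 2 * 4 ^ n * (2 * C) * (2 * R) + 2 * 4 ^ n * (2 * K) * S, by linarith,
      fun F _ _ f g₁ g₂ A δ hδS hf hg₁ hL₁ hg₂ hL₂ hg => ?_⟩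
    have hA := hf.nonneg
    have hδ := hg.nonneg
    have hp : 0 ≤ A * δ ^ α := by positivity
    have hd₁ := hasFDerivAt_comp_id_add hf.1 hg₁.1
    have hd₂ := hasFDerivAt_comp_id_add hf.1 hg₂.1
    have hd : ∀ x, HasFDerivAt (fun x => f (x + g₁ x) - f (x + g₂ x)) _ x :=
      fun x => (hd₁ x).sub (hd₂ x)
    have hL : ∀ {g : E → E}, (∀ x y, ‖g x - g y‖ ≤ R * ‖x - y‖) →
        ∀ x y, ‖g x - g y‖ ≤ 2 * R * ‖x - y‖ := fun hL x y => (hL x y).trans (by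
      have := norm_nonneg (x - y)
      nlinarith)
    refine ⟨fun x => (hd x).differentiableAt, fun x => ?_, ?_, ?_⟩
    · have : ‖x + g₁ x - (x + g₂ x)‖ ≤ δ := by simpa using hg.norm_le x
      calc ‖f (x + g₁ x) - f (x + g₂ x)‖ ≤ 2 * A * ‖x + g₁ x - (x + g₂ x)‖ ^ α :=
            hf.holder h0 h1 _ _
        _ ≤ 2 * A * δ ^ α := by gcongr
        _ ≤ _ := by nlinarith [mul_nonneg h4 hp, mul_nonneg h5 hp]
    · simpa using (hf.tendsto_comp hg₁).sub (hf.tendsto_comp hg₂)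
    · have e : fderiv ℝ (fun x => f (x + g₁ x) - f (x + g₂ x)) = fun x =>
          fderiv ℝ f (x + g₁ x) - fderiv ℝ f (x + g₂ x) +
            ((fderiv ℝ f (x + g₁ x) - fderiv ℝ f (x + g₂ x)).comp (fderiv ℝ g₁ x) +
            (fderiv ℝ f (x + g₂ x)).comp (fderiv ℝ (fun x => g₁ x - g₂ x) x)) := by
        funext x
        rw [(hd x).fderiv, fderiv_fun_sub (hg₁.1 x) (hg₂.1 x), ContinuousLinearMap.sub_comp,
          ContinuousLinearMap.comp_sub]
        abel
      rw [e]
      have a0 : HolderBound n 0 (2 * C * (A * δ ^ α))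
          (fun x => fderiv ℝ f (x + g₁ x) - fderiv ℝ f (x + g₂ x)) := by
        refine (hC _ _ g₁ g₂ A (2 * δ) (by linarith) hf.2.2.2 (hg₁.of_succ h0 h1) (hL hL₁)
          (hg₂.of_succ h0 h1) (hL hL₂) (hg.of_succ le_rfl zero_le_one)).mono ?_
        have e2 : (2 : ℝ) ^ α ≤ 2 := by
          simpa using Real.rpow_le_rpow_of_exponent_le one_le_two h1
        rw [Real.mul_rpow zero_le_two hδ]
        calc C * A * (2 ^ α * δ ^ α) ≤ C * A * (2 * δ ^ α) := by gcongr
          _ = _ := by ring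
      have a1 := a0.compL le_rfl zero_le_one (hg₁.2.2.2.exponent_mono le_rfl h0)
      have a2 := (((hK _ _ g₂ A hf.2.2.2 (hg₂.of_succ h0 h1) (hL hL₂)).exponent_mono le_rfl
        h0).compL le_rfl zero_le_one
          (hg.2.2.2.mono (le_mul_rpow_self h0 h1 hδ hδS hS)))
      refine (a0.add (a1.add a2)).mono (le_of_eq ?_)
      ring

set_option maxSynthPendingDepth 3 in
/-- The inverse `1 + v` of `1 + w` is bounded in `C^{n,α}`, in terms of bounds on `w` in `C^{n,α}`
and on `1 + v` in the supremum norm. -/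
theorem exists_inverse {A : Type} [NormedRing A] [NormedAlgebra ℝ A] [CompleteSpace A] (n : ℕ)
    {α : ℝ} (h0 : 0 ≤ α) (h1 : α ≤ 1) (R M : ℝ) :
    ∃ C : ℝ, ∀ w v : E → A, HolderBound n α R w → (∀ x, ‖1 + v x‖ ≤ M) →
      (∀ x, (1 + w x) * (1 + v x) = 1) → (∀ x, (1 + v x) * (1 + w x) = 1) →
      HolderBound n α C v := by
  have hvw : ∀ {w v : E → A}, (∀ x, (1 + v x) * (1 + w x) = 1) →
      ∀ x, v x = -((1 + v x) * w x) := by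
    intro w v h x
    have := h x
    rw [mul_add, mul_one] at this
    rw [← sub_eq_zero, ← sub_eq_zero.2 this]
    abel
  have hvn : ∀ {w v : E → A}, (∀ x, ‖1 + v x‖ ≤ M) → (∀ x, (1 + v x) * (1 + w x) = 1) →
      ∀ x, ‖v x‖ ≤ M * ‖w x‖ := by
    intro w v hM h x
    rw [hvw h x, norm_neg]
    exact (norm_mul_le _ _).trans (mul_le_mul_of_nonneg_right (hM x) (norm_nonneg _))
  have hvb : ∀ {m : ℕ} {R : ℝ} {w v : E → A}, HolderBound m α R w → (∀ x, ‖1 + v x‖ ≤ M) →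
      (∀ x, (1 + v x) * (1 + w x) = 1) → ∀ x, ‖v x‖ ≤ M * R := by
    intro m R w v hw hM h x
    exact (hvn hM h x).trans
      (mul_le_mul_of_nonneg_left (hw.norm_le x) ((norm_nonneg _).trans (hM x)))
  have hvt : ∀ {m : ℕ} {R : ℝ} {w v : E → A}, HolderBound m α R w → (∀ x, ‖1 + v x‖ ≤ M) →
      (∀ x, (1 + v x) * (1 + w x) = 1) → Tendsto v (Bornology.cobounded E) (𝓝 0) := by
    intro m R w v hw hM h
    exact squeeze_zero_norm (hvn hM h) (by simpa using hw.tendsto.norm.const_mul M)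
  induction n generalizing R with
  | zero =>
    refine ⟨max (M * R) (M * R * M), fun w v hw hM hl hr => ?_⟩
    have hM0 : 0 ≤ M := (norm_nonneg _).trans (hM 0)
    have key : ∀ x y, ‖v x - v y‖ ≤ M * ‖w x - w y‖ * M := by
      intro x y
      have e : v x - v y = (1 + v x) * (w y - w x) * (1 + v y) := by
        have e1 : w y - w x = (1 + w y) - (1 + w x) := by abel
        rw [e1, mul_sub, hr, sub_mul, mul_assoc, hl]
        simp
      rw [e, norm_sub_rev (w x)]
      refine (norm_mul_le _ _).trans ?_
      gcongr
      · exact (norm_mul_le _ _).trans (by gcongr; exact hM x)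
      · exact hM y
    refine ⟨?_, fun x => (hvb hw hM hr x).trans (le_max_left _ _), hvt hw hM hr, fun x y => ?_⟩
    · refine continuous_iff_continuousAt.2 fun x => tendsto_iff_norm_sub_tendsto_zero.2 ?_
      refine squeeze_zero (fun _ => norm_nonneg _) (fun y => key y x) ?_
      simpa using ((tendsto_iff_norm_sub_tendsto_zero.1 (hw.1.tendsto x)).const_mul M).mul_const M
    · refine (key x y).trans ?_
      calc M * ‖w x - w y‖ * M ≤ M * (R * ‖x - y‖ ^ α) * M := by
            gcongr
            exact hw.2.2.2 x y
        _ = M * R * M * ‖x - y‖ ^ α := by ring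
        _ ≤ _ := by
          gcongr
          exact le_max_right _ _
  | succ n ih =>
    obtain ⟨C, hC⟩ := ih (2 * R)
    -- Multiplication by elements of `A` from the left and from the right, applied to linear maps.
    -- In these terms, `dv = -(1 + v) dw (1 + v)` is affine in `L v` and in `L' v`.
    let L : A →L[ℝ] (E →L[ℝ] A) →L[ℝ] (E →L[ℝ] A) :=
      (ContinuousLinearMap.compL ℝ E A A).comp (ContinuousLinearMap.mul ℝ A)
    let L' : A →L[ℝ] (E →L[ℝ] A) →L[ℝ] (E →L[ℝ] A) :=
      (ContinuousLinearMap.compL ℝ E A A).comp (ContinuousLinearMap.mul ℝ A).flip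
    refine ⟨max (M * R) (R + 2 * 4 ^ n * ‖L‖ * C * R +
      2 * 4 ^ n * ‖L'‖ * C * (R + 2 * 4 ^ n * ‖L‖ * C * R)), fun w v hw hM hl hr => ?_⟩
    have hv := hC w v (hw.of_succ h0 h1) hM hl hr
    let u : E → Aˣ := fun x => ⟨1 + w x, 1 + v x, hl x, hr x⟩
    have hvi : v = fun x => Ring.inverse (1 + w x) - 1 := by
      funext x
      have : Ring.inverse (1 + w x) = 1 + v x := Ring.inverse_unit (u x)
      rw [this]
      abel
    have hd : ∀ x, HasFDerivAt v
        (-(fderiv ℝ w x + L (v x) (fderiv ℝ w x) +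
          L' (v x) (fderiv ℝ w x + L (v x) (fderiv ℝ w x)))) x := by
      intro x
      have h1 : HasFDerivAt (fun x => 1 + w x) (fderiv ℝ w x) x :=
        (hw.1 x).hasFDerivAt.const_add 1
      have h2 : HasFDerivAt Ring.inverse
          (-ContinuousLinearMap.mulLeftRight ℝ A (1 + v x) (1 + v x)) (1 + w x) :=
        hasFDerivAt_ringInverse (𝕜 := ℝ) (u x)
      have h3 := (h2.comp x h1).sub_const 1
      have h4 := h3.congr_of_eventuallyEq (f₁ := v) (Eventually.of_forall fun y => congrFun hvi y)
      refine h4.congr_fderiv ?_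
      ext y
      simp [L, L']
      noncomm_ring
    refine ⟨fun x => (hd x).differentiableAt, fun x => (hvb hw hM hr x).trans (le_max_left _ _),
      hvt hw hM hr, ?_⟩
    have e : fderiv ℝ v = fun x => -(fderiv ℝ w x + L (v x) (fderiv ℝ w x) +
          L' (v x) (fderiv ℝ w x + L (v x) (fderiv ℝ w x))) := by
      funext x
      exact (hd x).fderiv
    rw [e]
    have a1 := hw.2.2.2.add (hv.bilinear L h0 h1 hw.2.2.2)
    exact (a1.add (hv.bilinear L' h0 h1 a1)).neg.mono (le_max_right _ _)

end HolderBound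

end Composition

/-! ### Global invertibility -/

section Diffeo

variable {E : Type} [NormedAddCommGroup E] [NormedSpace ℝ E] [FiniteDimensional ℝ E] {f : E → E}

theorem hasStrictFDerivAt_id_add (hf : ContDiff ℝ 1 f) {x : E}
    (hdet : (1 + fderiv ℝ f x).det ≠ 0) :
    HasStrictFDerivAt (fun x => x + f x)
      ((1 + fderiv ℝ f x).toContinuousLinearEquivOfDetNeZero hdet : E →L[ℝ] E) x := by
  exact (hasStrictFDerivAt_id (𝕜 := ℝ) x).add
    (hf.contDiffAt.hasStrictFDerivAt (x := x) (by simp))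

theorem injOn_nhds_id_add (hf : ContDiff ℝ 1 f) {x : E} (hdet : (1 + fderiv ℝ f x).det ≠ 0) :
    ∃ U ∈ 𝓝 x, InjOn (fun x => x + f x) U := by
  have : CompleteSpace E := FiniteDimensional.complete ℝ E
  have h := hasStrictFDerivAt_id_add hf hdet
  exact ⟨_, (h.toOpenPartialHomeomorph _).open_source.mem_nhds
    h.mem_toOpenPartialHomeomorph_source, (h.toOpenPartialHomeomorph _).injOn⟩

theorem map_nhds_id_add (hf : ContDiff ℝ 1 f) {x : E} (hdet : (1 + fderiv ℝ f x).det ≠ 0) :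
    map (fun x => x + f x) (𝓝 x) = 𝓝 (x + f x) := by
  have : CompleteSpace E := FiniteDimensional.complete ℝ E
  exact (hasStrictFDerivAt_id_add hf hdet).map_nhds_eq_of_equiv

/-- The set of points with at least two preimages under a proper local homeomorphism is closed. -/
theorem isClosed_setOf_two_preimages {X Y : Type} [TopologicalSpace X] [TopologicalSpace Y]
    [T2Space Y] {Φ : X → Y} (hp : IsProperMap Φ) (hi : ∀ x, ∃ U ∈ 𝓝 x, InjOn Φ U) :
    IsClosed {y | ∃ x x', x ≠ x' ∧ Φ x = y ∧ Φ x' = y} := by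
  have hP : IsClosed {p : X × X | Φ p.1 = Φ p.2 ∧ p.1 ≠ p.2} := by
    rw [← isOpen_compl_iff, isOpen_iff_mem_nhds]
    rintro ⟨x, x'⟩ hx
    by_cases h : Φ x = Φ x'
    · have hxx : x = x' := by
        by_contra hne
        exact hx ⟨h, hne⟩
      subst hxx
      obtain ⟨U, hU, hUi⟩ := hi x
      filter_upwards [prod_mem_nhds hU hU] with p hp hp'
      exact hp'.2 (hUi hp.1 hp.2 hp'.1)
    · have ho : IsOpen {p : X × X | Φ p.1 ≠ Φ p.2} :=
        isOpen_ne_fun (hp.continuous.comp continuous_fst) (hp.continuous.comp continuous_snd)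
      filter_upwards [ho.mem_nhds h] with p hp hp'
      exact hp hp'.1
  have hc := (hp.prodMap hp).isClosedMap _ hP
  convert hc.preimage (f := fun y : Y => (y, y)) (by fun_prop) using 1
  ext y
  simp only [mem_ofPred_eq, mem_preimage, mem_image, Prod.exists, Prod.map_apply, Prod.mk.injEq]
  constructor
  · rintro ⟨x, x', h, h1, h2⟩
    exact ⟨x, x', ⟨h1.trans h2.symm, h⟩, h1, h2⟩
  · rintro ⟨x, x', ⟨_, h⟩, h1, h2⟩
    exact ⟨x, x', h, h1, h2⟩

/-- The set of points with at least two preimages under a local homeomorphism is open. -/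
theorem isOpen_setOf_two_preimages {X Y : Type} [TopologicalSpace X] [TopologicalSpace Y]
    [T2Space X] {Φ : X → Y} (hm : ∀ x, map Φ (𝓝 x) = 𝓝 (Φ x)) :
    IsOpen {y | ∃ x x', x ≠ x' ∧ Φ x = y ∧ Φ x' = y} := by
  rw [isOpen_iff_mem_nhds]
  rintro y ⟨x, x', hne, rfl, h⟩
  obtain ⟨U, V, hU, hV, hxU, hxV, hd⟩ := t2_separation hne
  have h1 : Φ '' U ∈ 𝓝 (Φ x) := hm x ▸ image_mem_map (hU.mem_nhds hxU)
  have h2 : Φ '' V ∈ 𝓝 (Φ x) := h ▸ hm x' ▸ image_mem_map (hV.mem_nhds hxV)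
  filter_upwards [h1, h2]
  rintro y ⟨a, ha, rfl⟩ ⟨b, hb, hab⟩
  exact ⟨a, b, disjoint_iff_forall_ne.1 hd ha hb, rfl, hab⟩

/-- If `id + f` is a local diffeomorphism and `f` vanishes at infinity together with its
derivative, then `id + f` is bijective: its image is open and closed; so is the set of points with
at least two preimages, which does not contain points far away from the origin. -/
theorem bijective_id_add (hf : ContDiff ℝ 1 f) {K : ℝ} (hK : ∀ x, ‖f x‖ ≤ K)
    (ht : Tendsto (fderiv ℝ f) (Bornology.cobounded E) (𝓝 0))
    (hdet : ∀ x, (1 + fderiv ℝ f x).det ≠ 0) : Function.Bijective (fun x => x + f x) := by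
  rcases subsingleton_or_nontrivial E with hE | hE
  · exact ⟨Function.injective_of_subsingleton _, fun y => ⟨0, Subsingleton.elim _ _⟩⟩
  have : ProperSpace E := FiniteDimensional.proper_real E
  have hc : Continuous (fun x => x + f x) := continuous_id.add hf.continuous
  have hp : IsProperMap (fun x => x + f x) := by
    rw [isProperMap_iff_tendsto_cocompact]
    refine ⟨hc, ?_⟩
    rw [← Metric.cobounded_eq_cocompact]
    exact tendsto_id_add_cobounded hK
  have hm := fun x => map_nhds_id_add hf (hdet x)
  constructor
  · have hS : IsClopen {y | ∃ x x', x ≠ x' ∧ x + f x = y ∧ x' + f x' = y} :=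
      ⟨isClosed_setOf_two_preimages hp fun x => injOn_nhds_id_add hf (hdet x),
        isOpen_setOf_two_preimages hm⟩
    rcases isClopen_iff.1 hS with h | h
    · intro x x' hxx
      by_contra hne
      have : x + f x ∈ {y | ∃ x x', x ≠ x' ∧ x + f x = y ∧ x' + f x' = y} :=
        ⟨x, x', hne, rfl, hxx.symm⟩
      rw [h] at this
      exact this
    · exfalso
      -- Where `f` is a contraction, the equation `x + f x = y` has at most one solution; since `f`
      -- is bounded by `K`, all solutions are in the ball of radius `K` about `y`.
      have hev : ∀ᶠ x in Bornology.cobounded E, ‖fderiv ℝ f x‖ ≤ 1 / 2 :=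
        ht.norm.eventually_le_const (by simp)
      obtain ⟨r, -, hr⟩ := (Metric.hasBasis_cobounded_compl_closedBall (0 : E)).eventually_iff.1 hev
      obtain ⟨y, hy⟩ := NormedSpace.exists_lt_norm ℝ E (r + K)
      obtain ⟨x, x', hne, hx, hx'⟩ : y ∈ {y | ∃ x x', x ≠ x' ∧ x + f x = y ∧ x' + f x' = y} :=
        h ▸ mem_univ y
      have hmem : ∀ {z}, z + f z = y → z ∈ Metric.closedBall y K := fun {z} hz => by
        rw [mem_closedBall_iff_norm, ← hz]
        simpa using hK z
      have hle := Convex.norm_image_sub_le_of_norm_fderiv_le (𝕜 := ℝ) (f := f) (C := 1 / 2)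
        (s := Metric.closedBall y K) (fun z _ => hf.differentiable (by simp) z)
        (fun z hz => hr ?_) (convex_closedBall y K) (hmem hx') (hmem hx)
      · have e : f x - f x' = -(x - x') := by
          rw [← sub_eq_zero]
          have := sub_eq_zero.2 (hx.trans hx'.symm)
          rw [← this]
          abel
        rw [e, norm_neg] at hle
        have : 0 < ‖x - x'‖ := norm_pos_iff.2 (sub_ne_zero.2 hne)
        linarith
      · rw [mem_closedBall_iff_norm] at hz
        have := norm_sub_norm_le y z
        rw [norm_sub_rev] at this
        simp only [mem_compl_iff, mem_closedBall_zero_iff, not_le]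
        linarith
  · have ho : IsOpen (range fun x => x + f x) :=
      (IsOpenMap.of_nhds_le fun x => (hm x).ge).isOpen_range
    rcases isClopen_iff.1 ⟨hp.isClosedMap.isClosed_range, ho⟩ with h | h
    · exact absurd h (range_nonempty _).ne_empty
    · exact range_eq_univ.1 h

/-- The inverse `id + h` of `id + f` is differentiable, and its derivative is the inverse of that
of `id + f`. -/
theorem hasFDerivAt_inverse {h : E → E} (hf : ContDiff ℝ 1 f)
    (hdet : ∀ x, (1 + fderiv ℝ f x).det ≠ 0) (hl : ∀ x, x + h x + f (x + h x) = x)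
    (hr : ∀ x, x + f x + h (x + f x) = x) (x : E) :
    ∃ T : E →L[ℝ] E, HasFDerivAt h T x ∧ (1 + fderiv ℝ f (x + h x)) * (1 + T) = 1 ∧
      (1 + T) * (1 + fderiv ℝ f (x + h x)) = 1 := by
  have hcont : ContinuousAt (fun x => x + h x) x := by
    have := map_nhds_id_add hf (hdet (x + h x))
    rw [hl] at this
    rw [ContinuousAt, ← this, tendsto_map'_iff]
    exact tendsto_id.congr fun y => (hr y).symm
  have h1 := HasFDerivAt.of_local_left_inverse hcont
    (hasStrictFDerivAt_id_add hf (hdet (x + h x))).hasFDerivAt (Eventually.of_forall hl)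
  set e := (1 + fderiv ℝ f (x + h x)).toContinuousLinearEquivOfDetNeZero (hdet (x + h x))
  have he : (1 + fderiv ℝ f (x + h x)) = (e : E →L[ℝ] E) := rfl
  refine ⟨(e.symm : E →L[ℝ] E) - 1, ?_, ?_, ?_⟩
  · have := h1.sub (hasFDerivAt_id x)
    refine (this.congr_of_eventuallyEq (f₁ := h) (Eventually.of_forall fun y => ?_))
    simp
  · rw [he]
    ext y
    simp
  · rw [he]
    ext y
    simp

/-- If `det (1 + df₀) > 0` everywhere and `df₀` vanishes at infinity, then the same is true for all
`f` which are `C¹`-close to `f₀`, and the inverses of `1 + df` are uniformly bounded. -/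
theorem exists_det_pos_and_inverse_bound {f₀ : E → E} (hf : Continuous (fderiv ℝ f₀))
    (ht : Tendsto (fderiv ℝ f₀) (Bornology.cobounded E) (𝓝 0))
    (hdet : ∀ x, 0 < (1 + fderiv ℝ f₀ x).det) :
    ∃ δ > 0, ∃ M : ℝ, ∀ f : E → E, (∀ x, ‖fderiv ℝ f x - fderiv ℝ f₀ x‖ ≤ δ) →
      (∀ x, 0 < (1 + fderiv ℝ f x).det) ∧
      ∀ (x : E) (T : E →L[ℝ] E), (1 + fderiv ℝ f x) * T = 1 → T * (1 + fderiv ℝ f x) = 1 →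
        ‖T‖ ≤ M := by
  have : ProperSpace E := FiniteDimensional.proper_real E
  have : CompleteSpace E := FiniteDimensional.complete ℝ E
  have : ProperSpace (E →L[ℝ] E) := FiniteDimensional.proper_real _
  have hK : IsCompact (insert 1 (range fun x => 1 + fderiv ℝ f₀ x)) := by
    refine Tendsto.isCompact_insert_range_of_cocompact ?_ (continuous_const.add hf)
    rw [← Metric.cobounded_eq_cocompact]
    simpa using ht.const_add (1 : E →L[ℝ] E)
  have hU : IsOpen {A : E →L[ℝ] E | 0 < A.det} :=
    isOpen_lt continuous_const ContinuousLinearMap.continuous_det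
  obtain ⟨δ, hδ, hsub⟩ := hK.exists_cthickening_subset_open hU (by
    rintro A (rfl | ⟨x, rfl⟩)
    · simp [ContinuousLinearMap.det]
    · exact hdet x)
  have hK' := hK.cthickening (r := δ)
  obtain ⟨M, hM⟩ := hK'.exists_bound_of_continuousOn (f := Ring.inverse) (by
    intro A hA
    have hA' : A.det ≠ 0 := (hsub hA).ne'
    let e := A.toContinuousLinearEquivOfDetNeZero hA'
    exact (NormedRing.inverse_continuousAt (ContinuousLinearEquiv.toUnit e)).continuousWithinAt)
  refine ⟨δ, hδ, M, fun f hff => ?_⟩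
  have hmem : ∀ x, 1 + fderiv ℝ f x ∈
      Metric.cthickening δ (insert 1 (range fun x => 1 + fderiv ℝ f₀ x)) := fun x => by
    refine Metric.mem_cthickening_of_dist_le _ (1 + fderiv ℝ f₀ x) _ _
      (mem_insert_of_mem _ ⟨x, rfl⟩) ?_
    simpa [dist_eq_norm] using hff x
  refine ⟨fun x => hsub (hmem x), fun x T h1 h2 => ?_⟩
  have := hM _ (hmem x)
  rwa [show Ring.inverse (1 + fderiv ℝ f x) = T from Ring.inverse_unit ⟨_, T, h1, h2⟩] at this

/-- The inverse `id + h` of `id + f` is bounded in `id + C^{n+1,α}`, in terms of bounds on `f` in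
`C^{n+1,α}` and on the inverse of `1 + df` in the supremum norm. Since
`dh = (1 + df ∘ (id + h))⁻¹ - 1`, a bound on `h` in `C^{k,α}` improves to one in `C^{k+1,α}`,
as long as `k ≤ n`. -/
theorem HolderBound.exists_inverse_map (n : ℕ) {α : ℝ} (h0 : 0 ≤ α) (h1 : α ≤ 1) (R M : ℝ) :
    ∃ C : ℝ, ∀ f h : E → E, HolderBound (n + 1) α R f → (∀ x, (1 + fderiv ℝ f x).det ≠ 0) →
      (∀ x, x + h x + f (x + h x) = x) → (∀ x, x + f x + h (x + f x) = x) →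
      (∀ (x : E) (T : E →L[ℝ] E), (1 + fderiv ℝ f x) * T = 1 → T * (1 + fderiv ℝ f x) = 1 →
        ‖T‖ ≤ M) → HolderBound (n + 1) α C h := by
  have : CompleteSpace E := FiniteDimensional.complete ℝ E
  suffices H : ∀ k ≤ n + 1, ∃ C : ℝ, ∀ f h : E → E, HolderBound (n + 1) α R f →
      (∀ x, (1 + fderiv ℝ f x).det ≠ 0) →
      (∀ x, x + h x + f (x + h x) = x) → (∀ x, x + f x + h (x + f x) = x) →
      (∀ (x : E) (T : E →L[ℝ] E), (1 + fderiv ℝ f x) * T = 1 → T * (1 + fderiv ℝ f x) = 1 →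
        ‖T‖ ≤ M) → HolderBound k α C h from H (n + 1) le_rfl
  have hder : ∀ {f h : E → E}, HolderBound (n + 1) α R f → (∀ x, (1 + fderiv ℝ f x).det ≠ 0) →
      (∀ x, x + h x + f (x + h x) = x) → (∀ x, x + f x + h (x + f x) = x) →
      Differentiable ℝ h ∧ (∀ x, (1 + fderiv ℝ f (x + h x)) * (1 + fderiv ℝ h x) = 1) ∧
        ∀ x, (1 + fderiv ℝ h x) * (1 + fderiv ℝ f (x + h x)) = 1 := by
    intro f h hf hdet hl hr
    choose T hT hT1 hT2 using hasFDerivAt_inverse hf.contDiff_one hdet hl hr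
    refine ⟨fun x => (hT x).differentiableAt, fun x => ?_, fun x => ?_⟩
    · rw [(hT x).fderiv, hT1]
    · rw [(hT x).fderiv, hT2]
  have hsup : ∀ {f h : E → E}, HolderBound (n + 1) α R f → (∀ x, x + h x + f (x + h x) = x) →
      ∀ x, ‖h x‖ ≤ R := by
    intro f h hf hl x
    have : h x = -f (x + h x) := by
      have := hl x
      rw [add_assoc, add_eq_left] at this
      exact eq_neg_of_add_eq_zero_left this
    rw [this, norm_neg]
    exact hf.norm_le _
  have hten : ∀ {f h : E → E}, HolderBound (n + 1) α R f → (∀ x, x + h x + f (x + h x) = x) →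
      Tendsto h (Bornology.cobounded E) (𝓝 0) := by
    intro f h hf hl
    have h1 := (hf.tendsto.comp (tendsto_id_add_cobounded (hsup hf hl))).neg
    rw [neg_zero] at h1
    refine h1.congr fun x => ?_
    have := hl x
    rw [add_assoc, add_eq_left] at this
    exact (eq_neg_of_add_eq_zero_left this).symm
  have hlip : ∀ {f h : E → E}, HolderBound (n + 1) α R f → (∀ x, (1 + fderiv ℝ f x).det ≠ 0) →
      (∀ x, x + h x + f (x + h x) = x) → (∀ x, x + f x + h (x + f x) = x) →
      (∀ (x : E) (T : E →L[ℝ] E), (1 + fderiv ℝ f x) * T = 1 → T * (1 + fderiv ℝ f x) = 1 →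
        ‖T‖ ≤ M) → ∀ x y, ‖h x - h y‖ ≤ (M + 1) * ‖x - y‖ := by
    intro f h hf hdet hl hr hM x y
    obtain ⟨hd, d1, d2⟩ := hder hf hdet hl hr
    refine Convex.norm_image_sub_le_of_norm_fderiv_le (𝕜 := ℝ) (fun z _ => hd z) (fun z _ => ?_)
      convex_univ (mem_univ y) (mem_univ x)
    have e1 := hM _ _ (d1 z) (d2 z)
    have e2 : fderiv ℝ h z = (1 + fderiv ℝ h z) - 1 := by abel
    rw [e2]
    exact (norm_sub_le _ _).trans (add_le_add e1 ContinuousLinearMap.norm_id_le)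
  intro k
  induction k with
  | zero =>
    refine fun _ => ⟨2 * max R (M + 1), fun f h hf hdet hl hr hM => ?_⟩
    have hR := hf.nonneg
    have hm : 0 ≤ max R (M + 1) := hR.trans (le_max_left _ _)
    have hb : ∀ x, ‖h x‖ ≤ max R (M + 1) := fun x => (hsup hf hl x).trans (le_max_left _ _)
    refine ⟨(hder hf hdet hl hr).1.continuous, fun x => (hb x).trans (by linarith), hten hf hl,
      fun x y => le_two_mul_mul_rpow h0 h1 hm (norm_nonneg _) ?_ ?_⟩
    · exact (norm_sub_le_of_le (hb x) (hb y)).trans (by linarith)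
    · rw [Real.rpow_one]
      exact (hlip hf hdet hl hr hM x y).trans (by gcongr; exact le_max_right _ _)
  | succ k ih =>
    intro hk
    obtain ⟨C, hC⟩ := ih (by lia)
    obtain ⟨K, hK1, hK⟩ := HolderBound.exists_comp (E := E) k h0 h1 (R := max 0 (max C (M + 1)))
      (le_max_left _ _)
    obtain ⟨C', hC'⟩ := HolderBound.exists_inverse (E := E) (A := E →L[ℝ] E) k h0 h1 (K * (2 * R)) M
    refine ⟨max R C', fun f h hf hdet hl hr hM => ?_⟩
    obtain ⟨hd, d1, d2⟩ := hder hf hdet hl hr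
    refine ⟨hd, fun x => (hsup hf hl x).trans (le_max_left _ _), hten hf hl,
      HolderBound.mono (le_max_right _ _) ?_⟩
    refine hC' (fun x => fderiv ℝ f (x + h x)) _ ?_ (fun x => hM _ _ (d1 x) (d2 x)) d1 d2
    refine hK _ _ h _ (hf.2.2.2.of_le h0 h1 (by lia))
      ((hC f h hf hdet hl hr hM).mono ((le_max_left _ _).trans (le_max_right _ _))) fun x y =>
        (hlip hf hdet hl hr hM x y).trans ?_
    gcongr
    exact (le_max_right _ _).trans (le_max_right _ _)

end Diffeo

/-! ### Hölder bounds and the Hölder norm -/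

section HolderZero

variable {E F : Type} [NormedAddCommGroup E] [NormedSpace ℝ E]
  [NormedAddCommGroup F] [NormedSpace ℝ F] {n : ℕ} {α C : ℝ} {f : E → F}

theorem holderBound_iff : HolderBound n α C f ↔ ContDiff ℝ n f ∧
    (∀ l ≤ n, ∀ x, ‖iteratedFDeriv ℝ l f x‖ ≤ C) ∧
    (∀ l ≤ n, Tendsto (iteratedFDeriv ℝ l f) (Bornology.cobounded E) (𝓝 0)) ∧
    ∀ x y, ‖iteratedFDeriv ℝ n f x - iteratedFDeriv ℝ n f y‖ ≤ C * ‖x - y‖ ^ α := by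
  induction n generalizing F with
  | zero =>
    have e : ∀ x y, ‖iteratedFDeriv ℝ 0 f x - iteratedFDeriv ℝ 0 f y‖ = ‖f x - f y‖ := by
      intro x y
      rw [iteratedFDeriv_zero_eq_comp]
      simp only [Function.comp_apply]
      rw [← map_sub, LinearIsometryEquiv.norm_map]
    simp only [HolderBound, Nat.le_zero, forall_eq, norm_iteratedFDeriv_zero, e,
      Nat.cast_zero, contDiff_zero, tendsto_zero_iff_norm_tendsto_zero (f := iteratedFDeriv ℝ 0 f),
      ← tendsto_zero_iff_norm_tendsto_zero]
  | succ n ih =>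
    have e : ∀ x y, ‖iteratedFDeriv ℝ (n + 1) f x - iteratedFDeriv ℝ (n + 1) f y‖ =
        ‖iteratedFDeriv ℝ n (fderiv ℝ f) x - iteratedFDeriv ℝ n (fderiv ℝ f) y‖ := by
      intro x y
      simp only [iteratedFDeriv_succ_eq_comp_right, Function.comp_apply, ← dist_eq_norm]
      exact (continuousMultilinearCurryRightEquiv' ℝ n E F).symm.dist_map _ _
    have el : ∀ {P : ℕ → Prop}, (∀ l ≤ n + 1, P l) ↔ P 0 ∧ ∀ l ≤ n, P (l + 1) := by
      intro P
      constructor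
      · exact fun h => ⟨h 0 (by lia), fun l hl => h (l + 1) (by lia)⟩
      · rintro ⟨h0, h1⟩ (_ | l) hl
        · exact h0
        · exact h1 l (by lia)
    rw [HolderBound, ih, el, el]
    push_cast
    rw [contDiff_succ_iff_fderiv]
    simp only [e, tendsto_zero_iff_norm_tendsto_zero (f := iteratedFDeriv ℝ _ f),
      norm_iteratedFDeriv_zero, ← norm_iteratedFDeriv_fderiv, ← tendsto_zero_iff_norm_tendsto_zero]
    simp only [WithTop.natCast_ne_top, false_implies, true_and]
    tauto

theorem holderBound_iff_eHolderCNorm_le (hC : 0 ≤ C) : HolderBound n α C f ↔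
    f ∈ holderZeroSubmodule E F n α ∧ eHolderCNorm n α f ≤ ENNReal.ofReal C := by
  have key : ContDiff ℝ n f → (eHolderCNorm n α f ≤ ENNReal.ofReal C ↔
      (∀ l ≤ n, ∀ x, ‖iteratedFDeriv ℝ l f x‖ ≤ C) ∧
      ∀ x y, x ≠ y → ‖iteratedFDeriv ℝ n f x - iteratedFDeriv ℝ n f y‖ ≤ C * ‖x - y‖ ^ α) := by
    intro _
    have en : ∀ (l : ℕ) (a : E [×l]→L[ℝ] F), ‖a‖ₑ = ENNReal.ofReal ‖a‖ :=
      fun _ _ => (ofReal_norm _).symm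
    simp only [eHolderCNorm, max_le_iff, iSup_le_iff]
    refine and_congr ?_ ?_
    · simp only [en, ENNReal.ofReal_le_ofReal_iff hC]
    · refine forall_congr' fun x => forall_congr' fun y => forall_congr' fun hxy => ?_
      have hp : 0 < ‖x - y‖ := norm_pos_iff.2 (sub_ne_zero.2 hxy)
      have e2 : ‖x - y‖ₑ ^ α = ENNReal.ofReal (‖x - y‖ ^ α) := by
        rw [← ofReal_norm, ENNReal.ofReal_rpow_of_pos hp]
      have hp2 : 0 < ‖x - y‖ ^ α := Real.rpow_pos_of_pos hp _
      rw [e2, en, ENNReal.div_le_iff (by simpa using hp2) ENNReal.ofReal_ne_top,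
        ← ENNReal.ofReal_mul hC, ENNReal.ofReal_le_ofReal_iff (by positivity)]
  rw [holderBound_iff]
  constructor
  · rintro ⟨h1, h2, h3, h4⟩
    have := (key h1).2 ⟨h2, fun x y _ => h4 x y⟩
    exact ⟨⟨h1, this.trans_lt ENNReal.ofReal_lt_top, h3⟩, this⟩
  · rintro ⟨⟨h1, -, h3⟩, h⟩
    obtain ⟨h2, h4⟩ := (key h1).1 h
    refine ⟨h1, h2, h3, fun x y => ?_⟩
    by_cases hxy : x = y
    · subst hxy
      rw [sub_self, norm_zero]
      exact mul_nonneg hC (Real.rpow_nonneg (norm_nonneg _) _)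
    · exact h4 x y hxy

theorem mem_holderZeroSubmodule_iff :
    f ∈ holderZeroSubmodule E F n α ↔ ∃ C, HolderBound n α C f := by
  constructor
  · intro h
    refine ⟨_, (holderBound_iff_eHolderCNorm_le ENNReal.toReal_nonneg).2
      ⟨h, (ENNReal.ofReal_toReal h.2.1.ne).ge⟩⟩
  · rintro ⟨C, h⟩
    exact ((holderBound_iff_eHolderCNorm_le h.nonneg).1 h).1

namespace HolderZero

theorem norm_le_iff (hC : 0 ≤ C) (g : HolderZero E F n α) : ‖g‖ ≤ C ↔ HolderBound n α C g.1 := by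
  rw [holderBound_iff_eHolderCNorm_le hC, and_iff_right g.2]
  exact (ENNReal.le_ofReal_iff_toReal_le g.2.2.1.ne hC).symm

theorem norm_le_of_val_eq {g : HolderZero E F n α} (h : g.1 = f) (H : HolderBound n α C f) :
    ‖g‖ ≤ C :=
  (norm_le_iff H.nonneg g).2 (h ▸ H)

theorem holderBound (g : HolderZero E F n α) : HolderBound n α ‖g‖ g.1 :=
  (norm_le_iff (norm_nonneg g) g).1 le_rfl

theorem ext {g h : HolderZero E F n α} (H : g.1 = h.1) : g = h := Subtype.ext H

theorem sub_val (g h : HolderZero E F n α) : (g - h).1 = g.1 - h.1 := rfl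

theorem norm_sub_le_iff (hC : 0 ≤ C) (g h : HolderZero E F n α) :
    ‖g - h‖ ≤ C ↔ HolderBound n α C (fun x => g.1 x - h.1 x) := norm_le_iff hC (g - h)

end HolderZero

theorem HolderBound.tsum [CompleteSpace F] {f : ℕ → E → F} {c : ℕ → ℝ} (hc : Summable c)
    (hf : ∀ i, HolderBound n α (c i) (f i)) :
    HolderBound n α (∑' i, c i) (fun x => ∑' i, f i x) := by
  have hb : ∀ x, ‖∑' i, f i x‖ ≤ ∑' i, c i := fun x =>
    tsum_of_norm_bounded hc.hasSum fun i => (hf i).norm_le x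
  have ht : Tendsto (fun x => ∑' i, f i x) (Bornology.cobounded E) (𝓝 0) := by
    have := tendsto_tsum_of_dominated_convergence hc (fun i => (hf i).tendsto)
      (Eventually.of_forall fun x i => (hf i).norm_le x)
    simpa using this
  have hs : ∀ x, Summable fun i => f i x := fun x =>
    Summable.of_norm_bounded hc fun i => (hf i).norm_le x
  induction n generalizing F with
  | zero =>
    refine ⟨continuous_tsum (fun i => (hf i).1) hc fun i x => (hf i).norm_le x, hb, ht,
      fun x y => ?_⟩
    rw [← (hs x).tsum_sub (hs y), ← tsum_mul_right]
    exact tsum_of_norm_bounded (hc.mul_right _).hasSum fun i => (hf i).2.2.2 x y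
  | succ n ih =>
    have hd : ∀ x, HasFDerivAt (fun x => ∑' i, f i x) (∑' i, fderiv ℝ (f i) x) x := fun x =>
      hasFDerivAt_tsum hc (fun i x => ((hf i).1 x).hasFDerivAt)
        (fun i x => (hf i).2.2.2.norm_le x) (hs 0) x
    refine ⟨fun x => (hd x).differentiableAt, hb, ht, ?_⟩
    have e : fderiv ℝ (fun x => ∑' i, f i x) = fun x => ∑' i, fderiv ℝ (f i) x := by
      funext x
      exact (hd x).fderiv
    rw [e]
    have h' := fun i => (hf i).2.2.2
    refine ih h' (fun x => tsum_of_norm_bounded hc.hasSum fun i => (h' i).norm_le x) ?_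
      fun x => Summable.of_norm_bounded hc fun i => (h' i).norm_le x
    have := tendsto_tsum_of_dominated_convergence hc (fun i => (h' i).tendsto)
      (Eventually.of_forall fun x i => (h' i).norm_le x)
    simpa using this

instance [CompleteSpace F] : CompleteSpace (HolderZero E F n α) := by
  refine NormedAddCommGroup.completeSpace_of_summable_imp_tendsto fun u hu => ?_
  have hb := fun i => (u i).holderBound
  have hg := HolderBound.tsum hu hb
  have hs : ∀ x, Summable fun i => (u i).1 x := fun x =>
    Summable.of_norm_bounded hu fun i => (hb i).norm_le x
  let g : HolderZero E F n α := ⟨fun x => ∑' i, (u i).1 x, mem_holderZeroSubmodule_iff.2 ⟨_, hg⟩⟩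
  refine ⟨g, tendsto_iff_norm_sub_tendsto_zero.2 ?_⟩
  refine squeeze_zero (fun _ => norm_nonneg _) (fun m => ?_) (tendsto_sum_nat_add fun i => ‖u i‖)
  rw [norm_sub_rev, HolderZero.norm_sub_le_iff (tsum_nonneg fun _ => norm_nonneg _)]
  have := HolderBound.tsum ((summable_nat_add_iff m).2 hu) fun i => hb (i + m)
  convert this using 2 with x
  have e : (∑ i ∈ Finset.range m, u i).1 x = ∑ i ∈ Finset.range m, (u i).1 x := by
    have := congrFun (map_sum (holderZeroSubmodule E F n α).subtype (fun i => u i)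
      (Finset.range m)) x
    rw [Finset.sum_apply] at this
    exact this
  rw [e, sub_eq_iff_eq_add', (hs x).sum_add_tsum_nat_add]

end HolderZero

/-! ### Hölder continuity of composition and inversion -/

section GroupEstimates

variable {E : Type} [NormedAddCommGroup E] [NormedSpace ℝ E] {n : ℕ}

namespace HolderBound

theorem zero {F : Type} [NormedAddCommGroup F] [NormedSpace ℝ F] (n : ℕ) (α : ℝ) {C : ℝ}
    (hC : 0 ≤ C) : HolderBound n α C (fun _ : E => (0 : F)) := by
  refine (holderBound_iff_eHolderCNorm_le hC).2 ⟨(holderZeroSubmodule E F n α).zero_mem, ?_⟩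
  exact (eHolderCNorm_zero (E := E) (F := F) n α).le.trans zero_le

/-- For `α' < α`, the map `g ↦ f ∘ (id + g)` is `(α - α')`-Hölder from bounded sets in `C^{n,α}` to
`C^{n,α'}`: it is bounded in `C^{n,α}` and `α`-Hölder into `Cⁿ`, and one interpolates. -/
theorem exists_comp_sub_rpow (n : ℕ) {α α' : ℝ} (h0' : 0 ≤ α') (hα' : α' ≤ α) (h0 : 0 < α)
    (h1 : α ≤ 1) {R : ℝ} (hR : 0 ≤ R) :
    ∃ C : ℝ, 0 ≤ C ∧ ∀ (f g₁ g₂ : E → E) (δ : ℝ), HolderBound (n + 1) α R f →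
      HolderBound (n + 1) α R g₁ → HolderBound (n + 1) α R g₂ →
      HolderBound (n + 1) α δ (fun x => g₁ x - g₂ x) →
      HolderBound (n + 1) α' (C * δ ^ (α - α')) (fun x => f (x + g₁ x) - f (x + g₂ x)) := by
  obtain ⟨C, hC4, hC⟩ := exists_comp_sub (E := E) (n + 1) h0.le h1 hR (S := 2) one_le_two
  obtain ⟨K, hK1, hK⟩ := exists_comp (E := E) (n + 1) h0.le h1 hR
  have hC0 : 0 ≤ C := by linarith
  have hK0 : 0 ≤ K := by linarith
  refine ⟨max (2 * (C * R)) (2 * (2 * (K * R))), by positivity,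
    fun f g₁ g₂ δ hf hg₁ hg₂ hg => ?_⟩
  have hδ := hg.nonneg
  have b := (hK _ f g₁ R hf hg₁ hg₁.lipschitz).sub (hK _ f g₂ R hf hg₂ hg₂.lipschitz)
  rcases le_total δ 1 with hδ1 | hδ1
  · have a := hC _ f g₁ g₂ R (2 * δ) (by linarith) hf hg₁ hg₁.lipschitz hg₂ hg₂.lipschitz
      (hg.exponent_mono le_rfl h0.le)
    have e2 : (2 : ℝ) ^ α ≤ 2 := by
      simpa using Real.rpow_le_rpow_of_exponent_le one_le_two h1
    have hδα : δ ^ α ≤ 1 := Real.rpow_le_one hδ hδ1 h0.le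
    have hδ0 : 0 ≤ δ ^ α := Real.rpow_nonneg hδ _
    have a' : HolderBound (n + 1) 0 (max (2 * (C * R)) (2 * (2 * (K * R))) * δ ^ α)
        (fun x => f (x + g₁ x) - f (x + g₂ x)) := a.mono (by
      rw [Real.mul_rpow zero_le_two hδ]
      calc C * R * (2 ^ α * δ ^ α) ≤ C * R * (2 * δ ^ α) := by gcongr
        _ = 2 * (C * R) * δ ^ α := by ring
        _ ≤ _ := by
          gcongr
          exact le_max_left _ _)
    have hKR : 0 ≤ K * R := by positivity
    have b' := b.mono (C' := max (2 * (C * R)) (2 * (2 * (K * R))))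
      (le_max_of_le_right (by linarith))
    have := b'.interpolate h0' hα' h0 hδ0 hδα a'
    rwa [← Real.rpow_mul hδ, mul_sub, mul_one, mul_div_cancel₀ _ h0.ne'] at this
  · refine (b.exponent_mono h0' hα').mono ?_
    have e1 : 1 ≤ δ ^ (α - α') := Real.one_le_rpow hδ1 (by linarith)
    calc 2 * (K * R + K * R) = 2 * (2 * (K * R)) * 1 := by ring
      _ ≤ _ := by
        gcongr
        exact le_max_right _ _

/-- Composition is Hölder continuous from bounded sets in `C^{n,α}` to `C^{n,α'}`. -/
theorem exists_mul_sub (n : ℕ) {α α' : ℝ} (h0' : 0 ≤ α') (hα' : α' ≤ α) (h0 : 0 < α)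
    (h1 : α ≤ 1) {R : ℝ} (hR : 0 ≤ R) :
    ∃ C : ℝ, 0 ≤ C ∧ ∀ (f₁ f₂ g₁ g₂ : E → E) (δ : ℝ),
      HolderBound (n + 1) α R f₁ → HolderBound (n + 1) α R f₂ →
      HolderBound (n + 1) α R g₁ → HolderBound (n + 1) α R g₂ →
      HolderBound (n + 1) α δ (fun x => f₁ x - f₂ x) →
      HolderBound (n + 1) α δ (fun x => g₁ x - g₂ x) →
      HolderBound (n + 1) α' (C * (δ + δ ^ (α - α')))
        (fun x => (g₁ x + f₁ (x + g₁ x)) - (g₂ x + f₂ (x + g₂ x))) := by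
  obtain ⟨C, hC0, hC⟩ := exists_comp_sub_rpow (E := E) n h0' hα' h0 h1 hR
  obtain ⟨K, hK1, hK⟩ := exists_comp (E := E) (n + 1) h0.le h1 hR
  have hK0 : 0 ≤ K := by linarith
  refine ⟨2 + 2 * K + C, by linarith, fun f₁ f₂ g₁ g₂ δ hf₁ hf₂ hg₁ hg₂ hf hg => ?_⟩
  have hδ := hg.nonneg
  have hp : 0 ≤ δ ^ (α - α') := Real.rpow_nonneg hδ _
  have a1 := (hg.exponent_mono h0' hα').add
    (((hK _ _ g₁ δ hf hg₁ hg₁.lipschitz).exponent_mono h0' hα').add (hC f₂ g₁ g₂ δ hf₂ hg₁ hg₂ hg))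
  have e : (fun x => (g₁ x + f₁ (x + g₁ x)) - (g₂ x + f₂ (x + g₂ x))) = fun x =>
      g₁ x - g₂ x + (f₁ (x + g₁ x) - f₂ (x + g₁ x) + (f₂ (x + g₁ x) - f₂ (x + g₂ x))) := by
    funext x
    abel
  rw [e]
  refine a1.mono ?_
  nlinarith [mul_nonneg hC0 hδ, mul_nonneg hK0 hp]

/-- Inversion is Hölder continuous from sets on which both the maps and their inverses are bounded
in `C^{n,α}` to `C^{n,α'}`, since `(id + h₁) ∘ (id + e) = id + h₂` for
`e = (f₁ - f₂) ∘ (id + h₂)`. -/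
theorem exists_inv_sub (n : ℕ) {α α' : ℝ} (h0' : 0 ≤ α') (hα' : α' ≤ α) (h0 : 0 < α)
    (h1 : α ≤ 1) {R : ℝ} (hR : 0 ≤ R) :
    ∃ C : ℝ, 0 ≤ C ∧ ∀ (f₁ f₂ h₁ h₂ : E → E) (δ : ℝ),
      HolderBound (n + 1) α R f₁ → HolderBound (n + 1) α R f₂ →
      HolderBound (n + 1) α R h₁ → HolderBound (n + 1) α R h₂ →
      (∀ x, x + f₁ x + h₁ (x + f₁ x) = x) → (∀ x, x + h₂ x + f₂ (x + h₂ x) = x) →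
      HolderBound (n + 1) α δ (fun x => f₁ x - f₂ x) →
      HolderBound (n + 1) α' (C * (δ + δ ^ (α - α'))) (fun x => h₁ x - h₂ x) := by
  obtain ⟨K, hK1, hK⟩ := exists_comp (E := E) (n + 1) h0.le h1 hR
  have hK0 : 0 ≤ K := by linarith
  obtain ⟨C, hC0, hC⟩ := exists_comp_sub_rpow (E := E) n h0' hα' h0 h1
    (R := R + K * (R + R)) (by positivity)
  refine ⟨2 * K + C * K ^ (α - α'), by positivity,
    fun f₁ f₂ h₁ h₂ δ hf₁ hf₂ hh₁ hh₂ hr hl hf => ?_⟩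
  have hδ := hf.nonneg
  have hp : 0 ≤ δ ^ (α - α') := Real.rpow_nonneg hδ _
  have hq : 0 ≤ K ^ (α - α') := Real.rpow_nonneg hK0 _
  have hKR : 0 ≤ K * (R + R) := by positivity
  have he := hK _ _ h₂ δ hf hh₂ hh₂.lipschitz
  have he' := hK _ _ h₂ (R + R) (hf₁.sub hf₂) hh₂ hh₂.lipschitz
  have hz : HolderBound (n + 1) α (K * δ)
      (fun x => 0 - (f₁ (x + h₂ x) - f₂ (x + h₂ x))) := by
    simpa only [zero_sub] using he.neg
  have a := hC h₁ (fun _ => 0) _ (K * δ) (hh₁.mono (by linarith)) (zero _ _ (by positivity))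
    (he'.mono (by linarith)) hz
  have e : (fun x => h₁ x - h₂ x) = fun x =>
      (h₁ (x + 0) - h₁ (x + (f₁ (x + h₂ x) - f₂ (x + h₂ x)))) -
        (f₁ (x + h₂ x) - f₂ (x + h₂ x)) := by
    funext x
    have e1 : x + (f₁ (x + h₂ x) - f₂ (x + h₂ x)) = x + h₂ x + f₁ (x + h₂ x) := by
      nth_rewrite 1 [← hl x]
      abel
    have e2 := hr (x + h₂ x)
    rw [← e1] at e2
    rw [add_zero, ← sub_eq_zero]
    rw [← sub_eq_zero] at e2
    rw [← e2]
    abel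
  rw [e]
  refine (a.sub (he.exponent_mono h0' hα')).mono ?_
  rw [Real.mul_rpow hK0 hδ]
  nlinarith [mul_nonneg hK0 hp, mul_nonneg (mul_nonneg hC0 hq) hδ]

end HolderBound

theorem holderZeroSubmodule_comp_mem {α : ℝ} (h0 : 0 ≤ α) (h1 : α ≤ 1) {f g : E → E}
    (hf : f ∈ holderZeroSubmodule E E (n + 1) α) (hg : g ∈ holderZeroSubmodule E E (n + 1) α) :
    (fun x => g x + f (x + g x)) ∈ holderZeroSubmodule E E (n + 1) α := by
  obtain ⟨A, hA⟩ := mem_holderZeroSubmodule_iff.1 hf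
  obtain ⟨R, hR⟩ := mem_holderZeroSubmodule_iff.1 hg
  obtain ⟨K, -, hK⟩ := HolderBound.exists_comp (E := E) (n + 1) h0 h1 hR.nonneg
  exact mem_holderZeroSubmodule_iff.2 ⟨_, hR.add (hK _ f g A hA hR hR.lipschitz)⟩

variable [FiniteDimensional ℝ E]

/-- The bounds in `C^{n,α}` on the inverses are locally uniform. -/
theorem HolderBound.exists_inverse_bound {α : ℝ} (h0 : 0 ≤ α) (h1 : α ≤ 1) {f₀ : E → E} {R₀ : ℝ}
    (hf₀ : HolderBound (n + 1) α R₀ f₀) (hdet : ∀ x, 0 < (1 + fderiv ℝ f₀ x).det) (R : ℝ) :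
    ∃ δ > 0, ∃ C : ℝ, ∀ f h : E → E, HolderBound (n + 1) α R f →
      HolderBound (n + 1) α δ (fun x => f x - f₀ x) → (∀ x, x + h x + f (x + h x) = x) →
      (∀ x, x + f x + h (x + f x) = x) → HolderBound (n + 1) α C h := by
  obtain ⟨δ, hδ, M, hM⟩ := exists_det_pos_and_inverse_bound hf₀.2.2.2.continuous
    hf₀.2.2.2.tendsto hdet
  obtain ⟨C, hC⟩ := HolderBound.exists_inverse_map (E := E) n h0 h1 R M
  refine ⟨δ, hδ, C, fun f h hf hff hl hr => ?_⟩
  obtain ⟨hp, hb⟩ := hM f fun x => by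
    have := hff.2.2.2.norm_le x
    rwa [fderiv_fun_sub (hf.1 x) (hf₀.1 x)] at this
  exact hC f h hf (fun x => (hp x).ne') hl hr hb

theorem exists_inverse_mem {f : E → E} {α : ℝ} (h0 : 0 ≤ α) (h1 : α ≤ 1)
    (hf : f ∈ holderZeroSubmodule E E (n + 1) α) (hdet : ∀ x, 0 < (1 + fderiv ℝ f x).det)
    {h : E → E} (hl : ∀ x, x + h x + f (x + h x) = x) (hr : ∀ x, x + f x + h (x + f x) = x) :
    h ∈ holderZeroSubmodule E E (n + 1) α := by
  obtain ⟨R, hR⟩ := mem_holderZeroSubmodule_iff.1 hf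
  obtain ⟨δ, hδ, C, hC⟩ := hR.exists_inverse_bound h0 h1 hdet R
  refine mem_holderZeroSubmodule_iff.2 ⟨C, hC f h hR ?_ hl hr⟩
  simpa only [sub_self] using HolderBound.zero (n + 1) α hδ.le

/-- Along a curve which is Lipschitz in `C^{n,α}`, the inverses are Hölder continuous in `C^{n,α'}`,
on compact intervals. -/
theorem HolderBound.exists_inv_curve {α α' : ℝ} (h0' : 0 ≤ α') (hα' : α' ≤ α) (h0 : 0 < α)
    (h1 : α ≤ 1) {f h : ℝ → E → E} {a b R L : ℝ}
    (hf : ∀ t ∈ Icc a b, HolderBound (n + 1) α R (f t))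
    (hL : ∀ t ∈ Icc a b, ∀ s ∈ Icc a b,
      HolderBound (n + 1) α (L * |t - s|) (fun x => f t x - f s x))
    (hdet : ∀ t x, 0 < (1 + fderiv ℝ (f t) x).det)
    (hl : ∀ t x, x + h t x + f t (x + h t x) = x) (hr : ∀ t x, x + f t x + h t (x + f t x) = x) :
    ∃ C : ℝ, ∀ t ∈ Icc a b, ∀ s ∈ Icc a b,
      HolderBound (n + 1) α' (C * (L * |t - s| + (L * |t - s|) ^ (α - α')))
        (fun x => h t x - h s x) := by
  rcases (Icc a b).eq_empty_or_nonempty with hab | ⟨t₁, ht₁⟩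
  · exact ⟨0, by simp [hab]⟩
  have key : ∃ C : ℝ, ∀ t ∈ Icc a b, HolderBound (n + 1) α C (h t) := by
    refine isCompact_Icc.induction_on (p := fun s => ∃ C : ℝ, ∀ t ∈ s,
      HolderBound (n + 1) α C (h t)) ⟨0, by simp⟩ ?_ ?_ ?_
    · rintro s t hst ⟨C, hC⟩
      exact ⟨C, fun x hx => hC x (hst hx)⟩
    · rintro s t ⟨C, hC⟩ ⟨C', hC'⟩
      refine ⟨max C C', ?_⟩
      rintro x (hx | hx)
      · exact (hC x hx).mono (le_max_left _ _)
      · exact (hC' x hx).mono (le_max_right _ _)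
    · intro t₀ ht₀
      obtain ⟨δ, hδ, C, hC⟩ := (hf t₀ ht₀).exists_inverse_bound h0.le h1 (hdet t₀) R
      have hU : ∀ᶠ t in 𝓝 t₀, L * |t - t₀| < δ := by
        have : Tendsto (fun t => L * |t - t₀|) (𝓝 t₀) (𝓝 (L * |t₀ - t₀|)) :=
          Continuous.tendsto (by fun_prop) t₀
        exact this.eventually (gt_mem_nhds (by simpa using hδ))
      refine ⟨{t | L * |t - t₀| < δ} ∩ Icc a b,
        inter_mem (mem_nhdsWithin_of_mem_nhds hU) self_mem_nhdsWithin, C, fun t ht => ?_⟩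
      exact hC _ _ (hf t ht.2) ((hL t ht.2 t₀ ht₀).mono ht.1.le) (hl t) (hr t)
  obtain ⟨C, hC⟩ := key
  have hR := (hf t₁ ht₁).nonneg
  obtain ⟨C', -, hC'⟩ := HolderBound.exists_inv_sub (E := E) n h0' hα' h0 h1
    (hR.trans (le_max_left R C))
  refine ⟨C', fun t ht s hs => ?_⟩
  exact hC' (f t) (f s) _ _ _ ((hf t ht).mono (le_max_left _ _))
    ((hf s hs).mono (le_max_left _ _)) ((hC t ht).mono (le_max_right _ _))
    ((hC s hs).mono (le_max_right _ _)) (hr t) (hl s) (hL t ht s hs)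

end GroupEstimates

/-! ### Inductive locally convex topologies and Mackey completeness -/

section Topologies

namespace LcFinal

variable {ι V : Type*} [AddCommGroup V] [Module ℝ V] {X : ι → Type*}
  [∀ i, NormedAddCommGroup (X i)] [∀ i, NormedSpace ℝ (X i)] (j : ∀ i, X i →ₗ[ℝ] V)

theorem isTopologicalAddGroup : @IsTopologicalAddGroup V (lcFinalTopology j) _ :=
  topologicalAddGroup_sInf fun _ ht => ht.1

theorem continuousSMul : @ContinuousSMul ℝ V _ _ (lcFinalTopology j) :=
  continuousSMul_sInf fun _ ht => ht.2.1

theorem locallyConvexSpace : @LocallyConvexSpace ℝ V _ _ _ _ (lcFinalTopology j) :=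
  LocallyConvexSpace.sInf fun _ ht => ht.2.2.1

theorem continuous_map (i : ι) : @Continuous (X i) V _ (lcFinalTopology j) (j i) :=
  continuous_sInf_rng.2 fun _ ht => ht.2.2.2 i

/-- The universal property of the inductive locally convex topology. -/
theorem continuous_of_comp {W : Type*} [AddCommGroup W] [Module ℝ W] [TopologicalSpace W]
    [IsTopologicalAddGroup W] [ContinuousSMul ℝ W] [LocallyConvexSpace ℝ W] (T : V →ₗ[ℝ] W)
    (h : ∀ i, Continuous fun x => T (j i x)) : @Continuous V W (lcFinalTopology j) _ T := by
  refine continuous_iff_le_induced.2 (sInf_le ⟨topologicalAddGroup_induced T,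
    continuousSMul_induced T, LocallyConvexSpace.induced T, fun i => ?_⟩)
  exact continuous_induced_rng.2 (h i)

end LcFinal

/-- Mackey-Cauchy sequences are Cauchy. -/
theorem IsFrechetSpace.isMackeyComplete {V : Type*} [AddCommGroup V] [Module ℝ V]
    [TopologicalSpace V] (h : IsFrechetSpace V) : IsMackeyComplete V := by
  rintro x ⟨B, hB, μ, hμ, hx⟩
  refine h.complete x fun U hU => ?_
  choose b hb hbx using hx
  have ht := hB.smul_tendsto_zero (x := fun p : ℕ × ℕ => b p.1 p.2)
    (Eventually.of_forall fun p => hb p.1 p.2) hμ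
  obtain ⟨N, hN⟩ := eventually_atTop_prod_self'.1 (ht.eventually hU)
  refine ⟨N, fun p hp q hq => ?_⟩
  rw [hbx]
  exact hN p hp q hq

section Curves

variable {V V' : Type*} [AddCommGroup V] [Module ℝ V] [TopologicalSpace V] [AddCommGroup V']
  [Module ℝ V'] [TopologicalSpace V'] {c : ℝ → V}

theorem IsSmoothCurve.map (hc : IsSmoothCurve c) (T : V →L[ℝ] V') :
    IsSmoothCurve fun t => T (c t) := by
  obtain ⟨D, rfl, hD⟩ := hc
  refine ⟨fun k t => T (D k t), rfl, fun k t => ?_⟩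
  have := (T.continuous.tendsto _).comp (hD k t)
  refine this.congr fun s => ?_
  simp

theorem IsSmoothCurve.exists_lipschitz {W : Type*} [NormedAddCommGroup W] [NormedSpace ℝ W]
    (hc : IsSmoothCurve c) (T : V →L[ℝ] W) (a b : ℝ) :
    ∃ L : ℝ, 0 ≤ L ∧ ∀ t ∈ Icc a b, ∀ s ∈ Icc a b, ‖T (c t) - T (c s)‖ ≤ L * |t - s| := by
  obtain ⟨D, h0, hD⟩ := hc.map T
  have hd : ∀ k t, HasDerivAt (D k) (D (k + 1) t) t := fun k t => by
    rw [hasDerivAt_iff_tendsto_slope]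
    exact hD k t
  have hcont : Continuous (D 1) := continuous_iff_continuousAt.2 fun t => (hd 1 t).continuousAt
  obtain ⟨L, hL⟩ := isCompact_Icc.exists_bound_of_continuousOn (hcont.continuousOn (s := Icc a b))
  refine ⟨max L 0, le_max_right _ _, fun t ht s hs => ?_⟩
  have := Convex.norm_image_sub_le_of_norm_hasDerivWithin_le
    (fun x _ => (hd 0 x).hasDerivWithinAt) (fun x hx => (hL x hx).trans (le_max_left L 0))
    (convex_Icc a b) hs ht
  rwa [h0, Real.norm_eq_abs] at this

end Curves

end Topologies

/-! ### The spaces `C₀^{n,β-}` -/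

section Inclusions

variable {E F : Type} [NormedAddCommGroup E] [NormedSpace ℝ E]
  [NormedAddCommGroup F] [NormedSpace ℝ F] {n : ℕ}

/-- The inclusion of `C₀^{n,α}` into `C₀^{n,α'}`, for `α' ≤ α`. -/
def HolderZero.inclₗ {α α' : ℝ} (h0 : 0 ≤ α') (h : α' ≤ α) :
    HolderZero E F n α →ₗ[ℝ] HolderZero E F n α' where
  toFun f := ⟨f.1, mem_holderZeroSubmodule_iff.2 ⟨_, f.holderBound.exponent_mono h0 h⟩⟩
  map_add' _ _ := rfl
  map_smul' _ _ := rfl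

theorem HolderZero.inclₗ_val {α α' : ℝ} (h0 : 0 ≤ α') (h : α' ≤ α) (f : HolderZero E F n α) :
    (HolderZero.inclₗ h0 h f).1 = f.1 := by
  have H : f.1 ∈ holderZeroSubmodule E F n α' :=
    mem_holderZeroSubmodule_iff.2 ⟨_, f.holderBound.exponent_mono h0 h⟩
  have e : HolderZero.inclₗ h0 h f = (⟨f.1, H⟩ : holderZeroSubmodule E F n α') := rfl
  exact (congrArg Subtype.val e).trans (Subtype.coe_mk f.1 H)

theorem HolderZero.norm_inclₗ_le {α α' : ℝ} (h0 : 0 ≤ α') (h : α' ≤ α) (f : HolderZero E F n α) :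
    ‖HolderZero.inclₗ h0 h f‖ ≤ 2 * ‖f‖ :=
  HolderZero.norm_le_of_val_eq (HolderZero.inclₗ_val h0 h f) (f.holderBound.exponent_mono h0 h)

/-- The inclusion of `C₀^{n,α}` into `C₀^{n,α'}`, for `α' ≤ α`, as a continuous linear map. -/
def HolderZero.incl {α α' : ℝ} (h0 : 0 ≤ α') (h : α' ≤ α) :
    HolderZero E F n α →L[ℝ] HolderZero E F n α' :=
  (HolderZero.inclₗ h0 h).mkContinuous 2 (HolderZero.norm_inclₗ_le h0 h)

theorem HolderZero.incl_val {α α' : ℝ} (h0 : 0 ≤ α') (h : α' ≤ α) (f : HolderZero E F n α) :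
    (HolderZero.incl h0 h f).1 = f.1 := HolderZero.inclₗ_val h0 h f

end Inclusions

namespace HolderMinus

variable {d n : ℕ} {β : ℝ}

theorem isTopologicalAddGroup : IsTopologicalAddGroup (HolderMinus d n β) :=
  topologicalAddGroup_iInf fun α => topologicalAddGroup_induced (HolderMinus.toStep d n β α)

theorem continuousSMul : ContinuousSMul ℝ (HolderMinus d n β) :=
  continuousSMul_iInf fun α => continuousSMul_induced (HolderMinus.toStep d n β α)

theorem locallyConvexSpace : LocallyConvexSpace ℝ (HolderMinus d n β) :=
  LocallyConvexSpace.iInf fun α => LocallyConvexSpace.induced (HolderMinus.toStep d n β α)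

/-- The element of `C₀^{n,β-}` given by a function. -/
def mk (f : Euc d → Euc d) (h : f ∈ holderMinusSubmodule d n β) : HolderMinus d n β := ⟨f, h⟩

theorem mk_val (f : Euc d → Euc d) (h : f ∈ holderMinusSubmodule d n β) : (mk f h).1 = f := rfl

theorem toStep_val (α : Ioo 0 β) (v : HolderMinus d n β) : (toStep d n β α v).1 = v.1 := by
  have H : v.1 ∈ holderZeroSubmodule (Euc d) (Euc d) n α := mem_holderMinusSubmodule.1 v.2 α α.2
  have e : toStep d n β α v = (⟨v.1, H⟩ : holderZeroSubmodule (Euc d) (Euc d) n α) := rfl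
  exact (congrArg Subtype.val e).trans (Subtype.coe_mk v.1 H)

theorem incl_toStep {α α' : Ioo 0 β} (h : α' ≤ α) (v : HolderMinus d n β) :
    HolderZero.incl α'.2.1.le h (toStep d n β α v) = toStep d n β α' v :=
  HolderZero.ext (by rw [HolderZero.incl_val, toStep_val, toStep_val])

theorem ext {v w : HolderMinus d n β} (h : v.1 = w.1) : v = w := Subtype.ext h

theorem tendsto_iff {ι : Type*} {l : Filter ι} {u : ι → HolderMinus d n β}
    {v : HolderMinus d n β} : Tendsto u l (𝓝 v) ↔
      ∀ α, Tendsto (fun i => toStep d n β α (u i)) l (𝓝 (toStep d n β α v)) := by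
  rw [nhds_iInf, tendsto_iInf]
  refine forall_congr' fun α => ?_
  rw [nhds_induced, tendsto_comap_iff]
  rfl

/-- The continuous inclusion of `C₀^{n,β-}` into `C₀^{n,α}`, for `0 < α < β`. -/
def toStepL (d n : ℕ) (β : ℝ) (α : Ioo 0 β) :
    HolderMinus d n β →L[ℝ] HolderZero (Euc d) (Euc d) n (α : ℝ) where
  toLinearMap := toStep d n β α
  cont := continuous_iff_continuousAt.2 fun _ => tendsto_iff.1 tendsto_id α

theorem isVonNBounded_of_forall {B : Set (HolderMinus d n β)}
    (h : ∀ α : Ioo 0 β, ∃ C : ℝ, ∀ v ∈ B, HolderBound n (α : ℝ) C v.1) :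
    Bornology.IsVonNBounded ℝ B := by
  have := continuousSMul (d := d) (n := n) (β := β)
  refine Bornology.isVonNBounded_of_smul_tendsto_zero (ε := fun k : ℕ => 1 / ((k : ℝ) + 1))
    (l := atTop) (Eventually.of_forall fun k => by positivity) fun x hx => ?_
  refine tendsto_iff.2 fun α => ?_
  obtain ⟨C, hC⟩ := h α
  rw [map_zero, tendsto_zero_iff_norm_tendsto_zero]
  refine squeeze_zero (fun _ => norm_nonneg _) (fun k => ?_)
    (by simpa only [zero_mul] using tendsto_one_div_add_atTop_nhds_zero_nat.mul_const C)
  change ‖toStep d n β α ((1 / ((k : ℝ) + 1)) • x k)‖ ≤ _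
  rw [map_smul, norm_smul, Real.norm_of_nonneg (by positivity)]
  gcongr
  exact HolderZero.norm_le_of_val_eq (toStep_val α (x k)) (hC _ (hx k))

/-- A sequence of exponents which is cofinal in `(0, β)`. -/
def exponent (hβ : 0 < β) (k : ℕ) : Ioo 0 β :=
  ⟨β - β / (k + 2), by
    have hk : (0 : ℝ) < k + 2 := by positivity
    rw [mem_Ioo, sub_pos, sub_lt_self_iff, div_lt_iff₀ hk]
    refine ⟨?_, by positivity⟩
    have : (0 : ℝ) ≤ k := by positivity
    nlinarith⟩

theorem exists_le_exponent (hβ : 0 < β) (α : Ioo 0 β) : ∃ k, α ≤ exponent hβ k := by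
  obtain ⟨k, hk⟩ := exists_nat_one_div_lt (div_pos (sub_pos.2 α.2.2) hβ)
  refine ⟨k, ?_⟩
  rw [← Subtype.coe_le_coe]
  have hk1 : (0 : ℝ) < k + 1 := by positivity
  rw [div_lt_div_iff₀ hk1 hβ, one_mul] at hk
  have : β / (k + 2) ≤ β - α := by
    rw [div_le_iff₀ (by positivity)]
    have := α.2.2
    nlinarith
  simp only [exponent]
  linarith

theorem isInducing_pi (hβ : 0 < β) : IsInducing fun (v : HolderMinus d n β) (k : ℕ) =>
    toStep d n β (exponent hβ k) v := by
  refine isInducing_iff_nhds.2 fun v => le_antisymm ?_ fun s hs => ?_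
  · exact (tendsto_pi_nhds.2 fun k => tendsto_iff.1 tendsto_id _).le_comap
  · have : Tendsto id (comap (fun (v : HolderMinus d n β) (k : ℕ) =>
        toStep d n β (exponent hβ k) v) (𝓝 fun k => toStep d n β (exponent hβ k) v)) (𝓝 v) := by
      refine tendsto_iff.2 fun α => ?_
      obtain ⟨k, hk⟩ := exists_le_exponent hβ α
      have h0 : Tendsto (fun w => toStep d n β (exponent hβ k) w)
          (comap (fun (v : HolderMinus d n β) (k : ℕ) => toStep d n β (exponent hβ k) v)
            (𝓝 fun k => toStep d n β (exponent hβ k) v)) (𝓝 (toStep d n β (exponent hβ k) v)) :=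
        ((continuous_apply k).tendsto (fun k => toStep d n β (exponent hβ k) v)).comp tendsto_comap
      have h1 := ((HolderZero.incl α.2.1.le hk).continuous.tendsto _).comp h0
      rw [incl_toStep] at h1
      exact h1.congr fun w => incl_toStep hk w
    exact this hs

theorem isFrechetSpace (hβ : 0 < β) : IsFrechetSpace (HolderMinus d n β) where
  isTopologicalAddGroup := isTopologicalAddGroup
  continuousSMul := continuousSMul
  locallyConvex := locallyConvexSpace
  metrizable := by
    have h := isInducing_pi (d := d) (n := n) hβ
    have hi : Function.Injective fun (v : HolderMinus d n β) (k : ℕ) =>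
        toStep d n β (exponent hβ k) v := fun v w hvw =>
      ext (by rw [← toStep_val (exponent hβ 0), ← toStep_val (exponent hβ 0)]
              exact congrArg (fun g => g.1) (congrFun hvw 0))
    have : TopologicalSpace.MetrizableSpace
        (∀ k : ℕ, HolderZero (Euc d) (Euc d) n (exponent hβ k : ℝ)) := UniformSpace.metrizableSpace
    exact (IsEmbedding.mk h hi).metrizableSpace
  complete := by
    intro x hx
    have hc : ∀ α, CauchySeq fun p => toStep d n β α (x p) := by
      intro α
      refine Metric.cauchySeq_iff.2 fun ε hε => ?_
      have hU : (fun v => toStep d n β α v) ⁻¹' Metric.ball 0 ε ∈ 𝓝 (0 : HolderMinus d n β) := by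
        refine (toStepL d n β α).continuous.tendsto 0 ?_
        rw [map_zero]
        exact Metric.ball_mem_nhds _ hε
      obtain ⟨N, hN⟩ := hx _ hU
      refine ⟨N, fun p hp q hq => ?_⟩
      have := hN p hp q hq
      rwa [mem_preimage, map_sub, mem_ball_zero_iff, ← dist_eq_norm] at this
    choose g hg using fun α => cauchySeq_tendsto_of_complete (hc α)
    have hpt : ∀ α y, Tendsto (fun p => (x p).1 y) atTop (𝓝 ((g α).1 y)) := by
      intro α y
      refine tendsto_iff_norm_sub_tendsto_zero.2 ?_
      refine squeeze_zero (fun _ => norm_nonneg _) (fun p => ?_)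
        (tendsto_iff_norm_sub_tendsto_zero.1 (hg α))
      have := (toStep d n β α (x p) - g α).holderBound.norm_le y
      rwa [HolderZero.sub_val, toStep_val] at this
    have heq : ∀ α α', (g α).1 = (g α').1 := fun α α' => funext fun y =>
      tendsto_nhds_unique (hpt α y) (hpt α' y)
    have hmem : (g (exponent hβ 0)).1 ∈ holderMinusSubmodule d n β :=
      mem_holderMinusSubmodule.2 fun α hα => heq ⟨α, hα⟩ (exponent hβ 0) ▸ (g ⟨α, hα⟩).2
    refine ⟨mk _ hmem, tendsto_iff.2 fun α => ?_⟩
    convert hg α using 2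
    refine HolderZero.ext ?_
    rw [toStep_val, mk_val]
    exact heq _ _

theorem isConvenient (hβ : 0 < β) : IsConvenient (HolderMinus d n β) where
  isTopologicalAddGroup := isTopologicalAddGroup
  continuousSMul := continuousSMul
  locallyConvex := locallyConvexSpace
  t2 := by
    have := (isFrechetSpace (d := d) (n := n) hβ).metrizable
    infer_instance
  mackeyComplete := (isFrechetSpace hβ).isMackeyComplete

end HolderMinus

/-! ### The spaces `C₀^{n,β+}` -/

namespace HolderPlus

variable {d n : ℕ} {β : ℝ}

theorem isTopologicalAddGroup : IsTopologicalAddGroup (HolderPlus d n β) :=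
  LcFinal.isTopologicalAddGroup _

theorem continuousSMul : ContinuousSMul ℝ (HolderPlus d n β) := LcFinal.continuousSMul _

theorem locallyConvexSpace : LocallyConvexSpace ℝ (HolderPlus d n β) :=
  LcFinal.locallyConvexSpace _

/-- The element of `C₀^{n,β+}` given by a function. -/
def mk (f : Euc d → Euc d) (h : f ∈ holderPlusSubmodule d n β) : HolderPlus d n β := ⟨f, h⟩

theorem mk_val (f : Euc d → Euc d) (h : f ∈ holderPlusSubmodule d n β) : (mk f h).1 = f := rfl

theorem ext {v w : HolderPlus d n β} (h : v.1 = w.1) : v = w := Subtype.ext h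

theorem ofStep_val (α : Ioo β 1) (f : HolderZero (Euc d) (Euc d) n (α : ℝ)) :
    (ofStep d n β α f).1 = f.1 := by
  have H : f.1 ∈ holderPlusSubmodule d n β :=
    le_iSup (fun a : Ioo β 1 => holderZeroSubmodule (Euc d) (Euc d) n a) α f.2
  have e : ofStep d n β α f = mk f.1 H := rfl
  rw [e, mk_val]

/-- The continuous inclusion of `C₀^{n,α}` into `C₀^{n,β+}`, for `β < α < 1`. -/
def ofStepL (d n : ℕ) (β : ℝ) (α : Ioo β 1) :
    HolderZero (Euc d) (Euc d) n (α : ℝ) →L[ℝ] HolderPlus d n β where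
  toLinearMap := ofStep d n β α
  cont := LcFinal.continuous_map (ofStep d n β) α

theorem mem_zero (hβ : 0 ≤ β) (v : HolderPlus d n β) :
    v.1 ∈ holderZeroSubmodule (Euc d) (Euc d) n 0 :=
  iSup_le (fun α : Ioo β 1 => holderZeroSubmodule_anti le_rfl (hβ.trans α.2.1.le)) v.2

theorem contDiff (hβ : 0 ≤ β) (v : HolderPlus d n β) : ContDiff ℝ n v.1 := (mem_zero hβ v).1

/-- The inclusion of `C₀^{n,β+}` into `C₀^{n,0}`, that is, into `C₀ⁿ`. -/
def toZeroₗ (hβ : 0 ≤ β) : HolderPlus d n β →ₗ[ℝ] HolderZero (Euc d) (Euc d) n 0 where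
  toFun v := ⟨v.1, mem_zero hβ v⟩
  map_add' _ _ := rfl
  map_smul' _ _ := rfl

theorem toZeroₗ_val (hβ : 0 ≤ β) (v : HolderPlus d n β) : (toZeroₗ hβ v).1 = v.1 := by
  have e : toZeroₗ hβ v = (⟨v.1, mem_zero hβ v⟩ : holderZeroSubmodule (Euc d) (Euc d) n 0) := rfl
  exact (congrArg Subtype.val e).trans (Subtype.coe_mk v.1 (mem_zero hβ v))

theorem toZeroₗ_ofStep (hβ : 0 ≤ β) (α : Ioo β 1) (f : HolderZero (Euc d) (Euc d) n (α : ℝ)) :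
    toZeroₗ hβ (ofStep d n β α f) = HolderZero.incl le_rfl (hβ.trans α.2.1.le) f :=
  HolderZero.ext (by rw [toZeroₗ_val, ofStep_val, HolderZero.incl_val])

/-- The inclusion of `C₀^{n,β+}` into `C₀^{n,0}` as a continuous linear map. -/
def toZero (hβ : 0 ≤ β) : HolderPlus d n β →L[ℝ] HolderZero (Euc d) (Euc d) n 0 where
  toLinearMap := toZeroₗ hβ
  cont := LcFinal.continuous_of_comp (ofStep d n β) (toZeroₗ hβ) fun α => by
    simp only [toZeroₗ_ofStep]
    exact (HolderZero.incl le_rfl (hβ.trans α.2.1.le)).continuous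

theorem toZero_val (hβ : 0 ≤ β) (v : HolderPlus d n β) : (toZero hβ v).1 = v.1 :=
  toZeroₗ_val hβ v

theorem toZero_injective (hβ : 0 ≤ β) :
    Function.Injective (toZero hβ : HolderPlus d n β → HolderZero (Euc d) (Euc d) n 0) :=
  fun v w h => ext (by rw [← toZero_val hβ, ← toZero_val hβ, h])

theorem t2Space (hβ : 0 ≤ β) : T2Space (HolderPlus d n β) :=
  T2Space.of_injective_continuous (toZero_injective hβ) (toZero hβ).continuous

theorem exists_eq_ofStep (hβ : β ∈ Ico (0 : ℝ) 1) (v : HolderPlus d n β) :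
    ∃ (α : Ioo β 1) (f : HolderZero (Euc d) (Euc d) n (α : ℝ)), ofStep d n β α f = v := by
  obtain ⟨α, hα, h⟩ := (mem_holderPlusSubmodule hβ).1 v.2
  let f : HolderZero (Euc d) (Euc d) n ((⟨α, hα⟩ : Ioo β 1) : ℝ) := ⟨v.1, h⟩
  have hf : f.1 = v.1 := rfl
  exact ⟨⟨α, hα⟩, f, ext ((ofStep_val _ f).trans hf)⟩

/-- A pointwise bounded sequence of linear maps, with uniform bounds on each step of the inductive
limit, is a continuous linear map into the bounded sequences. -/
theorem exists_clm_of_sequence (hβ : β ∈ Ico (0 : ℝ) 1) {W : Type} [NormedAddCommGroup W]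
    [NormedSpace ℝ W] (T : ℕ → HolderPlus d n β →ₗ[ℝ] W)
    (hT : ∀ α : Ioo β 1, ∃ C : ℝ, ∀ (k : ℕ) (f : HolderZero (Euc d) (Euc d) n (α : ℝ)),
      ‖T k (ofStep d n β α f)‖ ≤ C * ‖f‖) :
    ∃ S : HolderPlus d n β →L[ℝ] BoundedContinuousFunction ℕ W, ∀ v k, S v k = T k v := by
  have hb : ∀ v, ∃ C : ℝ, ∀ k, ‖T k v‖ ≤ C := by
    intro v
    obtain ⟨α, f, rfl⟩ := exists_eq_ofStep hβ v
    obtain ⟨C, hC⟩ := hT α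
    exact ⟨_, fun k => hC k f⟩
  choose b hb using hb
  let S : HolderPlus d n β →ₗ[ℝ] BoundedContinuousFunction ℕ W :=
    { toFun := fun v => BoundedContinuousFunction.ofNormedAddCommGroupDiscrete
        (fun k => T k v) (b v) (hb v)
      map_add' := fun v w => by
        ext k
        simp
      map_smul' := fun c v => by
        ext k
        simp }
  have hS : ∀ v k, S v k = T k v := fun v k => rfl
  refine ⟨⟨S, LcFinal.continuous_of_comp (ofStep d n β) S fun α => ?_⟩, hS⟩
  obtain ⟨C, hC⟩ := hT α
  have hC' : ∀ f, ‖(S ∘ₗ ofStep d n β α) f‖ ≤ max C 0 * ‖f‖ := fun f => by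
    refine (BoundedContinuousFunction.norm_le (by positivity)).2 fun k => ?_
    refine (hC k f).trans ?_
    gcongr
    exact le_max_left _ _
  exact ((S ∘ₗ ofStep d n β α).mkContinuous _ hC').continuous

/-- A sequence of exponents which is coinitial in `(β, 1)`. -/
def exponent (hβ : β < 1) (k : ℕ) : Ioo β 1 :=
  ⟨β + (1 - β) / (k + 2), by
    have hk : (0 : ℝ) < k + 2 := by positivity
    have h1 : 0 < 1 - β := by linarith
    refine ⟨by linarith [div_pos h1 hk], ?_⟩
    have : (1 - β) / (k + 2) < 1 - β := by
      rw [div_lt_iff₀ hk]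
      have : (0 : ℝ) ≤ k := by positivity
      nlinarith
    linarith⟩

theorem exponent_anti (hβ : β < 1) : Antitone (exponent hβ) := by
  intro k l hkl
  rw [← Subtype.coe_le_coe]
  simp only [exponent]
  have : (k : ℝ) ≤ l := by exact_mod_cast hkl
  have h1 : 0 < 1 - β := by linarith
  gcongr

theorem exists_exponent_le (hβ : β < 1) (α : Ioo β 1) : ∃ k, exponent hβ k ≤ α := by
  have h1 : 0 < 1 - β := by linarith
  obtain ⟨k, hk⟩ := exists_nat_one_div_lt (div_pos (sub_pos.2 α.2.1) h1)
  refine ⟨k, ?_⟩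
  rw [← Subtype.coe_le_coe]
  have hk1 : (0 : ℝ) < k + 1 := by positivity
  rw [div_lt_div_iff₀ hk1 h1, one_mul] at hk
  have : (1 - β) / (k + 2) ≤ α - β := by
    rw [div_le_iff₀ (by positivity)]
    have := α.2.1
    nlinarith
  simp only [exponent]
  linarith

/-- The normalized difference of the `n`-th derivatives at two points, as a linear map. -/
def diffQuot (hβ : 0 ≤ β) (c : ℝ) (x y : Euc d) :
    HolderPlus d n β →ₗ[ℝ] (Euc d [×n]→L[ℝ] Euc d) where
  toFun v := c • (iteratedFDeriv ℝ n v.1 x - iteratedFDeriv ℝ n v.1 y)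
  map_add' v w := by
    change c • (iteratedFDeriv ℝ n (v.1 + w.1) x - iteratedFDeriv ℝ n (v.1 + w.1) y) = _
    rw [iteratedFDeriv_add_apply (contDiff hβ v).contDiffAt (contDiff hβ w).contDiffAt,
      iteratedFDeriv_add_apply (contDiff hβ v).contDiffAt (contDiff hβ w).contDiffAt,
      add_sub_add_comm, smul_add]
  map_smul' a v := by
    change c • (iteratedFDeriv ℝ n (a • v.1) x - iteratedFDeriv ℝ n (a • v.1) y) = _
    rw [iteratedFDeriv_const_smul_apply (contDiff hβ v).contDiffAt,
      iteratedFDeriv_const_smul_apply (contDiff hβ v).contDiffAt, ← smul_sub, smul_comm]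
    rfl

theorem diffQuot_apply (hβ : 0 ≤ β) (c : ℝ) (x y : Euc d) (v : HolderPlus d n β) :
    diffQuot hβ c x y v = c • (iteratedFDeriv ℝ n v.1 x - iteratedFDeriv ℝ n v.1 y) := rfl

/-- The inductive limit `C₀^{n,β+}` is regular: a bounded set is contained and bounded in one of the
steps. Otherwise there are `f_k` in the set, exponents `α_k → β` and points `x_k`, `y_k` such that
`‖f_k⁽ⁿ⁾(x_k) - f_k⁽ⁿ⁾(y_k)‖ > k ‖x_k - y_k‖ ^ α_k`, with `‖x_k - y_k‖ ≤ 1`. The seminorm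
`sup_k ‖f⁽ⁿ⁾(x_k) - f⁽ⁿ⁾(y_k)‖ / ‖x_k - y_k‖ ^ α_k` is continuous on every step, since
`α_k ≤ α` for all but finitely many `k`, but it is not bounded on the set. Boundedness is used in
the form that continuous linear maps into normed spaces are bounded on the set. -/
theorem exists_bound (hβ : β ∈ Ico (0 : ℝ) 1) {B : Set (HolderPlus d n β)}
    (hB : ∀ (W : Type) [NormedAddCommGroup W] [NormedSpace ℝ W] (T : HolderPlus d n β →L[ℝ] W),
      ∃ C : ℝ, ∀ v ∈ B, ‖T v‖ ≤ C) :
    ∃ (α : Ioo β 1) (R : ℝ), ∀ v ∈ B, HolderBound n (α : ℝ) R v.1 := by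
  by_contra! hcon
  obtain ⟨K, hK⟩ := hB _ (toZero hβ.1)
  have hK0 : ∀ v ∈ B, HolderBound n 0 K v.1 := fun v hv => by
    rw [← toZero_val hβ.1 v]
    exact (toZero hβ.1 v).holderBound.mono (hK v hv)
  choose f hfB hf using fun k : ℕ => hcon (exponent hβ.2 k) (k + K)
  have hKn : 0 ≤ K := (hK0 _ (hfB 0)).nonneg
  have hxy : ∀ k : ℕ, ∃ x y, (k + K) * ‖x - y‖ ^ (exponent hβ.2 k : ℝ) <
      ‖iteratedFDeriv ℝ n (f k).1 x - iteratedFDeriv ℝ n (f k).1 y‖ := by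
    intro k
    by_contra! h
    obtain ⟨h1, h2, h3, -⟩ := holderBound_iff.1 (hK0 _ (hfB k))
    refine hf k (holderBound_iff.2 ⟨h1, fun l hl x => (h2 l hl x).trans ?_, h3, h⟩)
    have : (0 : ℝ) ≤ k := by positivity
    linarith
  choose x y hxy using hxy
  have hexp : ∀ k, 0 < (exponent hβ.2 k : ℝ) := fun k => hβ.1.trans_lt (exponent hβ.2 k).2.1
  have hr0 : ∀ k, 0 < ‖x k - y k‖ := by
    intro k
    refine norm_pos_iff.2 fun h => ?_
    have := hxy k
    rw [sub_eq_zero.1 h, sub_self, sub_self, norm_zero, norm_zero,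
      Real.zero_rpow (hexp k).ne'] at this
    simp at this
  have hr1 : ∀ k, ‖x k - y k‖ ≤ 1 := by
    intro k
    by_contra! h
    have h1 := Real.one_le_rpow h.le (hexp k).le
    have h2 := (holderBound_iff.1 (hK0 _ (hfB k))).2.2.2 (x k) (y k)
    rw [Real.rpow_zero, mul_one] at h2
    have : (0 : ℝ) ≤ k := by positivity
    nlinarith [hxy k]
  obtain ⟨S, hS⟩ := exists_clm_of_sequence hβ
    (fun k => diffQuot (n := n) hβ.1 (‖x k - y k‖ ^ (exponent hβ.2 k : ℝ))⁻¹ (x k) (y k)) (by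
      intro α
      have hb : IsBoundedUnder (· ≤ ·) atTop
          fun k => ‖x k - y k‖ ^ ((α : ℝ) - (exponent hβ.2 k : ℝ)) := by
        obtain ⟨k₀, hk₀⟩ := exists_exponent_le hβ.2 α
        refine ⟨1, eventually_map.2 (eventually_atTop.2 ⟨k₀, fun k hk => ?_⟩)⟩
        have : (exponent hβ.2 k : ℝ) ≤ α := ((exponent_anti hβ.2 hk).trans hk₀)
        exact Real.rpow_le_one (hr0 k).le (hr1 k) (by linarith)
      obtain ⟨C, hC⟩ := hb.bddAbove_range
      refine ⟨C, fun k g => ?_⟩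
      have h1 := (holderBound_iff.1 g.holderBound).2.2.2 (x k) (y k)
      have hp := Real.rpow_pos_of_pos (hr0 k) (exponent hβ.2 k : ℝ)
      rw [diffQuot_apply, ofStep_val, norm_smul, norm_inv, Real.norm_of_nonneg hp.le]
      calc _ ≤ (‖x k - y k‖ ^ (exponent hβ.2 k : ℝ))⁻¹ * (‖g‖ * ‖x k - y k‖ ^ (α : ℝ)) := by gcongr
        _ = ‖x k - y k‖ ^ ((α : ℝ) - (exponent hβ.2 k : ℝ)) * ‖g‖ := by
          rw [Real.rpow_sub (hr0 k)]
          field_simp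
        _ ≤ C * ‖g‖ := by
          gcongr
          exact hC ⟨k, rfl⟩)
  obtain ⟨C, hC⟩ := hB _ S
  obtain ⟨k, hk⟩ := exists_nat_gt C
  have h1 : ‖S (f k) k‖ ≤ C := (BoundedContinuousFunction.norm_coe_le_norm _ _).trans (hC _ (hfB k))
  have hp := Real.rpow_pos_of_pos (hr0 k) (exponent hβ.2 k : ℝ)
  rw [hS, diffQuot_apply, norm_smul, norm_inv, Real.norm_of_nonneg hp.le, inv_mul_le_iff₀ hp] at h1
  nlinarith [hxy k]

theorem isVonNBounded_of_bound (α : Ioo β 1) {R : ℝ} {B : Set (HolderPlus d n β)}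
    (h : ∀ v ∈ B, HolderBound n (α : ℝ) R v.1) : Bornology.IsVonNBounded ℝ B := by
  have hb : Bornology.IsVonNBounded ℝ
      (Metric.closedBall (0 : HolderZero (Euc d) (Euc d) n (α : ℝ)) R) :=
    (NormedSpace.isVonNBounded_iff ℝ).2 Metric.isBounded_closedBall
  refine (hb.image (ofStepL d n β α)).subset fun v hv => ?_
  let f : HolderZero (Euc d) (Euc d) n (α : ℝ) := ⟨v.1, mem_holderZeroSubmodule_iff.2 ⟨R, h v hv⟩⟩
  have hf : f.1 = v.1 := rfl
  refine ⟨f, mem_closedBall_zero_iff.2 (HolderZero.norm_le_of_val_eq hf (h v hv)), ?_⟩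
  exact ext ((ofStep_val α f).trans hf)

theorem isMackeyComplete (hβ : β ∈ Ico (0 : ℝ) 1) : IsMackeyComplete (HolderPlus d n β) := by
  have := isTopologicalAddGroup (d := d) (n := n) (β := β)
  rintro x ⟨B, hB, μ, hμ, hx⟩
  obtain ⟨α, R, hR⟩ := exists_bound hβ (B := B) (by
    intro W _ _ T
    have := (NormedSpace.isVonNBounded_iff ℝ).1 (hB.image T)
    obtain ⟨C, hC⟩ := isBounded_iff_forall_norm_le.1 this
    exact ⟨C, fun v hv => hC _ ⟨v, hv, rfl⟩⟩)
  have hsub : ∀ p q, HolderBound n (α : ℝ) (|μ (p, q)| * R) fun z => (x p).1 z - (x q).1 z := by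
    intro p q
    obtain ⟨b, hb, hbx⟩ := hx p q
    have hbR := hR b hb
    let f : HolderZero (Euc d) (Euc d) n (α : ℝ) := ⟨b.1, mem_holderZeroSubmodule_iff.2 ⟨R, hbR⟩⟩
    have hf : f.1 = b.1 := rfl
    have h1 : ‖μ (p, q) • f‖ ≤ |μ (p, q)| * R := by
      rw [norm_smul, Real.norm_eq_abs]
      gcongr
      exact HolderZero.norm_le_of_val_eq hf hbR
    have h2 := (μ (p, q) • f).holderBound.mono h1
    have h3 : (μ (p, q) • f).1 = fun z => (x p).1 z - (x q).1 z := by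
      change μ (p, q) • f.1 = (x p - x q).1
      rw [hbx, hf]
      rfl
    rwa [h3] at h2
  let y : ℕ → HolderZero (Euc d) (Euc d) n (α : ℝ) := fun p =>
    ⟨fun z => (x p).1 z - (x 0).1 z, mem_holderZeroSubmodule_iff.2 ⟨_, hsub p 0⟩⟩
  have hy : ∀ p, (y p).1 = fun z => (x p).1 z - (x 0).1 z := fun p => rfl
  have hc : CauchySeq y := by
    rw [cauchySeq_iff_tendsto_dist_atTop_0]
    have ht : Tendsto (fun p : ℕ × ℕ => |μ p| * R) atTop (𝓝 0) := by
      simpa using hμ.abs.mul_const R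
    refine squeeze_zero (fun _ => dist_nonneg) (fun p => ?_) ht
    rw [dist_eq_norm]
    refine HolderZero.norm_le_of_val_eq ?_ (hsub p.1 p.2)
    rw [HolderZero.sub_val, hy, hy]
    funext z
    simp
  obtain ⟨l, hl⟩ := cauchySeq_tendsto_of_complete hc
  refine ⟨ofStepL d n β α l + x 0, ?_⟩
  refine ((((ofStepL d n β α).continuous.tendsto l).comp hl).add_const (x 0)).congr fun p => ?_
  refine ext ?_
  change (ofStep d n β α (y p)).1 + (x 0).1 = _
  rw [ofStep_val, hy]
  funext z
  simp

theorem isConvenient (hβ : β ∈ Ico (0 : ℝ) 1) : IsConvenient (HolderPlus d n β) where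
  isTopologicalAddGroup := isTopologicalAddGroup
  continuousSMul := continuousSMul
  locallyConvex := locallyConvexSpace
  t2 := t2Space hβ.1
  mackeyComplete := isMackeyComplete hβ

theorem ofStep_incl (hβ : 0 ≤ β) {α α' : Ioo β 1} (h : α' ≤ α)
    (f : HolderZero (Euc d) (Euc d) n (α : ℝ)) :
    ofStep d n β α' (HolderZero.incl (hβ.trans α'.2.1.le) h f) = ofStep d n β α f :=
  ext (by rw [ofStep_val, ofStep_val, HolderZero.incl_val])

theorem isLBSpace (hβ : β ∈ Ico (0 : ℝ) 1) : IsLBSpace (HolderPlus d n β) := by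
  refine ⟨fun k => HolderZero (Euc d) (Euc d) n (exponent hβ.2 k : ℝ), fun _ => inferInstance,
    fun _ => inferInstance, fun k => ofStep d n β (exponent hβ.2 k),
    fun k => HolderZero.incl (hβ.1.trans (exponent hβ.2 (k + 1)).2.1.le)
      (exponent_anti hβ.2 k.le_succ), fun _ => inferInstance, fun k f g hfg => ?_,
    fun k f => ofStep_incl hβ.1 _ f, fun v => ?_, ?_⟩
  · refine HolderZero.ext ?_
    rw [← ofStep_val (exponent hβ.2 k) f, ← ofStep_val (exponent hβ.2 k) g, hfg]
  · obtain ⟨α, f, rfl⟩ := exists_eq_ofStep hβ v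
    obtain ⟨k, hk⟩ := exists_exponent_le hβ.2 α
    exact ⟨k, _, ofStep_incl hβ.1 hk f⟩
  · change lcFinalTopology (ofStep d n β) = _
    refine congrArg sInf (Set.ext fun t => ?_)
    refine and_congr_right fun _ => and_congr_right fun _ => and_congr_right fun _ =>
      ⟨fun h k => h _, fun h α => ?_⟩
    obtain ⟨k, hk⟩ := exists_exponent_le hβ.2 α
    have := (h k).comp (HolderZero.incl (hβ.1.trans (exponent hβ.2 k).2.1.le) hk).continuous
    refine this.congr fun f => ?_
    exact ofStep_incl hβ.1 hk f

end HolderPlus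

/-! ### Curves in Hölder spaces -/

section HolderCurves

theorem HolderBound.const_smul {E F : Type} [NormedAddCommGroup E] [NormedSpace ℝ E]
    [NormedAddCommGroup F] [NormedSpace ℝ F] {n : ℕ} {α C : ℝ} {f : E → F} (c : ℝ)
    (h : HolderBound n α C f) : HolderBound n α (|c| * C) (fun x => c • f x) := by
  have hb : ∀ x, ‖c • f x‖ ≤ |c| * C := fun x => by
    rw [norm_smul, Real.norm_eq_abs]
    gcongr
    exact h.norm_le x
  have ht : Tendsto (fun x => c • f x) (Bornology.cobounded E) (𝓝 0) := by
    simpa using h.tendsto.const_smul c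
  induction n generalizing F with
  | zero =>
    refine ⟨h.1.const_smul c, hb, ht, fun x y => ?_⟩
    rw [← smul_sub, norm_smul, Real.norm_eq_abs, mul_assoc]
    gcongr
    exact h.2.2.2 x y
  | succ n ih =>
    refine ⟨h.1.const_smul c, hb, ht, ?_⟩
    have e : fderiv ℝ (fun x => c • f x) = fun x => c • fderiv ℝ f x := by
      funext x
      exact fderiv_fun_const_smul (h.1 x) c
    rw [e]
    refine ih h.2.2.2 (fun x => ?_) (by simpa using h.2.2.2.tendsto.const_smul c)
    rw [norm_smul, Real.norm_eq_abs]
    gcongr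
    exact h.2.2.2.norm_le x

/-- A slowly vanishing modulus of continuity dominates all powers, on bounded intervals. -/
theorem IsSlowlyVanishing.exists_inv_mul_rpow_le {ω : ℝ≥0 → ℝ≥0} (hω : IsSlowlyVanishing ω)
    {γ : ℝ} (hγ : 0 < γ) (S : ℝ) :
    ∃ C : ℝ, 0 ≤ C ∧ ∀ t s : ℝ, t ≠ s → |t - s| ≤ S →
      (ω (nndist t s) : ℝ)⁻¹ * |t - s| ^ γ ≤ C := by
  obtain ⟨c, hc0, hc⟩ := exists_between (hω.liminf_pos γ hγ)
  have hct : c ≠ ⊤ := hc.ne_top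
  lift c to ℝ≥0 using hct
  have hc0' : 0 < c := by exact_mod_cast hc0
  have hev := eventually_lt_of_lt_liminf hc
  obtain ⟨η, hη, hsub⟩ := mem_nhdsGT_iff_exists_Ioo_subset.1 hev
  have hη0 : 0 < η := hη
  have hpos : ∀ r : ℝ≥0, 0 < r → 0 < r ^ γ := fun r hr => NNReal.rpow_pos hr
  have hlt : ∀ r : ℝ≥0, 0 < r → r < η → c * r ^ γ < ω r := by
    intro r h1 h2
    have : ((c : ℝ≥0) : ℝ≥0∞) < ((ω r / r ^ γ : ℝ≥0) : ℝ≥0∞) := hsub ⟨h1, h2⟩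
    have h3 : c < ω r / r ^ γ := by exact_mod_cast this
    rwa [lt_div_iff₀ (hpos r h1)] at h3
  have hhalf : 0 < ω (η / 2) :=
    (mul_pos hc0' (hpos _ (half_pos hη0))).trans
      (hlt _ (half_pos hη0) (NNReal.half_lt_self hη0.ne'))
  refine ⟨max ((c : ℝ)⁻¹) ((ω (η / 2) : ℝ)⁻¹ * S ^ γ), le_max_of_le_left (by positivity),
    fun t s hts hS => ?_⟩
  have hr : 0 < nndist t s := by
    rw [pos_iff_ne_zero, Ne, nndist_eq_zero]
    exact hts
  have hrr : |t - s| = (nndist t s : ℝ) := by rw [coe_nndist, Real.dist_eq]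
  rcases lt_or_ge (nndist t s) η with h | h
  · refine le_max_of_le_left ?_
    have h1 : (c : ℝ) * (nndist t s : ℝ) ^ γ < ω (nndist t s) := by exact_mod_cast hlt _ hr h
    have h2 : (0 : ℝ) < c := by exact_mod_cast hc0'
    have h3 : (0 : ℝ) ≤ (nndist t s : ℝ) ^ γ := by positivity
    have h4 : (0 : ℝ) < ω (nndist t s) := (by positivity : (0 : ℝ) ≤ _).trans_lt h1
    rw [hrr, inv_mul_le_iff₀ h4, ← div_eq_mul_inv, le_div_iff₀ h2, mul_comm]
    exact h1.le
  · refine le_max_of_le_right ?_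
    have h1 : ω (η / 2) ≤ ω (nndist t s) := hω.increasing ((half_le_self hη0.le).trans h)
    have h2 : (0 : ℝ) < ω (η / 2) := by exact_mod_cast hhalf
    have h3 : (ω (η / 2) : ℝ) ≤ ω (nndist t s) := by exact_mod_cast h1
    gcongr

variable {E : Type} [NormedAddCommGroup E] [NormedSpace ℝ E] {n : ℕ} {a b : ℝ}

/-- Curves which are bounded and Lipschitz in `C₀^{n,α}` on the interval `[a, b]`. -/
def IsHolderLipschitz (n : ℕ) (α a b : ℝ) (f : ℝ → E → E) : Prop :=
  ∃ R L : ℝ, 0 ≤ L ∧ (∀ t ∈ Icc a b, HolderBound n α R (f t)) ∧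
    ∀ t ∈ Icc a b, ∀ s ∈ Icc a b, HolderBound n α (L * |t - s|) fun x => f t x - f s x

/-- The increments of the curve `f`, divided by `ω`, are bounded in `C₀^{n,α}` on the interval
`[a, b]`. -/
def IsHolderOmega (ω : ℝ≥0 → ℝ≥0) (n : ℕ) (α a b : ℝ) (f : ℝ → E → E) : Prop :=
  ∃ R : ℝ, ∀ t ∈ Icc a b, ∀ s ∈ Icc a b, t ≠ s →
    HolderBound n α R fun x => (ω (nndist t s) : ℝ)⁻¹ • (f t x - f s x)

theorem IsHolderLipschitz.exponent_mono {α α' : ℝ} (h0 : 0 ≤ α') (h : α' ≤ α) {f : ℝ → E → E}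
    (hf : IsHolderLipschitz n α a b f) : IsHolderLipschitz n α' a b f := by
  obtain ⟨R, L, hL0, hR, hL⟩ := hf
  refine ⟨2 * R, 2 * L, by linarith, fun t ht => (hR t ht).exponent_mono h0 h,
    fun t ht s hs => ?_⟩
  rw [mul_assoc]
  exact (hL t ht s hs).exponent_mono h0 h

/-- Curves whose increments are bounded by a power of the length of the interval. -/
theorem IsSlowlyVanishing.isHolderOmega {ω : ℝ≥0 → ℝ≥0} (hω : IsSlowlyVanishing ω) {α γ C L : ℝ}
    (hγ0 : 0 < γ) (hγ1 : γ ≤ 1) (hC : 0 ≤ C) (hL : 0 ≤ L) {f : ℝ → E → E}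
    (hf : ∀ t ∈ Icc a b, ∀ s ∈ Icc a b, HolderBound n α (C * (L * |t - s| + (L * |t - s|) ^ γ))
      fun x => f t x - f s x) : IsHolderOmega ω n α a b f := by
  obtain ⟨K, hK0, hK⟩ := hω.exists_inv_mul_rpow_le hγ0 (b - a)
  set S := max 1 (b - a)
  refine ⟨K * (C * (L * S + L ^ γ)), fun t ht s hs hts => ?_⟩
  refine ((hf t ht s hs).const_smul (ω (nndist t s) : ℝ)⁻¹).mono ?_
  have habs : |t - s| ≤ b - a := by
    rw [abs_le]
    constructor <;> linarith [ht.1, ht.2, hs.1, hs.2]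
  have h1 : |t - s| ≤ S * |t - s| ^ γ :=
    le_mul_rpow_self hγ0.le hγ1 (abs_nonneg _) (habs.trans (le_max_right _ _)) (le_max_left _ _)
  have h2 := hK t s hts habs
  have h3 : 0 ≤ L ^ γ := Real.rpow_nonneg hL _
  have hS : 0 ≤ S := zero_le_one.trans (le_max_left _ _)
  rw [abs_of_nonneg (by positivity), Real.mul_rpow hL (abs_nonneg _)]
  calc (ω (nndist t s) : ℝ)⁻¹ * (C * (L * |t - s| + L ^ γ * |t - s| ^ γ))
      ≤ (ω (nndist t s) : ℝ)⁻¹ * (C * (L * (S * |t - s| ^ γ) + L ^ γ * |t - s| ^ γ)) := by gcongr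
    _ = (ω (nndist t s) : ℝ)⁻¹ * |t - s| ^ γ * (C * (L * S + L ^ γ)) := by ring
    _ ≤ K * (C * (L * S + L ^ γ)) := by gcongr

theorem IsHolderLipschitz.mul {ω : ℝ≥0 → ℝ≥0} (hω : IsSlowlyVanishing ω) {α α' : ℝ}
    (h0 : 0 ≤ α') (h : α' < α) (h1 : α ≤ 1) {f g : ℝ → E → E}
    (hf : IsHolderLipschitz (n + 1) α a b f) (hg : IsHolderLipschitz (n + 1) α a b g) :
    IsHolderOmega ω (n + 1) α' a b fun t x => g t x + f t (x + g t x) := by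
  obtain ⟨R, L, hL0, hR, hL⟩ := hf
  obtain ⟨R', L', hL0', hR', hL'⟩ := hg
  obtain ⟨C, hC0, hC⟩ := HolderBound.exists_mul_sub (E := E) n h0 h.le (h0.trans_lt h) h1
    (le_max_left 0 (max R R'))
  refine hω.isHolderOmega (γ := α - α') (by linarith) (by linarith) hC0
    (hL0.trans (le_max_left L L')) fun t ht s hs => ?_
  have e1 : R ≤ max 0 (max R R') := (le_max_left _ _).trans (le_max_right _ _)
  have e2 : R' ≤ max 0 (max R R') := (le_max_right _ _).trans (le_max_right _ _)
  refine hC (f t) (f s) (g t) (g s) _ ((hR t ht).mono e1) ((hR s hs).mono e1)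
    ((hR' t ht).mono e2) ((hR' s hs).mono e2) ((hL t ht s hs).mono ?_) ((hL' t ht s hs).mono ?_)
  · gcongr
    exact le_max_left _ _
  · gcongr
    exact le_max_right _ _

theorem IsHolderLipschitz.inv [FiniteDimensional ℝ E] {ω : ℝ≥0 → ℝ≥0} (hω : IsSlowlyVanishing ω)
    {α α' : ℝ} (h0 : 0 ≤ α') (h : α' < α) (h1 : α ≤ 1) {f k : ℝ → E → E}
    (hf : IsHolderLipschitz (n + 1) α a b f) (hdet : ∀ t x, 0 < (1 + fderiv ℝ (f t) x).det)
    (hl : ∀ t x, x + k t x + f t (x + k t x) = x) (hr : ∀ t x, x + f t x + k t (x + f t x) = x) :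
    IsHolderOmega ω (n + 1) α' a b k := by
  obtain ⟨R, L, hL0, hR, hL⟩ := hf
  obtain ⟨C, hC⟩ := HolderBound.exists_inv_curve h0 h.le (h0.trans_lt h) h1 hR hL hdet hl hr
  refine hω.isHolderOmega (γ := α - α') (C := max C 0) (by linarith) (by linarith)
    (le_max_right _ _) hL0 fun t ht s hs => (hC t ht s hs).mono ?_
  gcongr
  exact le_max_left _ _

end HolderCurves

section CurvesInSpaces

variable {d n : ℕ} {β : ℝ} {ω : ℝ≥0 → ℝ≥0}

theorem HolderMinus.isHolderLipschitz {c : ℝ → HolderMinus d n β} (hc : IsSmoothCurve c)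
    (α : Ioo 0 β) (a b : ℝ) : IsHolderLipschitz n (α : ℝ) a b fun t => (c t).1 := by
  obtain ⟨L, hL0, hL⟩ := hc.exists_lipschitz (toStepL d n β α) a b
  refine ⟨‖toStep d n β α (c a)‖ + L * |b - a|, L, hL0, fun t ht => ?_, fun t ht s hs => ?_⟩
  · beta_reduce
    rw [← toStep_val α (c t)]
    refine (toStep d n β α (c t)).holderBound.mono ?_
    have h1 := hL t ht a ⟨le_rfl, ht.1.trans ht.2⟩
    have h2 : |t - a| ≤ |b - a| := by
      rw [abs_of_nonneg (sub_nonneg.2 ht.1), abs_of_nonneg (by linarith [ht.1, ht.2])]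
      linarith [ht.2]
    calc ‖toStep d n β α (c t)‖ ≤ ‖toStep d n β α (c a)‖ +
          ‖toStep d n β α (c t) - toStep d n β α (c a)‖ := norm_le_norm_add_norm_sub' _ _
      _ ≤ ‖toStep d n β α (c a)‖ + L * |t - a| := by
        gcongr
        exact h1
      _ ≤ _ := by gcongr
  · have := (toStep d n β α (c t) - toStep d n β α (c s)).holderBound.mono (hL t ht s hs)
    rwa [HolderZero.sub_val, toStep_val, toStep_val] at this

theorem HolderMinus.isC0OmegaCurve {c : ℝ → HolderMinus d n β}
    (hc : ∀ (α : Ioo 0 β) (a b : ℝ), IsHolderOmega ω n (α : ℝ) a b fun t => (c t).1) :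
    IsC0OmegaCurve ω c := by
  intro a b
  refine isVonNBounded_of_forall fun α => ?_
  obtain ⟨R, hR⟩ := hc α a b
  refine ⟨R, ?_⟩
  rintro v ⟨t, ht, s, hs, hts, rfl⟩
  exact hR t ht s hs hts

theorem HolderPlus.isHolderLipschitz (hβ : β ∈ Ico (0 : ℝ) 1) {c : ℝ → HolderPlus d n β}
    (hc : IsSmoothCurve c) (a b : ℝ) :
    ∃ α : Ioo β 1, IsHolderLipschitz n (α : ℝ) a b fun t => (c t).1 := by
  obtain ⟨α, R, hR⟩ := exists_bound hβ
    (B := insert (c a) {v | ∃ t ∈ Icc a b, ∃ s ∈ Icc a b, t ≠ s ∧ v = (t - s)⁻¹ • (c t - c s)}) (by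
      intro W _ _ T
      obtain ⟨L, hL0, hL⟩ := hc.exists_lipschitz T a b
      refine ⟨max ‖T (c a)‖ L, ?_⟩
      rintro v (rfl | ⟨t, ht, s, hs, hts, rfl⟩)
      · exact le_max_left _ _
      · refine le_max_of_le_right ?_
        have hp : 0 < |t - s| := abs_pos.2 (sub_ne_zero.2 hts)
        rw [map_smul, map_sub, norm_smul, norm_inv, Real.norm_eq_abs, inv_mul_le_iff₀ hp, mul_comm]
        exact hL t ht s hs)
  have ha := hR (c a) (mem_insert _ _)
  have hlip : ∀ t ∈ Icc a b, ∀ s ∈ Icc a b,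
      HolderBound n (α : ℝ) (R * |t - s|) fun x => (c t).1 x - (c s).1 x := by
    intro t ht s hs
    by_cases hts : t = s
    · subst hts
      simpa using HolderBound.zero (E := Euc d) (F := Euc d) n (α : ℝ) le_rfl
    · have h1 : HolderBound n (α : ℝ) R fun x => (t - s)⁻¹ • ((c t).1 x - (c s).1 x) :=
        hR _ (mem_insert_of_mem _ ⟨t, ht, s, hs, hts, rfl⟩)
      have h2 := h1.const_smul (t - s)
      simp only [smul_inv_smul₀ (sub_ne_zero.2 hts)] at h2
      rwa [mul_comm] at h2
  refine ⟨α, R + R * |b - a|, R, ha.nonneg, fun t ht => ?_, hlip⟩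
  have h1 := ha.add (hlip t ht a ⟨le_rfl, ht.1.trans ht.2⟩)
  simp only [add_sub_cancel] at h1
  refine h1.mono ?_
  have h2 : |t - a| ≤ |b - a| := by
    rw [abs_of_nonneg (sub_nonneg.2 ht.1), abs_of_nonneg (by linarith [ht.1, ht.2])]
    linarith [ht.2]
  have := ha.nonneg
  gcongr

theorem HolderPlus.isC0OmegaCurve {c : ℝ → HolderPlus d n β}
    (hc : ∀ a b : ℝ, ∃ α : Ioo β 1, IsHolderOmega ω n (α : ℝ) a b fun t => (c t).1) :
    IsC0OmegaCurve ω c := by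
  intro a b
  obtain ⟨α, R, hR⟩ := hc a b
  refine isVonNBounded_of_bound α (R := R) ?_
  rintro v ⟨t, ht, s, hs, hts, rfl⟩
  exact hR t ht s hs hts

end CurvesInSpaces

/-! ### Groups of Hölder diffeomorphisms -/

section Groups

/-- The group of all maps with property `P`, under composition, if these maps are bijective and
stable under composition and inversion. -/
@[reducible] def groupOfBijective {E : Type} (P : (E → E) → Prop) (hid : P id)
    (hcomp : ∀ Φ Ψ, P Φ → P Ψ → P (Φ ∘ Ψ)) (hbij : ∀ Φ, P Φ → Function.Bijective Φ)
    (hinv : ∀ Φ Ψ, P Φ → (∀ x, Ψ (Φ x) = x) → (∀ x, Φ (Ψ x) = x) → P Ψ) :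
    Group {Φ : E → E // P Φ} :=
  letI : Mul {Φ : E → E // P Φ} := ⟨fun Φ Ψ => ⟨Φ.1 ∘ Ψ.1, hcomp _ _ Φ.2 Ψ.2⟩⟩
  letI : One {Φ : E → E // P Φ} := ⟨⟨id, hid⟩⟩
  letI : Inv {Φ : E → E // P Φ} := ⟨fun Φ => ⟨(Equiv.ofBijective Φ.1 (hbij _ Φ.2)).symm,
    hinv _ _ Φ.2 (Equiv.ofBijective Φ.1 (hbij _ Φ.2)).symm_apply_apply
      (Equiv.ofBijective Φ.1 (hbij _ Φ.2)).apply_symm_apply⟩⟩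
  Group.ofLeftAxioms (fun _ _ _ => rfl) (fun _ => rfl)
    fun Φ => Subtype.ext (funext (Equiv.ofBijective Φ.1 (hbij _ Φ.2)).symm_apply_apply)

variable {E : Type} [NormedAddCommGroup E] [NormedSpace ℝ E] {n : ℕ} {α : ℝ}

/-- The maps in `id + C₀^{n,α}` whose derivative has positive determinant everywhere. -/
def IsHolderDiffeo (n : ℕ) (α : ℝ) (Φ : E → E) : Prop :=
  Φ - id ∈ holderZeroSubmodule E E n α ∧ ∀ x, 0 < (fderiv ℝ Φ x).det

theorem hasFDerivAt_one_add {Φ : E → E} (h : Differentiable ℝ (Φ - id)) (x : E) :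
    HasFDerivAt Φ (1 + fderiv ℝ (Φ - id) x) x := by
  have := (hasFDerivAt_id (𝕜 := ℝ) x).add (h x).hasFDerivAt
  refine this.congr_of_eventuallyEq (Eventually.of_forall fun y => ?_)
  simp

theorem comp_sub_id {E : Type} [AddCommGroup E] (Φ Ψ : E → E) :
    Φ ∘ Ψ - id = fun x => (Ψ - id : E → E) x + (Φ - id : E → E) (x + (Ψ - id : E → E) x) := by
  funext x
  simp

theorem sub_id_left_inverse {E : Type} [AddCommGroup E] {Φ Ψ : E → E} (h : ∀ x, Ψ (Φ x) = x)
    (x : E) :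
    x + (Φ - id : E → E) x + (Ψ - id : E → E) (x + (Φ - id : E → E) x) = x := by
  simp [h]

theorem isHolderDiffeo_id (n : ℕ) (α : ℝ) : IsHolderDiffeo n α (id : E → E) := by
  refine ⟨?_, fun x => ?_⟩
  · rw [sub_self]
    exact (holderZeroSubmodule E E n α).zero_mem
  · rw [fderiv_id]
    simp [ContinuousLinearMap.det]

namespace IsHolderDiffeo

variable {Φ Ψ : E → E}

theorem differentiable_sub_id (h : IsHolderDiffeo (n + 1) α Φ) : Differentiable ℝ (Φ - id) :=
  h.1.1.differentiable (by simp)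

theorem det_pos (h : IsHolderDiffeo (n + 1) α Φ) (x : E) :
    0 < (1 + fderiv ℝ (Φ - id) x).det := by
  rw [← (hasFDerivAt_one_add h.differentiable_sub_id x).fderiv]
  exact h.2 x

theorem exists_holderBound (h : IsHolderDiffeo n α Φ) : ∃ R, HolderBound n α R (Φ - id) :=
  mem_holderZeroSubmodule_iff.1 h.1

theorem comp (h0 : 0 ≤ α) (h1 : α ≤ 1) (hΦ : IsHolderDiffeo (n + 1) α Φ)
    (hΨ : IsHolderDiffeo (n + 1) α Ψ) : IsHolderDiffeo (n + 1) α (Φ ∘ Ψ) := by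
  refine ⟨?_, fun x => ?_⟩
  · rw [comp_sub_id]
    exact holderZeroSubmodule_comp_mem h0 h1 hΦ.1 hΨ.1
  · have d1 := (hasFDerivAt_one_add hΦ.differentiable_sub_id (Ψ x)).differentiableAt
    have d2 := (hasFDerivAt_one_add hΨ.differentiable_sub_id x).differentiableAt
    rw [fderiv_comp x d1 d2]
    have : ((fderiv ℝ Φ (Ψ x)).comp (fderiv ℝ Ψ x)).det =
        (fderiv ℝ Φ (Ψ x)).det * (fderiv ℝ Ψ x).det := LinearMap.det_comp _ _
    rw [this]
    exact mul_pos (hΦ.2 _) (hΨ.2 _)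

variable [FiniteDimensional ℝ E]

theorem bijective (hΦ : IsHolderDiffeo (n + 1) α Φ) : Function.Bijective Φ := by
  obtain ⟨R, hR⟩ := hΦ.exists_holderBound
  have := bijective_id_add hR.contDiff_one hR.norm_le hR.2.2.2.tendsto fun x => (hΦ.det_pos x).ne'
  simpa using this

theorem of_inverse (h0 : 0 ≤ α) (h1 : α ≤ 1) (hΦ : IsHolderDiffeo (n + 1) α Φ)
    (hl : ∀ x, Ψ (Φ x) = x) (hr : ∀ x, Φ (Ψ x) = x) : IsHolderDiffeo (n + 1) α Ψ := by
  obtain ⟨R, hR⟩ := hΦ.exists_holderBound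
  have hl' := sub_id_left_inverse hl
  have hr' := sub_id_left_inverse hr
  have hm := exists_inverse_mem h0 h1 hΦ.1 hΦ.det_pos hr' hl'
  refine ⟨hm, fun x => ?_⟩
  rw [(hasFDerivAt_one_add (hm.1.differentiable (by simp)) x).fderiv]
  obtain ⟨T, hT, h2, -⟩ := hasFDerivAt_inverse hR.contDiff_one (fun x => (hΦ.det_pos x).ne')
    hr' hl' x
  rw [hT.fderiv]
  have h3 : (1 + fderiv ℝ (Φ - id) (x + (Ψ - id : E → E) x)).det * (1 + T).det = 1 := by
    have h4 := LinearMap.det_comp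
      (1 + fderiv ℝ (Φ - id) (x + (Ψ - id : E → E) x) : E →L[ℝ] E).toLinearMap
      (1 + T : E →L[ℝ] E).toLinearMap
    have h5 : ((1 + fderiv ℝ (Φ - id) (x + (Ψ - id : E → E) x)) * (1 + T)).det = 1 := by
      rw [h2]
      simp [ContinuousLinearMap.det]
    exact h4.symm.trans h5
  exact pos_of_mul_pos_right (h3 ▸ one_pos) (hΦ.det_pos _).le

end IsHolderDiffeo

/-- The condition `det (1 + df) > 0` defines an open set in `C₀^{n,α}`, for `1 ≤ n`. -/
theorem isOpen_setOf_det_pos [FiniteDimensional ℝ E] (n : ℕ) (α : ℝ) :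
    IsOpen {g : HolderZero E E (n + 1) α | ∀ x, 0 < (1 + fderiv ℝ g.1 x).det} := by
  rw [Metric.isOpen_iff]
  intro g hg
  have hb := g.holderBound
  obtain ⟨δ, hδ, M, hM⟩ := exists_det_pos_and_inverse_bound hb.2.2.2.continuous
    hb.2.2.2.tendsto hg
  refine ⟨δ, hδ, fun f hf => (hM f.1 fun x => ?_).1⟩
  rw [mem_ball_iff_norm] at hf
  have := ((f - g).holderBound.mono hf.le).2.2.2.norm_le x
  rwa [HolderZero.sub_val, fderiv_sub (f.holderBound.1 x) (hb.1 x)] at this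

end Groups

section DiffMinus

variable {d n : ℕ} {β : ℝ}

namespace DiffMinus

theorem prop_iff (hβ : 0 < β) {Φ : Euc d → Euc d} :
    (Φ - id ∈ holderMinusSubmodule d n β ∧ ∀ x, 0 < (fderiv ℝ Φ x).det) ↔
      ∀ α ∈ Ioo 0 β, IsHolderDiffeo n α Φ := by
  rw [mem_holderMinusSubmodule]
  constructor
  · exact fun h α hα => ⟨h.1 α hα, h.2⟩
  · exact fun h => ⟨fun α hα => (h α hα).1, (h (β / 2) ⟨by linarith, by linarith⟩).2⟩

theorem isHolderDiffeo (hβ : 0 < β) (Φ : DiffMinus d n β) {α : ℝ} (hα : α ∈ Ioo 0 β) :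
    IsHolderDiffeo n α Φ.1 := (prop_iff hβ).1 Φ.2 α hα

/-- The group structure of `𝒟^{n,β-}`, given by composition. -/
@[reducible] def group (d n : ℕ) (hβ : β ∈ Ioc (0 : ℝ) 1) : Group (DiffMinus d (n + 1) β) :=
  groupOfBijective
    (fun Φ : Euc d → Euc d =>
      Φ - id ∈ holderMinusSubmodule d (n + 1) β ∧ ∀ x, 0 < (fderiv ℝ Φ x).det)
    ((prop_iff hβ.1).2 fun _ _ => isHolderDiffeo_id _ _)
    (fun _ _ hΦ hΨ => (prop_iff hβ.1).2 fun α hα =>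
      ((prop_iff hβ.1).1 hΦ α hα).comp hα.1.le (hα.2.le.trans hβ.2) ((prop_iff hβ.1).1 hΨ α hα))
    (fun _ hΦ => ((prop_iff hβ.1).1 hΦ (β / 2)
      ⟨by linarith [hβ.1], by linarith [hβ.1]⟩).bijective)
    (fun _ _ hΦ hl hr => (prop_iff hβ.1).2 fun α hα =>
      ((prop_iff hβ.1).1 hΦ α hα).of_inverse hα.1.le (hα.2.le.trans hβ.2) hl hr)

theorem isOpenEmbedding_chart (hβ : 0 < β) : IsOpenEmbedding (chart d (n + 1) β) := by
  refine ⟨⟨⟨rfl⟩, fun Φ Ψ h => Subtype.ext ?_⟩, ?_⟩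
  · have := congrArg (fun v => v.1) h
    exact sub_left_injective this
  · let α : Ioo 0 β := ⟨β / 2, by linarith, by linarith⟩
    have ho := (isOpen_setOf_det_pos (E := Euc d) n α).preimage
      (HolderMinus.toStepL d (n + 1) β α).continuous
    convert ho using 1
    ext v
    simp only [mem_range, mem_preimage, mem_ofPred_eq]
    have hv : (HolderMinus.toStepL d (n + 1) β α v).1 = v.1 := HolderMinus.toStep_val α v
    rw [hv]
    constructor
    · rintro ⟨Φ, rfl⟩
      exact (isHolderDiffeo hβ Φ α.2).det_pos
    · intro h
      have hd : Differentiable ℝ v.1 :=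
        (HolderMinus.toStep_val α v ▸ (HolderMinus.toStep d (n + 1) β α v).holderBound :
          HolderBound (n + 1) (α : ℝ) _ v.1).1
      have he : (id + v.1) - id = v.1 := add_sub_cancel_left _ _
      refine ⟨⟨id + v.1, he.symm ▸ v.2, fun x => ?_⟩, HolderMinus.ext he⟩
      rw [(hasFDerivAt_one_add (he.symm ▸ hd) x).fderiv, he]
      exact h x

theorem isC0OmegaLieGroup {ω : ℝ≥0 → ℝ≥0} (hω : IsSlowlyVanishing ω) (hβ : β ∈ Ioc (0 : ℝ) 1) :
    @IsC0OmegaLieGroup (HolderMinus d (n + 1) β) _ _ _ ω _ (group d n hβ) _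
      (chart d (n + 1) β) := by
  let := group d n hβ
  have hmid : ∀ α : Ioo 0 β, ((α : ℝ) + β) / 2 ∈ Ioo 0 β := fun α =>
    ⟨by linarith [α.2.1, hβ.1], by linarith [α.2.2]⟩
  have hlt : ∀ α : Ioo 0 β, (α : ℝ) < ((α : ℝ) + β) / 2 := fun α => by linarith [α.2.2]
  refine ⟨HolderMinus.isConvenient hβ.1, isOpenEmbedding_chart hβ.1, fun c hc => ?_, fun c hc => ?_⟩
  · refine HolderMinus.isC0OmegaCurve fun α a b => ?_
    have h1 := HolderMinus.isHolderLipschitz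
      (hc.map (ContinuousLinearMap.fst ℝ (HolderMinus d (n + 1) β) (HolderMinus d (n + 1) β)))
      ⟨_, hmid α⟩ a b
    have h2 := HolderMinus.isHolderLipschitz
      (hc.map (ContinuousLinearMap.snd ℝ (HolderMinus d (n + 1) β) (HolderMinus d (n + 1) β)))
      ⟨_, hmid α⟩ a b
    have h3 := h1.mul hω α.2.1.le (hlt α)
      ((hmid α).2.le.trans hβ.2) h2
    convert h3 using 2 with t
    exact comp_sub_id (E := Euc d) (c t).1.1 (c t).2.1
  · refine HolderMinus.isC0OmegaCurve fun α a b => ?_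
    have h1 := HolderMinus.isHolderLipschitz hc ⟨_, hmid α⟩ a b
    refine IsHolderLipschitz.inv (E := Euc d) (n := n) hω α.2.1.le (hlt α)
      ((hmid α).2.le.trans hβ.2) h1 (fun t => (isHolderDiffeo hβ.1 (c t) (hmid α)).det_pos)
      (fun t => ?_) (fun t => ?_)
    · exact sub_id_left_inverse fun x =>
        congrFun (congrArg Subtype.val (mul_inv_cancel (c t))) x
    · exact sub_id_left_inverse fun x =>
        congrFun (congrArg Subtype.val (inv_mul_cancel (c t))) x

/-- The norm of `C₀^{n,α}` applied to the difference of two diffeomorphisms; these are the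
seminorms of the chart, and they generate the topology. -/
def chartDist (α : Ioo 0 β) (Φ Ψ : DiffMinus d n β) : ℝ :=
  ‖HolderMinus.toStep d n β α (chart d n β Φ) - HolderMinus.toStep d n β α (chart d n β Ψ)‖

theorem chartDist_nonneg (α : Ioo 0 β) (Φ Ψ : DiffMinus d n β) : 0 ≤ chartDist α Φ Ψ :=
  norm_nonneg _

theorem chartDist_self (α : Ioo 0 β) (Φ : DiffMinus d n β) : chartDist α Φ Φ = 0 := by
  simp [chartDist]

theorem holderBound_chartDist (α : Ioo 0 β) (Φ Ψ : DiffMinus d n β) :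
    HolderBound n (α : ℝ) (chartDist α Φ Ψ)
      fun x => (Φ.1 - id : Euc d → Euc d) x - (Ψ.1 - id : Euc d → Euc d) x := by
  have := (HolderMinus.toStep d n β α (chart d n β Φ) -
    HolderMinus.toStep d n β α (chart d n β Ψ)).holderBound
  rwa [HolderZero.sub_val, HolderMinus.toStep_val, HolderMinus.toStep_val] at this

theorem chartDist_le {α : Ioo 0 β} {Φ Ψ : DiffMinus d n β} {C : ℝ}
    (h : HolderBound n (α : ℝ) C
      fun x => (Φ.1 - id : Euc d → Euc d) x - (Ψ.1 - id : Euc d → Euc d) x) :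
    chartDist α Φ Ψ ≤ C := by
  refine HolderZero.norm_le_of_val_eq ?_ h
  rw [HolderZero.sub_val, HolderMinus.toStep_val, HolderMinus.toStep_val]
  rfl

theorem tendsto_nhds_iff (hβ : 0 < β) {ι : Type*} {l : Filter ι} {u : ι → DiffMinus d (n + 1) β}
    {Φ : DiffMinus d (n + 1) β} :
    Tendsto u l (𝓝 Φ) ↔ ∀ α, Tendsto (fun i => chartDist α (u i) Φ) l (𝓝 0) := by
  rw [(isOpenEmbedding_chart hβ).isInducing.tendsto_nhds_iff, HolderMinus.tendsto_iff]
  exact forall_congr' fun α => tendsto_iff_norm_sub_tendsto_zero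

/-- Diffeomorphisms at distance at most one from a given one are uniformly bounded. -/
theorem exists_holderBound_of_chartDist_le_one (hβ : 0 < β) (α : Ioo 0 β)
    (Φ₀ : DiffMinus d (n + 1) β) : ∃ R : ℝ, 0 ≤ R ∧
      HolderBound (n + 1) (α : ℝ) R (Φ₀.1 - id) ∧
      ∀ Φ, chartDist α Φ Φ₀ ≤ 1 → HolderBound (n + 1) (α : ℝ) R (Φ.1 - id) := by
  obtain ⟨R, hR⟩ := (isHolderDiffeo hβ Φ₀ α.2).exists_holderBound
  refine ⟨R + 1, by linarith [hR.nonneg], hR.mono (by linarith), fun Φ hΦ => ?_⟩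
  have h := hR.add ((holderBound_chartDist α Φ Φ₀).mono hΦ)
  convert h using 1
  ext1 x
  simp

theorem _root_.tendsto_mul_add_rpow {ι : Type*} {l : Filter ι} {δ : ι → ℝ} (C : ℝ) {γ : ℝ}
    (hγ : 0 < γ) (hδ : Tendsto δ l (𝓝 0)) :
    Tendsto (fun i => C * (δ i + δ i ^ γ)) l (𝓝 0) := by
  have h1 := hδ.rpow_const (p := γ) (Or.inr hγ.le)
  rw [Real.zero_rpow hγ.ne'] at h1
  simpa using (hδ.add h1).const_mul C

theorem tendsto_mul (hβ : β ∈ Ioc (0 : ℝ) 1) {ι : Type*} {l : Filter ι}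
    {u v : ι → DiffMinus d (n + 1) β} {Φ Ψ : DiffMinus d (n + 1) β} (hu : Tendsto u l (𝓝 Φ))
    (hv : Tendsto v l (𝓝 Ψ)) :
    letI := group d n hβ
    Tendsto (fun i => u i * v i) l (𝓝 (Φ * Ψ)) := by
  let := group d n hβ
  refine (tendsto_nhds_iff hβ.1).2 fun α => ?_
  -- The estimate in the exponent `α` costs a bound in a strictly larger exponent `α'`.
  obtain ⟨α', hα'⟩ : ∃ α' : Ioo 0 β, (α : ℝ) < α' := by
    obtain ⟨a, ha, hb⟩ := exists_between α.2.2
    exact ⟨⟨a, α.2.1.trans ha, hb⟩, ha⟩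
  have h1 := (tendsto_nhds_iff hβ.1).1 hu α'
  have h2 := (tendsto_nhds_iff hβ.1).1 hv α'
  obtain ⟨R₁, hR₁, hb₁, hB₁⟩ := exists_holderBound_of_chartDist_le_one hβ.1 α' Φ
  obtain ⟨R₂, hR₂, hb₂, hB₂⟩ := exists_holderBound_of_chartDist_le_one hβ.1 α' Ψ
  obtain ⟨C, hC0, hC⟩ := HolderBound.exists_mul_sub (E := Euc d) n α.2.1.le hα'.le
    α'.2.1 (α'.2.2.le.trans hβ.2) (hR₁.trans (le_max_left R₁ R₂))
  have h3 := h1.add h2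
  rw [add_zero] at h3
  refine squeeze_zero' (Eventually.of_forall fun _ => chartDist_nonneg _ _ _) ?_
    (tendsto_mul_add_rpow C (sub_pos.2 hα') h3)
  filter_upwards [h1.eventually_le_const one_pos, h2.eventually_le_const one_pos] with i hi1 hi2
  refine chartDist_le ?_
  have := hC _ _ _ _ _ ((hB₁ _ hi1).mono (le_max_left _ _)) (hb₁.mono (le_max_left _ _))
    ((hB₂ _ hi2).mono (le_max_right _ _)) (hb₂.mono (le_max_right _ _))
    ((holderBound_chartDist α' (u i) Φ).mono (le_add_of_nonneg_right (chartDist_nonneg α' _ _)))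
    ((holderBound_chartDist α' (v i) Ψ).mono (le_add_of_nonneg_left (chartDist_nonneg α' _ _)))
  have e1 : (u i * v i).1 - id = _ := comp_sub_id (E := Euc d) (u i).1 (v i).1
  have e2 : (Φ * Ψ).1 - id = _ := comp_sub_id (E := Euc d) Φ.1 Ψ.1
  rw [e1, e2]
  exact this

theorem tendsto_inv (hβ : β ∈ Ioc (0 : ℝ) 1) (Φ₀ : DiffMinus d (n + 1) β) :
    letI := group d n hβ
    Tendsto (fun Φ : DiffMinus d (n + 1) β => Φ⁻¹) (𝓝 Φ₀) (𝓝 Φ₀⁻¹) := by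
  let := group d n hβ
  refine (tendsto_nhds_iff hβ.1).2 fun α => ?_
  obtain ⟨α', hα'⟩ : ∃ α' : Ioo 0 β, (α : ℝ) < α' := by
    obtain ⟨a, ha, hb⟩ := exists_between α.2.2
    exact ⟨⟨a, α.2.1.trans ha, hb⟩, ha⟩
  obtain ⟨R, hR, hb, hB⟩ := exists_holderBound_of_chartDist_le_one hβ.1 α' Φ₀
  obtain ⟨δ, hδ, K, hK⟩ := hb.exists_inverse_bound α'.2.1.le (α'.2.2.le.trans hβ.2)
    (isHolderDiffeo hβ.1 Φ₀ α'.2).det_pos R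
  obtain ⟨C, hC0, hC⟩ := HolderBound.exists_inv_sub (E := Euc d) n α.2.1.le hα'.le
    α'.2.1 (α'.2.2.le.trans hβ.2) (hR.trans (le_max_left R K))
  have hl : ∀ Φ : DiffMinus d (n + 1) β, ∀ x, Φ⁻¹.1 (Φ.1 x) = x := fun Φ x =>
    congrFun (congrArg Subtype.val (inv_mul_cancel Φ)) x
  have hr : ∀ Φ : DiffMinus d (n + 1) β, ∀ x, Φ.1 (Φ⁻¹.1 x) = x := fun Φ x =>
    congrFun (congrArg Subtype.val (mul_inv_cancel Φ)) x
  have h1 := (tendsto_nhds_iff hβ.1).1 (tendsto_id (x := 𝓝 Φ₀)) α'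
  refine squeeze_zero' (Eventually.of_forall fun _ => chartDist_nonneg _ _ _) ?_
    (tendsto_mul_add_rpow C (sub_pos.2 hα') h1)
  have hb0 : chartDist α' Φ₀ Φ₀ ≤ δ := (chartDist_self α' Φ₀).trans_le hδ.le
  filter_upwards [h1.eventually_le_const one_pos, h1.eventually_le_const hδ] with Φ hΦ1 hΦδ
  refine chartDist_le ?_
  have hinv : ∀ Ψ : DiffMinus d (n + 1) β, HolderBound (n + 1) (α' : ℝ) R (Ψ.1 - id) →
      chartDist α' Ψ Φ₀ ≤ δ →
      HolderBound (n + 1) (α' : ℝ) (max R K) (Ψ⁻¹.1 - id) := fun Ψ h1 h2 =>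
    (hK _ _ h1 ((holderBound_chartDist α' Ψ Φ₀).mono h2) (sub_id_left_inverse (hr Ψ))
      (sub_id_left_inverse (hl Ψ))).mono (le_max_right _ _)
  exact hC _ _ _ _ _ ((hB Φ hΦ1).mono (le_max_left _ _)) (hb.mono (le_max_left _ _))
    (hinv Φ (hB Φ hΦ1) hΦδ) (hinv Φ₀ hb hb0) (sub_id_left_inverse (hl Φ))
    (sub_id_left_inverse (hr Φ₀)) (holderBound_chartDist α' Φ Φ₀)

theorem isTopologicalGroup (hβ : β ∈ Ioc (0 : ℝ) 1) :
    @IsTopologicalGroup (DiffMinus d (n + 1) β) _ (group d n hβ) := by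
  let := group d n hβ
  exact
    { continuous_mul := continuous_iff_continuousAt.2 fun p =>
        tendsto_mul hβ (continuous_fst.tendsto p) (continuous_snd.tendsto p)
      continuous_inv := continuous_iff_continuousAt.2 (tendsto_inv hβ) }

end DiffMinus

end DiffMinus

section DiffPlus

variable {d n : ℕ} {β : ℝ}

namespace DiffPlus

theorem prop_iff (hβ : β ∈ Ico (0 : ℝ) 1) {Φ : Euc d → Euc d} :
    (Φ - id ∈ holderPlusSubmodule d n β ∧ ∀ x, 0 < (fderiv ℝ Φ x).det) ↔
      ∃ α ∈ Ioo β 1, IsHolderDiffeo n α Φ := by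
  rw [mem_holderPlusSubmodule hβ]
  exact ⟨fun ⟨⟨α, hα, h⟩, h'⟩ => ⟨α, hα, h, h'⟩, fun ⟨α, hα, h, h'⟩ => ⟨⟨α, hα, h⟩, h'⟩⟩

theorem exists_isHolderDiffeo (hβ : β ∈ Ico (0 : ℝ) 1) (Φ : DiffPlus d n β) :
    ∃ α ∈ Ioo β 1, IsHolderDiffeo n α Φ.1 := (prop_iff hβ).1 Φ.2

/-- The group structure of `𝒟^{n,β+}`, given by composition. -/
@[reducible] def group (d n : ℕ) (hβ : β ∈ Ico (0 : ℝ) 1) : Group (DiffPlus d (n + 1) β) :=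
  groupOfBijective
    (fun Φ : Euc d → Euc d =>
      Φ - id ∈ holderPlusSubmodule d (n + 1) β ∧ ∀ x, 0 < (fderiv ℝ Φ x).det)
    ((prop_iff hβ).2 ⟨(β + 1) / 2, ⟨by linarith [hβ.2], by linarith [hβ.2]⟩,
      isHolderDiffeo_id _ _⟩)
    (fun Φ Ψ hΦ hΨ => (prop_iff hβ).2 (by
      obtain ⟨α, hα, h⟩ := (prop_iff hβ).1 hΦ
      obtain ⟨α', hα', h'⟩ := (prop_iff hβ).1 hΨ
      have h0 : 0 ≤ min α α' := hβ.1.trans (le_min hα.1.le hα'.1.le)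
      exact ⟨min α α', ⟨lt_min hα.1 hα'.1, (min_le_left _ _).trans_lt hα.2⟩,
        IsHolderDiffeo.comp h0 ((min_le_left _ _).trans hα.2.le)
          ⟨holderZeroSubmodule_anti h0 (min_le_left _ _) h.1, h.2⟩
          ⟨holderZeroSubmodule_anti h0 (min_le_right _ _) h'.1, h'.2⟩⟩))
    (fun Φ hΦ => by
      obtain ⟨α, hα, h⟩ := (prop_iff hβ).1 hΦ
      exact h.bijective)
    (fun Φ Ψ hΦ hl hr => (prop_iff hβ).2 (by
      obtain ⟨α, hα, h⟩ := (prop_iff hβ).1 hΦ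
      exact ⟨α, hα, h.of_inverse (hβ.1.trans hα.1.le) hα.2.le hl hr⟩))

theorem isOpenEmbedding_chart (hβ : β ∈ Ico (0 : ℝ) 1) : IsOpenEmbedding (chart d (n + 1) β) := by
  refine ⟨⟨⟨rfl⟩, fun Φ Ψ h => Subtype.ext ?_⟩, ?_⟩
  · have := congrArg (fun v => v.1) h
    exact sub_left_injective this
  · have ho := (isOpen_setOf_det_pos (E := Euc d) n 0).preimage
      (HolderPlus.toZero (d := d) (n := n + 1) hβ.1).continuous
    convert ho using 1
    ext v
    simp only [mem_range, mem_preimage, mem_ofPred_eq]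
    rw [HolderPlus.toZero_val]
    constructor
    · rintro ⟨Φ, rfl⟩
      obtain ⟨α, hα, h⟩ := exists_isHolderDiffeo hβ Φ
      exact h.det_pos
    · intro h
      have hd : Differentiable ℝ v.1 := (HolderPlus.contDiff hβ.1 v).differentiable (by simp)
      have he : (id + v.1) - id = v.1 := add_sub_cancel_left _ _
      refine ⟨⟨id + v.1, he.symm ▸ v.2, fun x => ?_⟩, HolderPlus.ext he⟩
      rw [(hasFDerivAt_one_add (he.symm ▸ hd) x).fderiv, he]
      exact h x

theorem isC0OmegaLieGroup {ω : ℝ≥0 → ℝ≥0} (hω : IsSlowlyVanishing ω) (hβ : β ∈ Ico (0 : ℝ) 1) :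
    @IsC0OmegaLieGroup (HolderPlus d (n + 1) β) _ _ _ ω _ (group d n hβ) _
      (chart d (n + 1) β) := by
  let := group d n hβ
  have hmid : ∀ {α : ℝ}, α ∈ Ioo β 1 → (β + α) / 2 ∈ Ioo β 1 ∧ (β + α) / 2 < α := fun hα =>
    ⟨⟨by linarith [hα.1], by linarith [hα.1, hα.2]⟩, by linarith [hα.1]⟩
  refine ⟨HolderPlus.isConvenient hβ, isOpenEmbedding_chart hβ, fun c hc => ?_, fun c hc => ?_⟩
  · refine HolderPlus.isC0OmegaCurve fun a b => ?_
    obtain ⟨α₁, h1⟩ := HolderPlus.isHolderLipschitz hβ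
      (hc.map (ContinuousLinearMap.fst ℝ (HolderPlus d (n + 1) β) (HolderPlus d (n + 1) β))) a b
    obtain ⟨α₂, h2⟩ := HolderPlus.isHolderLipschitz hβ
      (hc.map (ContinuousLinearMap.snd ℝ (HolderPlus d (n + 1) β) (HolderPlus d (n + 1) β))) a b
    have hα : min (α₁ : ℝ) α₂ ∈ Ioo β 1 :=
      ⟨lt_min α₁.2.1 α₂.2.1, (min_le_left _ _).trans_lt α₁.2.2⟩
    have h0 := hβ.1.trans hα.1.le
    have h3 := IsHolderLipschitz.mul (E := Euc d) (n := n) hω (hβ.1.trans (hmid hα).1.1.le)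
      (hmid hα).2 hα.2.le (h1.exponent_mono h0 (min_le_left _ _))
      (h2.exponent_mono h0 (min_le_right _ _))
    refine ⟨⟨_, (hmid hα).1⟩, ?_⟩
    convert h3 using 2 with t
    exact comp_sub_id (E := Euc d) (c t).1.1 (c t).2.1
  · refine HolderPlus.isC0OmegaCurve fun a b => ?_
    obtain ⟨α, h1⟩ := HolderPlus.isHolderLipschitz hβ hc a b
    refine ⟨⟨_, (hmid α.2).1⟩, ?_⟩
    refine IsHolderLipschitz.inv (E := Euc d) (n := n) hω (hβ.1.trans (hmid α.2).1.1.le)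
      (hmid α.2).2 α.2.2.le h1 (fun t => ?_) (fun t => ?_) (fun t => ?_)
    · obtain ⟨α', hα', h⟩ := exists_isHolderDiffeo hβ (c t)
      exact h.det_pos
    · exact sub_id_left_inverse fun x =>
        congrFun (congrArg Subtype.val (mul_inv_cancel (c t))) x
    · exact sub_id_left_inverse fun x =>
        congrFun (congrArg Subtype.val (inv_mul_cancel (c t))) x

end DiffPlus

end DiffPlus

theorem mainTheorem4 (d n : ℕ) (hn : 1 ≤ n) (ω : ℝ≥0 → ℝ≥0) (hω : IsSlowlyVanishing ω) :
    (∀ β ∈ Ioc (0 : ℝ) 1,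
      IsFrechetSpace (HolderMinus d n β) ∧
      ∃ _ : Group (DiffMinus d n β),
        (∀ Φ Ψ : DiffMinus d n β, (Φ * Ψ).1 = Φ.1 ∘ Ψ.1) ∧
        IsC0OmegaLieGroup ω (DiffMinus.chart d n β) ∧
        IsTopologicalGroup (DiffMinus d n β)) ∧
    (∀ β ∈ Ico (0 : ℝ) 1,
      IsLBSpace (HolderPlus d n β) ∧
      ∃ _ : Group (DiffPlus d n β),
        (∀ Φ Ψ : DiffPlus d n β, (Φ * Ψ).1 = Φ.1 ∘ Ψ.1) ∧
        IsC0OmegaLieGroup ω (DiffPlus.chart d n β)) := by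
  obtain ⟨m, rfl⟩ := Nat.exists_eq_succ_of_ne_zero (Nat.one_le_iff_ne_zero.1 hn)
  exact ⟨fun β hβ => ⟨HolderMinus.isFrechetSpace hβ.1, DiffMinus.group d m hβ, fun _ _ => rfl,
    DiffMinus.isC0OmegaLieGroup hω hβ, DiffMinus.isTopologicalGroup hβ⟩,
    fun β hβ => ⟨HolderPlus.isLBSpace hβ, DiffPlus.group d m hβ, fun _ _ => rfl,
    DiffPlus.isC0OmegaLieGroup hω hβ⟩⟩
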